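/- For every nonnegative integer $d$ there is a constant $\varepsilon_d \in (0,1)$ such that, by a deterministic algorithm running in time $\tilde{O}(m\,n^{1-\varepsilon_d})$, one can decide whether a connected, undirected, unweighted graph $G$ with $n$ vertices, $m$ edges and VC-dimension at most $d$ has diameter equal to two, and likewise whether it has diameter at most two. Here the VC-dimension of $G$ is the largest cardinality of a vertex set $Y$ such that every subset of $Y$ has the form $Y\cap N_G[v]$ for some vertex $v$, where $N_G[v]$ is the closed neighbourhood of $v$. The graph is given by its adjacency lists (in any order); for each $d$ the algorithm is a fixed program for a word RAM with unit-cost operations, which is correct and meets the time bound for every word length $w\ge \kappa_d\,(\lfloor\log_2 n\rfloor+1)$; and the time bound means at most $C_d\,\bigl(m\,n^{1-\varepsilon_d}(\log n)^{k_d}+1\bigr)$ steps, where the constants $C_d, k_d, \kappa_d$ depend only on $d$. -/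

import Mathlib

/-! ## Deterministic word RAM

The machine has finitely many registers and finitely many arrays (those named in the program), all of
whose cells hold words of `w` bits, that is, natural numbers below `2 ^ w`. Array cells are addressed
indirectly, by computed words. Programs are structured (sequencing, branching, loops), and every
elementary operation has unit cost. The program does not depend on `w`. -/

namespace WordRAM

/-- Arithmetic operations and comparisons on words. -/
inductive BinOp where
  | add | sub | mul | div | mod | lt | eq
  deriving DecidableEq

/-- Value of an operation on `w`-bit words; results are reduced modulo `2 ^ w`.
Subtraction is truncated at `0`, division is integer division, comparisons return `1` or `0`. -/
def BinOp.eval (w : ℕ) : BinOp → ℕ → ℕ → ℕ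
  | .add, a, b => (a + b) % 2 ^ w
  | .sub, a, b => (a - b) % 2 ^ w
  | .mul, a, b => (a * b) % 2 ^ w
  | .div, a, b => (a / b) % 2 ^ w
  | .mod, a, b => (a % b) % 2 ^ w
  | .lt, a, b => (if a < b then 1 else 0) % 2 ^ w
  | .eq, a, b => (if a = b then 1 else 0) % 2 ^ w

/-- Expressions: constants, registers, array cells and operations. -/
inductive Exp where
  | lit (c : ℕ)
  | reg (x : ℕ)
  | get (a : ℕ) (i : Exp)
  | op (o : BinOp) (e₁ e₂ : Exp)

/-- Contents of the memory: `reg x` is register `x`, and `arr a i` is cell `i` of array `a`. -/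
@[ext] structure State where
  reg : ℕ → ℕ
  arr : ℕ → ℕ → ℕ

/-- Value of an expression in a given state. -/
def Exp.eval (w : ℕ) (s : State) : Exp → ℕ
  | .lit c => c % 2 ^ w
  | .reg x => s.reg x
  | .get a i => s.arr a (i.eval w s)
  | .op o e₁ e₂ => o.eval w (e₁.eval w s) (e₂.eval w s)

/-- Number of elementary operations (constants, register reads, memory accesses, arithmetic) that
the evaluation of an expression takes. -/
def Exp.cost : Exp → ℕ
  | .lit _ => 1
  | .reg _ => 1
  | .get _ i => i.cost + 1
  | .op _ e₁ e₂ => e₁.cost + e₂.cost + 1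

/-- Programs. The name of the register or of the array is fixed in the program text, while the
index of an array cell is computed. -/
inductive Prog where
  | skip
  | assign (x : ℕ) (e : Exp)
  | put (a : ℕ) (i e : Exp)
  | seq (p q : Prog)
  | ite (e : Exp) (p q : Prog)
  | loop (e : Exp) (p : Prog)

/-- Write a value into a register. -/
def State.setReg (s : State) (x v : ℕ) : State :=
  { s with reg := Function.update s.reg x v }

/-- Write a value into an array cell. -/
def State.setArr (s : State) (a i v : ℕ) : State :=
  { s with arr := Function.update s.arr a (Function.update (s.arr a) i v) }

/-- `Exec w p s s' t`: on a machine with `w`-bit words, program `p` started in state `s` halts in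
state `s'` after exactly `t` elementary steps. Conditions hold when they are nonzero. -/
inductive Exec (w : ℕ) : Prog → State → State → ℕ → Prop
  | skip (s : State) : Exec w .skip s s 1
  | assign (s : State) (x : ℕ) (e : Exp) :
      Exec w (.assign x e) s (s.setReg x (e.eval w s)) (e.cost + 1)
  | put (s : State) (a : ℕ) (i e : Exp) :
      Exec w (.put a i e) s (s.setArr a (i.eval w s) (e.eval w s)) (i.cost + e.cost + 1)
  | seq {p q : Prog} {s s₁ s₂ : State} {t₁ t₂ : ℕ} (hp : Exec w p s s₁ t₁)
      (hq : Exec w q s₁ s₂ t₂) : Exec w (.seq p q) s s₂ (t₁ + t₂)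
  | ite_true {e : Exp} {p q : Prog} {s s' : State} {t : ℕ} (he : e.eval w s ≠ 0)
      (hp : Exec w p s s' t) : Exec w (.ite e p q) s s' (e.cost + 1 + t)
  | ite_false {e : Exp} {p q : Prog} {s s' : State} {t : ℕ} (he : e.eval w s = 0)
      (hq : Exec w q s s' t) : Exec w (.ite e p q) s s' (e.cost + 1 + t)
  | loop_done {e : Exp} {p : Prog} {s : State} (he : e.eval w s = 0) :
      Exec w (.loop e p) s s (e.cost + 1)
  | loop_step {e : Exp} {p : Prog} {s s₁ s₂ : State} {t₁ t₂ : ℕ} (he : e.eval w s ≠ 0)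
      (hp : Exec w p s s₁ t₁) (hl : Exec w (.loop e p) s₁ s₂ t₂) :
      Exec w (.loop e p) s s₂ (e.cost + 1 + t₁ + t₂)

/-- The machine is deterministic: final state and number of steps are determined. -/
theorem Exec.deterministic {w : ℕ} {p : Prog} {s s₁ s₂ : State} {t₁ t₂ : ℕ}
    (h₁ : Exec w p s s₁ t₁) (h₂ : Exec w p s s₂ t₂) : s₁ = s₂ ∧ t₁ = t₂ := by
  induction h₁ generalizing s₂ t₂ with
  | skip s => cases h₂; exact ⟨rfl, rfl⟩
  | assign s x e => cases h₂; exact ⟨rfl, rfl⟩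
  | put s a i e => cases h₂; exact ⟨rfl, rfl⟩
  | seq hp hq ihp ihq =>
    cases h₂ with
    | seq hp' hq' =>
      obtain ⟨rfl, rfl⟩ := ihp hp'
      obtain ⟨rfl, rfl⟩ := ihq hq'
      exact ⟨rfl, rfl⟩
  | ite_true he hp ih =>
    cases h₂ with
    | ite_true he' hp' => obtain ⟨rfl, rfl⟩ := ih hp'; exact ⟨rfl, rfl⟩
    | ite_false he' hq' => exact absurd he' he
  | ite_false he hq ih =>
    cases h₂ with
    | ite_true he' hp' => exact absurd he he'
    | ite_false he' hq' => obtain ⟨rfl, rfl⟩ := ih hq'; exact ⟨rfl, rfl⟩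
  | loop_done he =>
    cases h₂ with
    | loop_done he' => exact ⟨rfl, rfl⟩
    | loop_step he' hp' hl' => exact absurd he he'
  | loop_step he hp hl ihp ihl =>
    cases h₂ with
    | loop_done he' => exact absurd he' he
    | loop_step he' hp' hl' =>
      obtain ⟨rfl, rfl⟩ := ihp hp'
      obtain ⟨rfl, rfl⟩ := ihl hl'
      exact ⟨rfl, rfl⟩

end WordRAM

/-! ## Graphs as inputs -/

/-- `L` is an adjacency-list representation of `G`: the list `L v` enumerates the neighbours of `v`,
each exactly once, in an arbitrary order. -/
def IsAdjLists {n : ℕ} (G : SimpleGraph (Fin n)) (L : Fin n → List (Fin n)) : Prop :=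
  ∀ v, (L v).Nodup ∧ ∀ u, u ∈ L v ↔ G.Adj v u

/-- The concatenation `L 0 ++ L 1 ++ ⋯` of the adjacency lists, as a list of numbers. -/
def adjConcat {n : ℕ} (L : Fin n → List (Fin n)) : List ℕ :=
  (List.ofFn fun v => (L v).map Fin.val).flatten

/-- The position at which the adjacency list of vertex `i` starts in the concatenation
(for `i = n`: the total length). -/
def adjOffset {n : ℕ} (L : Fin n → List (Fin n)) (i : ℕ) : ℕ :=
  ∑ v : Fin n, if v.val < i then (L v).length else 0

/-- Initial memory for an `n`-vertex graph given by adjacency lists: register `0` holds `n`, cells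
`0, …, n` of array `0` hold the offsets of the lists, array `1` holds the concatenation of the lists,
and everything else is `0`. -/
def inputState {n : ℕ} (L : Fin n → List (Fin n)) : WordRAM.State where
  reg x := if x = 0 then n else 0
  arr a i :=
    if a = 0 then (if i ≤ n then adjOffset L i else 0)
    else if a = 1 then (adjConcat L).getD i 0
    else 0

/-- Program `P` decides the graph property `Q` on the graphs that satisfy `promise`, within `T n m`
steps on graphs with `n` vertices and `m` edges: for some constant `κ`, on every such graph, for every
adjacency-list representation of it and every word length `w ≥ κ (⌊log₂ n⌋ + 1)`, the program halts
within `T n m` steps with the answer (`1` for yes, `0` for no) in register `0`. -/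
def DecidesWithin (P : WordRAM.Prog) (promise Q : ∀ {n : ℕ}, SimpleGraph (Fin n) → Prop)
    (T : ℕ → ℕ → ℝ) : Prop :=
  ∃ κ : ℕ, ∀ (n : ℕ) (G : SimpleGraph (Fin n)), promise G →
    ∀ L : Fin n → List (Fin n), IsAdjLists G L →
    ∀ w : ℕ, κ * (Nat.log 2 n + 1) ≤ w →
    ∃ (s : WordRAM.State) (t : ℕ), WordRAM.Exec w P (inputState L) s t ∧
      (t : ℝ) ≤ T n G.edgeSet.ncard ∧
      (Q G → s.reg 0 = 1) ∧ (¬ Q G → s.reg 0 = 0)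

/-! ## VC-dimension of a graph -/

open scoped Classical in
/-- The hyperedges of the closed-neighbourhood hypergraph: the sets `N[v] = {v} ∪ N(v)`. -/
noncomputable def closedNeighbourhoods {V : Type*} [Fintype V] [DecidableEq V] (G : SimpleGraph V) :
    Finset (Finset V) :=
  Finset.univ.image fun v => Finset.univ.filter fun u => u = v ∨ G.Adj v u

/-- The VC-dimension of a graph: that of its closed-neighbourhood hypergraph, i.e. the largest
cardinality of a shattered vertex set. -/
noncomputable def graphVCDim {V : Type*} [Fintype V] [DecidableEq V] (G : SimpleGraph V) : ℕ :=
  (closedNeighbourhoods G).vcDim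

/-! A connected graph has diameter at most two exactly when any two vertices `u`, `x` have a common
closed neighbour (`allMeet_iff`). So it suffices to decide, for each `u`, whether every `x`
satisfies `#{w ∈ N[u] : x ∈ N[w]} > 0`. Bounded VC-dimension allows these counts to be maintained in
compressed form.

Fix a scale `q` and call two vertices near when their closed neighbourhoods differ in at most `n /
q` places. A greedy scan yields pairwise non-near centres such that every vertex `w` is near some
centre `cen w`. Up to logarithms there are only `q ^ d` centres: the symmetric differences of their
neighbourhoods are dense, so a small set `Y` hits all of them, hence the centres have distinct
traces on `Y`, and the Sauer–Shelah lemma bounds the number of traces (`exists_hitting_set`,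
`card_le_of_separated`, `centres_length_le`). Next, vertices `x` are grouped by the set of centres
adjacent to them. Since adjacency is symmetric, this set is the trace of `N[x]` on the set of
centres, so with `S` centres there are at most `(S + 1) ^ d` classes (`classes_length_le`).

For fixed `u`, replace every `w ∈ N[u]` by its centre. The resulting count `base u x` depends only
on the class of `x` (`GoodData.base_typ`), so it is computed once per class from the multiplicities
of the centres in `N[u]`. The true count is `base + gain - loss` (`base_add_gain`), where the
corrections come from the symmetric differences of `N[w]` and `N[cen w]`. These have at most `n / q`
elements for each `w`, so they are processed one element at a time while the number of covered `x`
is kept up to date (`updateProg_spec`, `correctProg_spec`).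

With `M = ∑ |N[u]| = n + 2 m`, `S` centres and `T` classes, the work is `O(M (n / q + T S))`
(`pipelineProg_spec`). Up to logarithms `T S` is `q ^ (d (d + 1))`, so taking `q` of order `n ^ (1 /
(d (d + 1) + 2))` keeps it below `n / q` and saves the factor `q` (`cost_le`, `time_le`). Diameter
exactly two is then a matter of excluding complete graphs, which the number of edges reveals
(`diam_eq_two_iff`). -/

namespace WordRAM

/-! ## Time-bounded total correctness -/

/-- Value of an operation on natural numbers, without reduction modulo the word size. -/
def BinOp.val : BinOp → ℕ → ℕ → ℕ
  | .add, a, b => a + b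
  | .sub, a, b => a - b
  | .mul, a, b => a * b
  | .div, a, b => a / b
  | .mod, a, b => a % b
  | .lt, a, b => if a < b then 1 else 0
  | .eq, a, b => if a = b then 1 else 0

/-- The operation does not overflow. -/
def BinOp.ok (w : ℕ) : BinOp → ℕ → ℕ → Prop
  | .add, a, b => a + b < 2 ^ w
  | .sub, a, b => a - b < 2 ^ w
  | .mul, a, b => a * b < 2 ^ w
  | .div, a, b => a / b < 2 ^ w
  | .mod, a, b => a % b < 2 ^ w
  | .lt, _, _ => 0 < w
  | .eq, _, _ => 0 < w

theorem BinOp.eval_eq_val {w : ℕ} {o : BinOp} {a b : ℕ} (h : o.ok w a b) :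
    o.eval w a b = o.val a b := by
  cases o <;> simp only [BinOp.ok] at h <;> simp only [BinOp.eval, BinOp.val]
  all_goals first
    | exact Nat.mod_eq_of_lt h
    | (have : 1 < 2 ^ w := Nat.one_lt_two_pow h.ne'
       split_ifs <;> exact Nat.mod_eq_of_lt (by omega))

/-- Value of an expression, without reduction modulo the word size. -/
def Exp.val (s : State) : Exp → ℕ
  | .lit c => c
  | .reg x => s.reg x
  | .get a i => s.arr a (i.val s)
  | .op o e₁ e₂ => o.val (e₁.val s) (e₂.val s)

/-- The evaluation of the expression does not overflow. -/
def Exp.ok (w : ℕ) (s : State) : Exp → Prop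
  | .lit c => c < 2 ^ w
  | .reg _ => True
  | .get _ i => i.ok w s
  | .op o e₁ e₂ => e₁.ok w s ∧ e₂.ok w s ∧ o.ok w (e₁.val s) (e₂.val s)

theorem Exp.eval_eq_val {w : ℕ} {s : State} : ∀ {e : Exp}, e.ok w s → e.eval w s = e.val s
  | .lit _, h => Nat.mod_eq_of_lt h
  | .reg _, _ => rfl
  | .get a i, h => by
    have h' : i.ok w s := h
    simp only [Exp.eval, Exp.val, Exp.eval_eq_val h']
  | .op o e₁ e₂, h => by
    obtain ⟨h₁, h₂, h₃⟩ := h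
    simp only [Exp.eval, Exp.val, Exp.eval_eq_val h₁, Exp.eval_eq_val h₂, BinOp.eval_eq_val h₃]

/-- Started in `s`, the program halts within `T` steps in a state that satisfies `Q`. -/
def Hoare (w : ℕ) (P : Prog) (s : State) (T : ℕ) (Q : State → Prop) : Prop :=
  ∃ s' t, Exec w P s s' t ∧ t ≤ T ∧ Q s'

theorem Hoare.mono {w : ℕ} {P : Prog} {s : State} {T T' : ℕ} {Q Q' : State → Prop}
    (h : Hoare w P s T Q) (hT : T ≤ T') (hQ : ∀ s', Q s' → Q' s') : Hoare w P s T' Q' := by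
  obtain ⟨s', t, h₁, h₂, h₃⟩ := h
  exact ⟨s', t, h₁, h₂.trans hT, hQ _ h₃⟩

theorem Hoare.time {w : ℕ} {P : Prog} {s : State} {T T' : ℕ} {Q : State → Prop}
    (h : Hoare w P s T Q) (hT : T ≤ T') : Hoare w P s T' Q :=
  h.mono hT fun _ => id

theorem Hoare.seq {w : ℕ} {p q : Prog} {s : State} {T₁ T₂ : ℕ} {Q : State → Prop}
    (h : Hoare w p s T₁ fun s' => Hoare w q s' T₂ Q) : Hoare w (.seq p q) s (T₁ + T₂) Q := by
  obtain ⟨s₁, t₁, h₁, h₂, s₂, t₂, h₃, h₄, h₅⟩ := h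
  exact ⟨s₂, t₁ + t₂, .seq h₁ h₃, Nat.add_le_add h₂ h₄, h₅⟩

/-- Verification condition of a loop-free program. -/
def Prog.vc (w : ℕ) : Prog → State → (State → Prop) → Prop
  | .skip, s, Q => Q s
  | .assign x e, s, Q => e.ok w s ∧ Q (s.setReg x (e.val s))
  | .put a i e, s, Q => i.ok w s ∧ e.ok w s ∧ Q (s.setArr a (i.val s) (e.val s))
  | .seq p q, s, Q => p.vc w s fun s' => q.vc w s' Q
  | .ite e p q, s, Q => e.ok w s ∧ (e.val s ≠ 0 → p.vc w s Q) ∧ (e.val s = 0 → q.vc w s Q)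
  | .loop _ _, _, _ => False

/-- Upper bound for the running time of a loop-free program. -/
def Prog.maxTime : Prog → ℕ
  | .skip => 1
  | .assign _ e => e.cost + 1
  | .put _ i e => i.cost + e.cost + 1
  | .seq p q => p.maxTime + q.maxTime
  | .ite e p q => e.cost + 1 + max p.maxTime q.maxTime
  | .loop _ _ => 0

/-- Structural induction; `Exp.ok` lets every word operation be replaced by its value in the natural
numbers. Loops are excluded, their verification condition being `False`; they are the business of
`Hoare.forP`. -/
theorem Hoare.of_vc {w : ℕ} {P : Prog} {s : State} {Q : State → Prop} (h : P.vc w s Q) :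
    Hoare w P s P.maxTime Q := by
  induction P generalizing s Q with
  | skip => exact ⟨s, 1, .skip s, le_rfl, h⟩
  | assign x e =>
    refine ⟨_, _, .assign s x e, le_rfl, ?_⟩
    rw [Exp.eval_eq_val h.1]; exact h.2
  | put a i e =>
    refine ⟨_, _, .put s a i e, le_rfl, ?_⟩
    rw [Exp.eval_eq_val h.1, Exp.eval_eq_val h.2.1]; exact h.2.2
  | seq p q ihp ihq => exact Hoare.seq ((ihp h).mono le_rfl fun s' h' => ihq h')
  | ite e p q ihp ihq =>
    obtain ⟨h₀, h₁, h₂⟩ := h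
    rw [← Exp.eval_eq_val h₀] at h₁ h₂
    by_cases he : e.eval w s = 0
    · obtain ⟨s', t, h₃, h₄, h₅⟩ := ihq (h₂ he)
      exact ⟨s', _, .ite_false he h₃, by simp only [Prog.maxTime]; omega, h₅⟩
    · obtain ⟨s', t, h₃, h₄, h₅⟩ := ihp (h₁ he)
      exact ⟨s', _, .ite_true he h₃, by simp only [Prog.maxTime]; omega, h₅⟩
  | loop e p => exact h.elim

theorem Hoare.block {w : ℕ} {P : Prog} {s : State} {T : ℕ} {Q : State → Prop}
    (hT : P.maxTime ≤ T) (h : P.vc w s Q) : Hoare w P s T Q :=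
  (Hoare.of_vc h).time hT

/-! ### The frame rule -/

/-- Does the program text contain an assignment to register `x`? -/
def Prog.writesReg : Prog → ℕ → Bool
  | .skip, _ => false
  | .assign y _, x => x == y
  | .put _ _ _, _ => false
  | .seq p q, x => p.writesReg x || q.writesReg x
  | .ite _ p q, x => p.writesReg x || q.writesReg x
  | .loop _ p, x => p.writesReg x

/-- Does the program text contain an assignment to a cell of array `a`? -/
def Prog.writesArr : Prog → ℕ → Bool
  | .skip, _ => false
  | .assign _ _, _ => false
  | .put b _ _, a => a == b
  | .seq p q, a => p.writesArr a || q.writesArr a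
  | .ite _ p q, a => p.writesArr a || q.writesArr a
  | .loop _ p, a => p.writesArr a

/-- The two states agree on everything that `P` does not write. -/
def Agree (P : Prog) (s s' : State) : Prop :=
  (∀ x, P.writesReg x = false → s'.reg x = s.reg x) ∧
    ∀ a, P.writesArr a = false → s'.arr a = s.arr a

theorem Agree.refl (P : Prog) (s : State) : Agree P s s := ⟨fun _ _ => rfl, fun _ _ => rfl⟩

theorem Agree.trans {P : Prog} {s s' s'' : State} (h : Agree P s s') (h' : Agree P s' s'') :
    Agree P s s'' :=
  ⟨fun x hx => (h'.1 x hx).trans (h.1 x hx), fun x hx => (h'.2 x hx).trans (h.2 x hx)⟩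

theorem Agree.of_imp {P P' : Prog} {s s' : State} (h : Agree P s s')
    (hr : ∀ x, P'.writesReg x = false → P.writesReg x = false)
    (ha : ∀ x, P'.writesArr x = false → P.writesArr x = false) : Agree P' s s' :=
  ⟨fun x hx => h.1 x (hr x hx), fun x hx => h.2 x (ha x hx)⟩

/-- Targets of writes are named in the program text, so what a program leaves untouched is decided
syntactically. For concrete programs the resulting side conditions hold by `rfl`, and loop
invariants need only mention what the body changes. -/
theorem Exec.agree {w : ℕ} {P : Prog} {s s' : State} {t : ℕ} (h : Exec w P s s' t) :
    Agree P s s' := by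
  induction h with
  | skip s => exact Agree.refl _ _
  | assign s x e =>
    refine ⟨fun y hy => ?_, fun _ _ => rfl⟩
    have : y ≠ x := by simpa [Prog.writesReg] using hy
    simp [State.setReg, Function.update_of_ne this]
  | put s a i e =>
    refine ⟨fun _ _ => rfl, fun b hb => ?_⟩
    have : b ≠ a := by simpa [Prog.writesArr] using hb
    simp [State.setArr, Function.update_of_ne this]
  | seq hp hq ihp ihq =>
    refine (ihp.of_imp ?_ ?_).trans (ihq.of_imp ?_ ?_) <;>
      simp +contextual [Prog.writesReg, Prog.writesArr]
  | ite_true he hp ih =>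
    refine ih.of_imp ?_ ?_ <;> simp +contextual [Prog.writesReg, Prog.writesArr]
  | ite_false he hp ih =>
    refine ih.of_imp ?_ ?_ <;> simp +contextual [Prog.writesReg, Prog.writesArr]
  | loop_done he => exact Agree.refl _ _
  | loop_step he hp hl ihp ihl =>
    exact (ihp.of_imp (fun _ h => h) (fun _ h => h)).trans ihl

theorem Hoare.frame {w : ℕ} {P : Prog} {s : State} {T : ℕ} {Q : State → Prop}
    (h : Hoare w P s T Q) : Hoare w P s T fun s' => Agree P s s' ∧ Q s' := by
  obtain ⟨s', t, h₁, h₂, h₃⟩ := h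
  exact ⟨s', t, h₁, h₂, h₁.agree, h₃⟩

@[simp] theorem State.setReg_reg (s : State) (x v y : ℕ) :
    (s.setReg x v).reg y = if y = x then v else s.reg y := by
  simp [State.setReg, Function.update_apply]

@[simp] theorem State.setReg_arr (s : State) (x v : ℕ) : (s.setReg x v).arr = s.arr := rfl

@[simp] theorem State.setArr_reg (s : State) (a i v : ℕ) : (s.setArr a i v).reg = s.reg := rfl

@[simp] theorem State.setArr_arr (s : State) (a i v b : ℕ) :
    (s.setArr a i v).arr b = if b = a then Function.update (s.arr a) i v else s.arr b := by
  simp [State.setArr, Function.update_apply]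

/-! ## Counting loops -/

/-- `for i := 0, …, e - 1 do body`. -/
def forP (i : ℕ) (e : Exp) (body : Prog) : Prog :=
  .seq (.assign i (.lit 0))
    (.loop (.op .lt (.reg i) e) (.seq body (.assign i (.op .add (.reg i) (.lit 1)))))

theorem forP_writesReg (i : ℕ) (e : Exp) (body : Prog) (x : ℕ) :
    (forP i e body).writesReg x = (x == i || body.writesReg x) := by
  simp only [forP, Prog.writesReg]
  cases x == i <;> cases body.writesReg x <;> rfl

theorem forP_writesArr (i : ℕ) (e : Exp) (body : Prog) (a : ℕ) :
    (forP i e body).writesArr a = body.writesArr a := by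
  simp [forP, Prog.writesArr]

/-- The bound `e` is re-evaluated in each round, so it must keep the value `N` under the invariant.
Besides the invariant, every round may use that the state agrees with the initial one off the write
targets. Each round pays `e.cost + 3` for the test and `4` for the increment; the initialisation and
the last test give the additive `e.cost + 5`. -/
theorem Hoare.forP {w i : ℕ} {e : Exp} {body : Prog} {s₀ : State} {N : ℕ} {c : ℕ → ℕ}
    {Q : State → Prop} (I : ℕ → State → Prop) (hN : N < 2 ^ w) (hw : 0 < w)
    (hi : body.writesReg i = false)
    (he : ∀ k ≤ N, ∀ s, Agree (WordRAM.forP i e body) s₀ s → I k s → e.ok w s ∧ e.val s = N)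
    (h0 : I 0 (s₀.setReg i 0))
    (hstep : ∀ k < N, ∀ s, Agree (WordRAM.forP i e body) s₀ s → s.reg i = k → I k s →
      Hoare w body s (c k) fun s' => I (k + 1) (s'.setReg i (k + 1)))
    (hQ : ∀ s, Agree (WordRAM.forP i e body) s₀ s → I N s → Q s) :
    Hoare w (WordRAM.forP i e body) s₀
      (∑ k ∈ Finset.range N, (c k + (e.cost + 7)) + (e.cost + 5)) Q := by
  have h1w : 1 < 2 ^ w := Nat.one_lt_two_pow hw.ne'
  -- Induction on the number `j` of rounds still to come, while the counter `k` moves up.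
  have key : ∀ j k, j + k = N → ∀ s, Agree (WordRAM.forP i e body) s₀ s → s.reg i = k → I k s →
      Hoare w (.loop (.op .lt (.reg i) e) (.seq body (.assign i (.op .add (.reg i) (.lit 1))))) s
        (∑ k ∈ Finset.Ico k N, (c k + (e.cost + 7)) + (e.cost + 3)) Q := by
    intro j
    induction j with
    | zero =>
      intro k hk s hA hs hI
      obtain rfl : k = N := by omega
      obtain ⟨h₁, h₂⟩ := he k le_rfl s hA hI
      refine ⟨s, _, .loop_done ?_, ?_, hQ s hA hI⟩
      · rw [Exp.eval_eq_val (show Exp.ok w s (.op .lt (.reg i) e) from ⟨trivial, h₁, hw⟩)]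
        simp [Exp.val, BinOp.val, h₂, hs]
      · simp [Exp.cost]; omega
    | succ j ih =>
      intro k hk s hA hs hI
      obtain ⟨h₁, h₂⟩ := he k (by omega) s hA hI
      obtain ⟨s₁, t₁, hx, ht, hI'⟩ := hstep k (by omega) s hA hs hI
      have hA₁ := hx.agree
      have hs₁ : s₁.reg i = k := (hA₁.1 i hi).trans hs
      have hx2 : Exec w (.assign i (.op .add (.reg i) (.lit 1))) s₁ (s₁.setReg i (k + 1)) 4 := by
        have := Exec.assign (w := w) s₁ i (.op .add (.reg i) (.lit 1))
        rw [Exp.eval_eq_val] at this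
        · simpa [Exp.val, BinOp.val, hs₁, Exp.cost] using this
        · exact ⟨trivial, h1w, by simp only [BinOp.ok, Exp.val, hs₁]; omega⟩
      have hx3 := Exec.seq hx hx2
      have hA₂ : Agree (WordRAM.forP i e body) s₀ (s₁.setReg i (k + 1)) := by
        refine hA.trans (hx3.agree.of_imp ?_ ?_) <;> intro x <;>
          simp only [forP_writesReg, forP_writesArr, Prog.writesReg, Prog.writesArr] <;>
          simp +contextual
      obtain ⟨s₂, t₂, hy, ht₂, hQ₂⟩ := ih (k + 1) (by omega) _ hA₂ (by simp) hI'
      refine ⟨s₂, _, .loop_step ?_ hx3 hy, ?_, hQ₂⟩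
      · rw [Exp.eval_eq_val (show Exp.ok w s (.op .lt (.reg i) e) from ⟨trivial, h₁, hw⟩)]
        simp only [Exp.val, BinOp.val, h₂, hs]
        rw [if_pos (by omega)]; simp
      · rw [Finset.sum_eq_sum_Ico_succ_bot (by omega)]
        simp only [Exp.cost]; omega
  have h1 : Hoare w (.assign i (.lit 0)) s₀ 2 fun s' => s' = s₀.setReg i 0 :=
    Hoare.of_vc (P := .assign i (.lit 0)) ⟨show 0 < 2 ^ w by omega, rfl⟩
  have hA : Agree (WordRAM.forP i e body) s₀ (s₀.setReg i 0) := by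
    refine ⟨fun x hx => ?_, fun _ _ => rfl⟩
    have : x ≠ i := by
      rintro rfl; simp [forP_writesReg] at hx
    simp [this]
  have h2 := key N 0 (by omega) (s₀.setReg i 0) hA (by simp) h0
  rw [← Finset.range_eq_Ico] at h2
  have h3 : Hoare w (WordRAM.forP i e body) s₀
      (2 + (∑ k ∈ Finset.range N, (c k + (e.cost + 7)) + (e.cost + 3))) Q :=
    Hoare.seq (h1.mono le_rfl (by rintro s' rfl; exact h2))
  exact h3.time (by omega)

/-! ## Iteration over closed neighbourhoods -/

/-- Closed adjacency lists of a graph on `{0, …, n - 1}`. -/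
structure ClosedLists (n : ℕ) (cl : ℕ → List ℕ) : Prop where
  nodup : ∀ v < n, (cl v).Nodup
  lt : ∀ v < n, ∀ x ∈ cl v, x < n
  symm : ∀ v < n, ∀ x < n, x ∈ cl v → v ∈ cl x
  self : ∀ v < n, v ∈ cl v

theorem ClosedLists.length_le {n : ℕ} {cl : ℕ → List ℕ} (h : ClosedLists n cl) {v : ℕ}
    (hv : v < n) : (cl v).length ≤ n := by
  rw [← List.toFinset_card_of_nodup (h.nodup v hv)]
  have : (cl v).toFinset ⊆ Finset.range n := fun x hx =>
    Finset.mem_range.2 (h.lt v hv x (by simpa using hx))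
  simpa using Finset.card_le_card this

/-- The memory holds the graph whose closed adjacency lists are `cl`. -/
structure HasGraph (n : ℕ) (cl : ℕ → List ℕ) (s : State) : Prop where
  size : s.reg 0 = n
  lists : ∀ v < n, ∃ l, cl v = l ++ [v] ∧ s.arr 0 (v + 1) = s.arr 0 v + l.length ∧
    ∀ k, ∀ h : k < l.length, s.arr 1 (s.arr 0 v + k) = l[k]
  offset_le : ∀ v ≤ n, s.arr 0 v ≤ n * n

theorem HasGraph.congr {n : ℕ} {cl : ℕ → List ℕ} {s s' : State} (h : HasGraph n cl s)
    (h0 : s'.reg 0 = s.reg 0) (h1 : s'.arr 0 = s.arr 0) (h2 : s'.arr 1 = s.arr 1) :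
    HasGraph n cl s' := by
  constructor
  · rw [h0, h.size]
  · rw [h1, h2]; exact h.lists
  · rw [h1]; exact h.offset_le

theorem HasGraph.length_eq {n : ℕ} {cl : ℕ → List ℕ} {s : State} (h : HasGraph n cl s) {v : ℕ}
    (hv : v < n) : s.arr 0 (v + 1) - s.arr 0 v + 1 = (cl v).length := by
  obtain ⟨l, h₁, h₂, -⟩ := h.lists v hv
  rw [h₁, h₂]; simp

/-- The words are long enough for quadratic quantities. -/
def Wide (n w : ℕ) : Prop := 4 * (n * n) + 16 * n + 16 < 2 ^ w

theorem Wide.pos {n w : ℕ} (h : Wide n w) : 0 < w := by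
  rcases Nat.eq_zero_or_pos w with rfl | h'
  · simp [Wide] at h
  · exact h'

/-- `e₁ + e₂` -/
abbrev addE (e₁ e₂ : Exp) : Exp := .op .add e₁ e₂
/-- `e₁ - e₂` -/
abbrev subE (e₁ e₂ : Exp) : Exp := .op .sub e₁ e₂
/-- `e₁ * e₂` -/
abbrev mulE (e₁ e₂ : Exp) : Exp := .op .mul e₁ e₂
/-- `e₁ < e₂` -/
abbrev ltE (e₁ e₂ : Exp) : Exp := .op .lt e₁ e₂
/-- `e₁ = e₂` -/
abbrev eqE (e₁ e₂ : Exp) : Exp := .op .eq e₁ e₂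

/-- Number of neighbours of the vertex in register `v`. -/
def degE (v : ℕ) : Exp := subE (.get 0 (addE (.reg v) (.lit 1))) (.get 0 (.reg v))

/-- `for x ∈ N[v] do body`, with `i` as the counter. -/
def forNbr (i x v : ℕ) (body : Prog) : Prog :=
  forP i (addE (degE v) (.lit 1))
    (.seq (.ite (ltE (.reg i) (degE v)) (.assign x (.get 1 (addE (.get 0 (.reg v)) (.reg i))))
      (.assign x (.reg v))) body)

theorem forNbr_writesReg (i x v : ℕ) (body : Prog) (y : ℕ) :
    (forNbr i x v body).writesReg y = (y == i || (y == x || body.writesReg y)) := by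
  simp [forNbr, forP_writesReg, Prog.writesReg]

theorem forNbr_writesArr (i x v : ℕ) (body : Prog) (y : ℕ) :
    (forNbr i x v body).writesArr y = body.writesArr y := by
  simp [forNbr, forP_writesArr, Prog.writesArr]

/-- The invariant is indexed by the prefix of the neighbour list already processed, so users reason
about a list instead of memory positions. It has to be insensitive to the counter `i` and the
current vertex `x`, which the loop itself overwrites. -/
theorem Hoare.forNbr {w n i x v V c : ℕ} {cl : ℕ → List ℕ} {body : Prog} {s₀ : State}
    {Q : State → Prop} (I : List ℕ → State → Prop) (hw : Wide n w) (hG : HasGraph n cl s₀)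
    (hV : V < n) (hsV : s₀.reg v = V)
    (hi : body.writesReg i = false) (hv : body.writesReg v = false)
    (h0 : body.writesReg 0 = false)
    (ha0 : body.writesArr 0 = false) (ha1 : body.writesArr 1 = false)
    (hne : i ≠ v ∧ x ≠ v ∧ i ≠ x ∧ i ≠ 0 ∧ x ≠ 0)
    (hinit : I [] s₀)
    (hI : ∀ pre s y, I pre s → I pre (s.setReg i y) ∧ I pre (s.setReg x y))
    (hstep : ∀ pre y post, cl V = pre ++ y :: post → ∀ s,
      Agree (WordRAM.forNbr i x v body) s₀ s → s.reg x = y → I pre s →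
      Hoare w body s c (I (pre ++ [y])))
    (hQ : ∀ s, Agree (WordRAM.forNbr i x v body) s₀ s → I (cl V) s → Q s) :
    Hoare w (WordRAM.forNbr i x v body) s₀ ((cl V).length * (c + 32) + 14) Q := by
  obtain ⟨hiv, hxv, hix, hi0, hx0⟩ := hne
  have hwp := hw.pos
  have key : ∀ s, Agree (WordRAM.forNbr i x v body) s₀ s → s.reg v = V ∧ HasGraph n cl s := by
    intro s hA
    refine ⟨?_, hG.congr ?_ ?_ ?_⟩
    · rw [← hsV]; apply hA.1; simp [forNbr_writesReg, hv, hiv.symm, hxv.symm]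
    · apply hA.1; simp [forNbr_writesReg, h0, hi0.symm, hx0.symm]
    · apply hA.2; simp [forNbr_writesArr, ha0]
    · apply hA.2; simp [forNbr_writesArr, ha1]
  have hdeg : ∀ s, s.reg v = V → HasGraph n cl s →
      (degE v).ok w s ∧ (degE v).val s + 1 = (cl V).length ∧ (degE v).val s ≤ n * n := by
    intro s h₁ h₂
    have := h₂.length_eq hV
    have h₃ := h₂.offset_le (V + 1) hV
    unfold Wide at hw
    refine ⟨⟨⟨trivial, show 1 < 2 ^ w by omega, ?_⟩, trivial, ?_⟩, ?_, ?_⟩ <;>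
      simp only [Exp.val, BinOp.ok, BinOp.val, h₁, degE] <;> omega
  have hlen : ((cl V).length) ≤ n * n + 1 := by
    have := hdeg s₀ hsV hG; omega
  refine (Hoare.forP (c := fun _ => c + 16) (N := (cl V).length)
    (fun k s => I ((cl V).take k) s) ?_ hwp ?_ ?_ ?_ ?_ ?_).time ?_
  · unfold Wide at hw; omega
  · simp [Prog.writesReg, hi, hix]
  · intro k _ s hA _
    obtain ⟨h₁, h₂⟩ := key s hA
    obtain ⟨h₃, h₄, h₅⟩ := hdeg s h₁ h₂
    unfold Wide at hw
    refine ⟨⟨h₃, show 1 < 2 ^ w by omega, show _ + 1 < 2 ^ w by omega⟩, h₄⟩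
  · simpa using (hI [] s₀ 0 hinit).1
  · intro k hk s hA hsi hIk
    obtain ⟨h₁, h₂⟩ := key s hA
    obtain ⟨h₃, h₄, h₅⟩ := hdeg s h₁ h₂
    obtain ⟨l, hl, hl₂, hl₃⟩ := h₂.lists V hV
    have hlk : (cl V).length = l.length + 1 := by rw [hl]; simp
    have hpre : cl V = (cl V).take k ++ (cl V)[k] :: (cl V).drop (k + 1) := by simp
    have htake : (cl V).take (k + 1) = (cl V).take k ++ [(cl V)[k]] := by
      rw [List.take_succ_eq_append_getElem hk]
    have h₆ := h₂.offset_le V hV.le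
    have hW : 4 * (n * n) + 16 * n + 16 < 2 ^ w := hw
    refine (Hoare.seq (T₁ := 16) (T₂ := c) ?_).time (by omega)
    refine (Hoare.frame (T := 16) (Q := fun s' => s' = s.setReg x (cl V)[k]) ?_).mono le_rfl ?_
    -- Array `1` stores open neighbourhoods only. The closed list ends with the vertex itself, which
    -- is supplied in the round where the counter equals the degree.
    · refine Hoare.of_vc ⟨⟨trivial, h₃, hwp⟩, fun h => ?_, fun h => ?_⟩
      · simp only [Exp.val, BinOp.val, hsi] at h
        have hkl : k < l.length := by
          split_ifs at h with h'
          · omega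
          · exact absurd rfl h
        refine ⟨⟨trivial, trivial, ?_⟩, ?_⟩
        · simp only [BinOp.ok, Exp.val, h₁, hsi]; omega
        · simp only [Exp.val, BinOp.val, h₁, hsi, hl₃ k hkl]
          congr 1
          simp [hl, List.getElem_append_left hkl]
      · simp only [Exp.val, BinOp.val, hsi] at h
        have hkl : k = l.length := by
          split_ifs at h with h'
          omega
        refine ⟨trivial, ?_⟩
        simp only [Exp.val, h₁]
        congr 1
        subst hkl
        simp [hl]
    · rintro s' ⟨-, rfl⟩
      refine (hstep _ _ _ hpre _ ?_ (by simp) (hI _ _ _ hIk).2).mono le_rfl ?_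
      · refine hA.trans ⟨fun y hy => ?_, fun _ _ => rfl⟩
        have : y ≠ x := by rintro rfl; simp [forP_writesReg, Prog.writesReg] at hy
        simp [this]
      · intro s' h
        rw [htake]
        exact (hI _ _ _ h).1
  · intro s hA h
    exact hQ s hA (by simpa using h)
  · simp only [Finset.sum_const, Finset.card_range, smul_eq_mul, degE, Exp.cost]
    rw [show c + 16 + (1 + 1 + 1 + 1 + (1 + 1) + 1 + 1 + 1 + 7) = c + 32 by ring]

/-- The position of the cell `(i, j)` of an `n × n` table. -/
theorem idx_lt {n i j : ℕ} (hi : i < n) (hj : j < n) : i * n + j < n * n := by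
  have : (i + 1) * n ≤ n * n := Nat.mul_le_mul_right n hi
  linarith [add_mul i 1 n]

theorem idx_inj {n i j i' j' : ℕ} (hj : j < n) (hj' : j' < n) :
    i * n + j = i' * n + j' ↔ i = i' ∧ j = j' := by
  refine ⟨fun h => ?_, by rintro ⟨rfl, rfl⟩; rfl⟩
  have h1 := congrArg (· / n) h
  have hn : 0 < n := by omega
  simp only [Nat.mul_comm _ n, Nat.mul_add_div hn, Nat.div_eq_of_lt hj, Nat.div_eq_of_lt hj'] at h1
  have h2 : i = i' := by simpa using h1
  subst h2
  exact ⟨rfl, by omega⟩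

/-! ## The scale `q` -/

/-- Computes in register `1` the largest power `q` of two with `q ^ E ≤ n`. -/
def scaleProg (E : ℕ) : Prog :=
  .seq (.assign 1 (.lit 1)) (.seq (.assign 5 (.lit 1))
    (forP 6 (.reg 0)
      (.ite (ltE (.reg 0) (mulE (.reg 5) (.lit (2 ^ E)))) .skip
        (.seq (.assign 5 (mulE (.reg 5) (.lit (2 ^ E)))) (.assign 1 (mulE (.reg 1) (.lit 2)))))))

/-- Doubling until the next power would exceed `n`. The hypothesis `hwE` ensures that the trial
product, at most `2 ^ E * n`, still fits in a word. Running `n` rounds is wasteful but linear, hence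
harmless. -/
theorem scaleProg_spec {w n E : ℕ} {s : State} (hw : Wide n w) (hn : 0 < n) (hE : 0 < E)
    (hwE : 2 ^ E * n < 2 ^ w) (hs : s.reg 0 = n) :
    Hoare w (scaleProg E) s (n * 50 + 50) fun s' =>
      0 < s'.reg 1 ∧ s'.reg 1 ^ E ≤ n ∧ n < (2 * s'.reg 1) ^ E := by
  have hW : 4 * (n * n) + 16 * n + 16 < 2 ^ w := hw
  have hEw : 2 ^ E < 2 ^ w := lt_of_le_of_lt (Nat.le_mul_of_pos_right _ hn) hwE
  refine (Hoare.seq (T₁ := 2) (T₂ := n * 50 + 10) ?_).time (by omega)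
  refine (Hoare.of_vc (P := .assign 1 (.lit 1)) (Q := fun s' => s' = s.setReg 1 1)
    ⟨show 1 < 2 ^ w by omega, rfl⟩).mono le_rfl ?_
  rintro _ rfl
  refine (Hoare.seq (T₁ := 2) (T₂ := n * 50 + 8) ?_).time (by omega)
  refine (Hoare.of_vc (P := .assign 5 (.lit 1)) (Q := fun s' => s' = (s.setReg 1 1).setReg 5 1)
    ⟨show 1 < 2 ^ w by omega, rfl⟩).mono le_rfl ?_
  rintro _ rfl
  -- Either the doubling has come to rest, or every round so far was a doubling and the exponent `j`
  -- equals the round number.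
  refine (Hoare.forP (N := n) (c := fun _ => 20) (fun k s => ∃ j, s.reg 1 = 2 ^ j ∧
    s.reg 5 = (2 ^ j) ^ E ∧ (2 ^ j) ^ E ≤ n ∧ (n < (2 * 2 ^ j) ^ E ∨ j = k)) (by omega) hw.pos rfl
    ?_ ?_ ?_ ?_).time ?_
  · intro k _ t hA _
    exact ⟨trivial, (hA.1 0 rfl).trans (by simpa using hs)⟩
  · exact ⟨0, by simp; omega⟩
  · rintro k hk t hA - ⟨j, h1, h5, hle, hor⟩
    have h0 : t.reg 0 = n := by simpa [hs] using hA.1 0 rfl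
    have hq : 2 ^ j ≤ n := (Nat.le_self_pow hE.ne' _).trans hle
    have hm : (2 ^ j) ^ E * 2 ^ E = (2 * 2 ^ j) ^ E := by rw [mul_pow, mul_comm]
    have hmo : (2 ^ j) ^ E * 2 ^ E < 2 ^ w :=
      lt_of_le_of_lt (by rw [mul_comm]; exact Nat.mul_le_mul_left _ hle) hwE
    refine (Hoare.block (T := 14) (by simp [Prog.maxTime, Exp.cost]) ?_).time (by omega)
    refine ⟨⟨trivial, ⟨trivial, hEw, ?_⟩, hw.pos⟩, fun h => ?_, fun h => ?_⟩
    · simpa [BinOp.ok, Exp.val, h5] using hmo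
    · have h' : n < (2 * 2 ^ j) ^ E := by
        rw [← hm]; simpa [Exp.val, BinOp.val, h5, h0] using h
      exact ⟨j, by simp [h1], by simp [h5], hle, Or.inl h'⟩
    · have h' : (2 * 2 ^ j) ^ E ≤ n := by
        rw [← hm]; simpa [Exp.val, BinOp.val, h5, h0] using h
      refine ⟨⟨trivial, hEw, by simpa [BinOp.ok, Exp.val, h5] using hmo⟩,
        ⟨trivial, show 2 < 2 ^ w by omega, ?_⟩, j + 1, ?_, ?_, ?_, ?_⟩
      · simp [BinOp.ok, Exp.val, h1]; omega
      · simp [Exp.val, BinOp.val, h1, pow_succ]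
      · simp [Exp.val, BinOp.val, h5, hm, pow_succ, mul_comm]
      · rwa [pow_succ, mul_comm]
      · right
        rcases hor with h'' | h'' <;> omega
  · rintro t hA ⟨j, h1, -, hle, hor⟩
    rw [h1]
    refine ⟨by positivity, hle, hor.resolve_right ?_⟩
    -- If all `n` rounds were doublings, then `2 ^ n ≤ n`, which is absurd.
    rintro rfl
    have : 2 ^ j ≤ j := (Nat.le_self_pow hE.ne' _).trans hle
    exact absurd this (not_le.2 j.lt_two_pow_self)
  · simp [Exp.cost]; omega

/-! ## The adjacency table -/

/-- Fills array `2` with the table of closed adjacency. -/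
def adjTable : Prog :=
  forP 6 (.reg 0) (forNbr 7 8 6 (.put 2 (addE (mulE (.reg 6) (.reg 0)) (.reg 8)) (.lit 1)))

/-- Array `2` is the table of closed adjacency. -/
def IsAdjTable (n : ℕ) (cl : ℕ → List ℕ) (s : State) : Prop :=
  ∀ u < n, ∀ x < n, s.arr 2 (u * n + x) = if x ∈ cl u then 1 else 0

/-- The memory starts out as zero, so only the ones of the `n × n` table are written, and the time
is linear in the lengths of the lists instead of quadratic in `n`. -/
theorem adjTable_spec {w n : ℕ} {cl : ℕ → List ℕ} {s : State} (hw : Wide n w)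
    (hC : ClosedLists n cl) (hG : HasGraph n cl s) (hz : s.arr 2 = fun _ => 0) :
    Hoare w adjTable s (∑ u ∈ Finset.range n, ((cl u).length * 50 + 50) + 50)
      (IsAdjTable n cl) := by
  have hW : 4 * (n * n) + 16 * n + 16 < 2 ^ w := hw
  refine (Hoare.forP (N := n) (c := fun u => (cl u).length * 42 + 14)
    (fun k s => ∀ u < n, ∀ x < n, s.arr 2 (u * n + x) = if u < k ∧ x ∈ cl u then 1 else 0)
    (by omega) hw.pos rfl ?_ ?_ ?_ ?_).time ?_
  · intro k _ t hA _
    exact ⟨trivial, (hA.1 0 rfl).trans hG.size⟩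
  · intro u hu x hx; simp [hz]
  · intro k hk t hA htk hI
    have hGt : HasGraph n cl t := hG.congr (hA.1 0 rfl) (hA.2 0 rfl) (hA.2 1 rfl)
    refine Hoare.forNbr (c := 10) (fun pre s => ∀ u < n, ∀ x < n, s.arr 2 (u * n + x) =
      if (u < k ∧ x ∈ cl u) ∨ (u = k ∧ x ∈ pre) then 1 else 0) hw hGt hk htk rfl rfl rfl rfl rfl
      (by decide) ?_ ?_ ?_ ?_
    · simpa using hI
    · intro pre s y h; exact ⟨h, h⟩
    · intro pre y post hpre s' hA' hy hI'
      have hyn : y < n := hC.lt k hk y (by simp [hpre])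
      have h6 : s'.reg 6 = k := by simpa [htk] using hA'.1 6 rfl
      have h0 : s'.reg 0 = n := by simpa [hGt.size] using hA'.1 0 rfl
      have := idx_lt hk hyn
      refine Hoare.block (by decide) ?_
      refine ⟨⟨⟨trivial, trivial, ?_⟩, trivial, ?_⟩, show 1 < 2 ^ w by omega, ?_⟩
      · simp only [BinOp.ok, Exp.val, h6, h0]; omega
      · simp only [BinOp.ok, BinOp.val, Exp.val, h6, h0, hy]; omega
      · intro u hu x hx
        simp only [Exp.val, BinOp.val, h6, h0, hy, State.setArr_arr, if_true,
          Function.update_apply, idx_inj hx hyn, hI' u hu x hx, List.mem_append,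
          List.mem_singleton]
        by_cases h : u = k <;> by_cases h' : x = y <;> simp [h, h']
    · intro s' hA' hI' u hu x hx
      simp only [State.setReg_arr, hI' u hu x hx]
      congr 1
      rw [eq_iff_iff]
      constructor
      · rintro (h | ⟨rfl, h⟩)
        · exact ⟨by omega, h.2⟩
        · exact ⟨by omega, h⟩
      · rintro ⟨h, h'⟩
        rcases Nat.lt_succ_iff_lt_or_eq.1 h with h'' | rfl
        · exact Or.inl ⟨h'', h'⟩
        · exact Or.inr ⟨rfl, h'⟩
  · intro t hA hI u hu x hx
    rw [hI u hu x hx]; simp [hu]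
  · refine Nat.add_le_add (Finset.sum_le_sum fun u _ => ?_) ?_
    · simp only [Exp.cost]; omega
    · simp only [Exp.cost]; omega

/-! ## Greedy choice of representatives -/

/-- Scans the numbers `u < n`. Each `u` that passes the test with an earlier representative is
assigned to it; otherwise `u` becomes a representative itself. The representatives are listed in
array `aL`, their number is held in register `xS`, and array `aR` holds the assignment. The test
compares the contents of registers `6` and `9` and leaves its answer in register `12`. -/
def greedy (xS aL aR : ℕ) (test : Prog) : Prog :=
  .seq (.assign xS (.lit 0)) (forP 6 (.reg 0)
    (.seq (.assign 13 (.reg 6)) (.seq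
      (forP 14 (.reg xS) (.seq (.assign 9 (.get aL (.reg 14)))
        (.seq test (.ite (.reg 12) (.assign 13 (.reg 9)) .skip))))
      (.seq
        (.ite (eqE (.reg 13) (.reg 6))
          (.seq (.put aL (.reg xS) (.reg 6)) (.assign xS (addE (.reg xS) (.lit 1)))) .skip)
        (.put aR (.reg 6) (.reg 13))))))

/-- `l` is the list of representatives of the numbers below `k`, and the memory holds it together
with the assignment. -/
structure Representatives (R : ℕ → ℕ → Prop) (xS aL aR k : ℕ) (l : List ℕ) (s : State) : Prop where
  length_eq : s.reg xS = l.length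
  entry : ∀ i, ∀ h : i < l.length, s.arr aL i = l[i]
  lt : ∀ x ∈ l, x < k
  separated : l.Pairwise fun a b => a < b ∧ ¬ R b a
  mem : ∀ u < k, s.arr aR u ∈ l
  rel : ∀ u < k, s.arr aR u = u ∨ R u (s.arr aR u)

theorem Representatives.congr {R : ℕ → ℕ → Prop} {xS aL aR k : ℕ} {l : List ℕ} {s s' : State}
    (h : Representatives R xS aL aR k l s) (h₁ : s'.reg xS = s.reg xS)
    (h₂ : s'.arr aL = s.arr aL) (h₃ : s'.arr aR = s.arr aR) :
    Representatives R xS aL aR k l s' :=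
  ⟨h₁.trans h.length_eq, by rw [h₂]; exact h.entry, h.lt, h.separated, by rw [h₃]; exact h.mem,
    by rw [h₃]; exact h.rel⟩

theorem Representatives.nodup {R : ℕ → ℕ → Prop} {xS aL aR k : ℕ} {l : List ℕ} {s : State}
    (h : Representatives R xS aL aR k l s) : l.Nodup :=
  h.separated.imp fun h => h.1.ne

theorem Representatives.length_le {R : ℕ → ℕ → Prop} {xS aL aR k : ℕ} {l : List ℕ} {s : State}
    (h : Representatives R xS aL aR k l s) : l.length ≤ k := by
  rw [← List.toFinset_card_of_nodup h.nodup]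
  have : l.toFinset ⊆ Finset.range k := fun x hx => Finset.mem_range.2 (h.lt x (by simpa using hx))
  simpa using Finset.card_le_card this

/-- The representatives found at any time form a separated list, so `hS` bounds their number
throughout the run and each `u` undergoes at most `S` tests. Neither symmetry nor transitivity of
`R` is needed. The cost `ct u` of a test may depend on `u` but not on the representative. -/
theorem greedy_spec {w n S xS aL aR : ℕ} {test : Prog} {R : ℕ → ℕ → Prop} {ct : ℕ → ℕ} {s : State}
    (hw : Wide n w) (hs : s.reg 0 = n)
    (hx : xS ≠ 0 ∧ xS ≠ 6 ∧ xS ≠ 9 ∧ xS ≠ 12 ∧ xS ≠ 13 ∧ xS ≠ 14) (ha : aL ≠ aR)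
    (htr : ∀ x ∈ [0, 6, 9, 13, 14, xS], test.writesReg x = false)
    (hta : ∀ a ∈ [aL, aR], test.writesArr a = false)
    (htest : ∀ u < n, ∀ r < n, ∀ t, Agree (greedy xS aL aR test) s t → t.reg 6 = u → t.reg 9 = r →
      Hoare w test t (ct u) fun t' => t'.reg 12 ≠ 0 ↔ R u r)
    (hS : ∀ l : List ℕ, (∀ x ∈ l, x < n) → (l.Pairwise fun a b => a < b ∧ ¬ R b a) →
      l.length ≤ S) :
    Hoare w (greedy xS aL aR test) s (∑ u ∈ Finset.range n, (S * (ct u + 50) + 50) + 50)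
      fun s' => ∃ l, Representatives R xS aL aR n l s' := by
  have hW : 4 * (n * n) + 16 * n + 16 < 2 ^ w := hw
  obtain ⟨hx0, hx6, hx9, hx12, hx13, hx14⟩ := hx
  have ht0 := htr 0 (by simp)
  have ht6 := htr 6 (by simp)
  have ht9 := htr 9 (by simp)
  have ht13 := htr 13 (by simp)
  have ht14 := htr 14 (by simp)
  have htx := htr xS (by simp)
  have hta1 := hta aL (by simp)
  have hta2 := hta aR (by simp)
  refine (Hoare.seq (T₁ := 2) (T₂ := ∑ u ∈ Finset.range n, (S * (ct u + 50) + 50) + 48) ?_).time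
    (by omega)
  refine (Hoare.block (P := .assign xS (.lit 0)) (Q := fun s' => s' = s.setReg xS 0)
    le_rfl ⟨show 0 < 2 ^ w by omega, rfl⟩).mono le_rfl ?_
  rintro _ rfl
  refine (Hoare.forP (N := n) (c := fun u => S * (ct u + 50) + 40)
    (fun k s => ∃ l, Representatives R xS aL aR k l s)
    (by omega) hw.pos ?_ ?_ ?_ ?_ ?_).time ?_
  · simp [Prog.writesReg, forP_writesReg, ht6, hx6.symm]
  · intro k _ t hA _
    refine ⟨trivial, (hA.1 0 ?_).trans ?_⟩
    · simp [Prog.writesReg, forP_writesReg, ht0, hx0.symm]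
    · simp [hs, hx0.symm]
  · exact ⟨[], by simp [hx6], by simp, by simp, by simp, by simp, by simp⟩
  · rintro u hu t hA ht ⟨l, hl⟩
    have hlS : l.length ≤ S := hS l (fun x hx => (hl.lt x hx).trans hu) hl.separated
    have hln := hl.length_le
    refine (Hoare.seq (T₁ := 2) (T₂ := S * (ct u + 50) + 20) ?_).time (by omega)
    refine (Hoare.block (P := .assign 13 (.reg 6)) (Q := fun s' => s' = t.setReg 13 u)
      le_rfl ⟨trivial, by simp [Exp.val, ht]⟩).mono le_rfl ?_
    rintro _ rfl
    refine (Hoare.seq (T₁ := S * (ct u + 50) + 6) (T₂ := 14) ?_).time (by omega)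
    -- Register `13` holds `u` until a representative passes the test. Earlier representatives are
    -- smaller than `u`, so the value `u` at the end means that none has passed.
    refine ((Hoare.forP (N := l.length) (c := fun _ => ct u + 10)
      (fun k s => (s.reg 13 = u ∨ (s.reg 13 ∈ l ∧ R u (s.reg 13))) ∧
        (s.reg 13 = u → ∀ r ∈ l.take k, ¬ R u r))
      (Q := fun s => s.reg 6 = u ∧ Representatives R xS aL aR u l s ∧
        (s.reg 13 = u ∨ (s.reg 13 ∈ l ∧ R u (s.reg 13))) ∧
        (s.reg 13 = u → ∀ r ∈ l, ¬ R u r))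
      (by omega) hw.pos ?_ ?_ ?_ ?_ ?_).time ?_).mono le_rfl ?_
    · simp [Prog.writesReg, ht14]
    · intro k _ t' hA' _
      refine ⟨trivial, (hA'.1 xS ?_).trans ?_⟩
      · simp [Prog.writesReg, forP_writesReg, htx, hx9, hx13, hx14]
      · simp [hl.length_eq, hx13]
    · simp
    · intro i hi t' hA' hti ⟨hI₁, hI₂⟩
      have hrl : l[i] ∈ l := List.getElem_mem hi
      have hru := hl.lt _ hrl
      have hta' : t'.arr aL = t.arr aL := hA'.2 aL
        (by simp [Prog.writesArr, forP_writesArr, hta1])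
      have h6 : t'.reg 6 = u := (hA'.1 6
        (by simp [Prog.writesReg, forP_writesReg, ht6])).trans (by simp [ht])
      refine (Hoare.seq (T₁ := 3) (T₂ := ct u + 7) ?_).time (by omega)
      refine (Hoare.block (P := .assign 9 (.get aL (.reg 14)))
        (Q := fun s' => s' = t'.setReg 9 l[i])
        le_rfl ⟨trivial, by simp [Exp.val, hta', hti, hl.entry i hi]⟩).mono le_rfl ?_
      rintro _ rfl
      refine (Hoare.seq (T₁ := ct u) (T₂ := 7) ?_).time (by omega)
      refine (htest u hu l[i] (hru.trans hu) (t'.setReg 9 l[i]) ?_ (by simp [h6])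
        (by simp)).frame.mono le_rfl ?_
      · have hsub : ∀ x, (greedy xS aL aR test).writesReg x = false →
            x ≠ xS ∧ x ≠ 6 ∧ x ≠ 9 ∧ x ≠ 13 ∧ x ≠ 14 ∧ x ≠ 12 ∨ x = 12 ∧ x ≠ xS := by
          intro x
          simp only [greedy, Prog.writesReg, forP_writesReg]
          simp only [Bool.or_eq_false_iff, beq_eq_false_iff_ne]
          tauto
        -- The test is specified in states that agree with the initial state of the whole greedy
        -- program, so agreement is chained through the inner loop, the outer loop and the single
        -- assignments.
        refine ⟨fun x hxw => ?_, fun a haw => ?_⟩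
        · have e1 : t'.reg x = (t.setReg 13 u).reg x := hA'.1 x (by
            revert hxw
            simp only [greedy, Prog.writesReg, forP_writesReg]
            simp +contextual)
          have e2 : t.reg x = (s.setReg xS 0).reg x := hA.1 x (by
            revert hxw
            simp only [greedy, Prog.writesReg, forP_writesReg]
            simp +contextual)
          have hn : x ≠ 9 ∧ x ≠ 13 ∧ x ≠ xS := by
            rcases hsub x hxw with h | h
            · tauto
            · refine ⟨?_, ?_, h.2⟩ <;> omega
          simp [e1, e2, hn]
        · have e1 : t'.arr a = (t.setReg 13 u).arr a := hA'.2 a (by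
            revert haw
            simp only [greedy, Prog.writesArr, forP_writesArr]
            simp +contextual)
          have e2 : t.arr a = (s.setReg xS 0).arr a := hA.2 a (by
            revert haw
            simp only [greedy, Prog.writesArr, forP_writesArr]
            simp +contextual)
          simp [e1, e2]
      · rintro t₂ ⟨hA₂, hR⟩
        have h9 : t₂.reg 9 = l[i] := (hA₂.1 9 ht9).trans (by simp)
        have h13 : t₂.reg 13 = t'.reg 13 := (hA₂.1 13 ht13).trans (by simp)
        have htake : l.take (i + 1) = l.take i ++ [l[i]] := by
          rw [List.take_succ_eq_append_getElem hi]
        refine Hoare.block (by decide) ⟨trivial, fun h => ⟨trivial, ?_⟩, fun h => ?_⟩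
        · have hR' := hR.1 h
          simp only [Exp.val, h9]
          simp [hrl, hR', hru.ne]
        · have hR' : ¬ R u l[i] := fun h' => hR.2 h' h
          show _ ∧ _
          simp only [State.setReg_reg, h13, htake]
          simp only [Nat.reduceEqDiff, if_false]
          refine ⟨hI₁, fun h' r hr => ?_⟩
          rcases List.mem_append.1 hr with hr | hr
          · exact hI₂ h' r hr
          · rw [List.mem_singleton.1 hr]; exact hR'
    · intro t' hA' hI
      refine ⟨?_, hl.congr ?_ ?_ ?_, by simpa using hI⟩
      · exact (hA'.1 6 (by simp [Prog.writesReg, forP_writesReg, ht6])).trans (by simp [ht])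
      · exact (hA'.1 xS (by
          simp [Prog.writesReg, forP_writesReg, htx, hx9, hx13, hx14])).trans (by simp [hx13])
      · exact hA'.2 aL (by simp [Prog.writesArr, forP_writesArr, hta1])
      · exact hA'.2 aR (by simp [Prog.writesArr, forP_writesArr, hta2])
    · simp only [Finset.sum_const, Finset.card_range, smul_eq_mul, Exp.cost]
      have := Nat.mul_le_mul hlS (show ct u + 10 + (1 + 7) ≤ ct u + 50 by omega)
      omega
    · rintro t' ⟨h6, hl', hf, hnf⟩
      refine Hoare.block (by simp [Prog.maxTime, Exp.cost]) ?_
      refine ⟨⟨trivial, trivial, hw.pos⟩, fun h => ?_, fun h => ?_⟩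
      · have h13 : t'.reg 13 = u := by
          by_contra hne
          simp [Exp.val, BinOp.val, h6, hne] at h
        refine ⟨trivial, trivial, ⟨trivial, show 1 < 2 ^ w by omega, ?_⟩, trivial, trivial,
          l ++ [u], ?_⟩
        · simp only [BinOp.ok, Exp.val, State.setArr_reg, hl'.length_eq]; omega
        · constructor
          · simp [Exp.val, BinOp.val, hl'.length_eq, hx6]
          · intro i hi
            have hi' : i < l.length + 1 := by simpa using hi
            simp only [Exp.val, h6, hl'.length_eq, State.setReg_arr, State.setArr_arr, if_true,
              if_neg ha, Function.update_apply]
            rcases Nat.lt_succ_iff_lt_or_eq.1 hi' with hi'' | rfl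
            · rw [if_neg hi''.ne, hl'.entry i hi'', List.getElem_append_left hi'']
            · simp
          · intro x hx
            rcases List.mem_append.1 hx with hx | hx
            · exact (hl'.lt x hx).trans (Nat.lt_succ_self u)
            · rw [List.mem_singleton.1 hx]; exact Nat.lt_succ_self u
          · rw [List.pairwise_append]
            refine ⟨hl'.separated, by simp, fun a ha b hb => ?_⟩
            rw [List.mem_singleton.1 hb]
            exact ⟨hl'.lt a ha, hnf h13 a ha⟩
          · intro v hv
            simp only [Exp.val, State.setReg_arr, State.setArr_arr, if_true, State.setReg_reg,
              State.setArr_reg, if_neg ha.symm, if_neg hx6.symm, if_neg hx13.symm,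
              Function.update_apply, h6, h13]
            split_ifs with hvu
            · simp
            · exact List.mem_append_left _ (hl'.mem v (by omega))
          · intro v hv
            simp only [Exp.val, State.setReg_arr, State.setArr_arr, if_true, State.setReg_reg,
              State.setArr_reg, if_neg ha.symm, if_neg hx6.symm, if_neg hx13.symm,
              Function.update_apply, h6, h13]
            split_ifs with hvu
            · exact Or.inl hvu.symm
            · exact hl'.rel v (by omega)
      · have h13 : t'.reg 13 ≠ u := by
          intro heq
          simp [Exp.val, BinOp.val, h6, heq] at h
        obtain ⟨hm, hR⟩ := hf.resolve_left h13
        refine ⟨trivial, trivial, l, ?_⟩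
        constructor
        · simp [hl'.length_eq, hx6]
        · intro i hi
          simp [ha, hl'.entry i hi]
        · exact fun x hx => (hl'.lt x hx).trans (Nat.lt_succ_self u)
        · exact hl'.separated
        · intro v hv
          simp only [Exp.val, State.setReg_arr, State.setArr_arr, if_true,
            Function.update_apply, h6]
          split_ifs with hvu
          · exact hm
          · exact hl'.mem v (by omega)
        · intro v hv
          simp only [Exp.val, State.setReg_arr, State.setArr_arr, if_true,
            Function.update_apply, h6]
          split_ifs with hvu
          · rw [hvu]; exact Or.inr hR
          · exact hl'.rel v (by omega)
  · intro t hA h; exact h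
  · simp only [Exp.cost, add_assoc, Nat.reduceAdd]
    refine Nat.add_le_add (Finset.sum_le_sum fun u _ => ?_) ?_ <;> omega

/-! ## Symmetric differences of neighbourhoods -/

/-- The symmetric difference of two closed neighbourhoods, as a list. -/
def diffList (cl : ℕ → List ℕ) (u r : ℕ) : List ℕ :=
  (cl u).filter (fun x => x ∉ cl r) ++ (cl r).filter (fun x => x ∉ cl u)

theorem mem_diffList {cl : ℕ → List ℕ} {u r x : ℕ} :
    x ∈ diffList cl u r ↔ (x ∈ cl u ∧ x ∉ cl r) ∨ (x ∈ cl r ∧ x ∉ cl u) := by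
  simp [diffList]

theorem diffList_self (cl : ℕ → List ℕ) (u : ℕ) : diffList cl u u = [] := by
  simp [diffList]

variable {n : ℕ} {cl : ℕ → List ℕ}

theorem ClosedLists.diffList_nodup (h : ClosedLists n cl) {u r : ℕ} (hu : u < n) (hr : r < n) :
    (diffList cl u r).Nodup := by
  refine List.Nodup.append ((h.nodup u hu).filter _) ((h.nodup r hr).filter _) ?_
  intro x hx hx'
  simp only [List.mem_filter, decide_eq_true_eq] at hx hx'
  exact hx.2 hx'.1

theorem ClosedLists.diffList_lt (h : ClosedLists n cl) {u r x : ℕ} (hu : u < n) (hr : r < n)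
    (hx : x ∈ diffList cl u r) : x < n := by
  rcases mem_diffList.1 hx with h' | h'
  · exact h.lt u hu x h'.1
  · exact h.lt r hr x h'.1

theorem ClosedLists.diffList_length_le (h : ClosedLists n cl) {u r : ℕ} (hu : u < n) (hr : r < n) :
    (diffList cl u r).length ≤ n := by
  rw [← List.toFinset_card_of_nodup (h.diffList_nodup hu hr)]
  have : (diffList cl u r).toFinset ⊆ Finset.range n := fun x hx =>
    Finset.mem_range.2 (h.diffList_lt hu hr (by simpa using hx))
  simpa using Finset.card_le_card this

/-- Inclusion–exclusion: the size of a symmetric difference follows from the two degrees and the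
size of the intersection, and the latter can be counted by scanning one list only. -/
theorem ClosedLists.diffList_length (h : ClosedLists n cl) {u r : ℕ} (hu : u < n) (hr : r < n) :
    (cl u).length + (cl r).length =
      (diffList cl u r).length + 2 * ((cl u).filter (fun x => x ∈ cl r)).length := by
  have h₁ := List.length_eq_length_filter_add (l := cl u) (fun x => decide (x ∈ cl r))
  have h₂ := List.length_eq_length_filter_add (l := cl r) (fun x => decide (x ∈ cl u))
  have h₃ : ((cl u).filter (fun x => x ∈ cl r)).length =
      ((cl r).filter (fun x => x ∈ cl u)).length := by
    rw [← List.toFinset_card_of_nodup ((h.nodup u hu).filter _),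
      ← List.toFinset_card_of_nodup ((h.nodup r hr).filter _)]
    congr 1
    ext x
    simp [and_comm]
  simp only [diffList, List.length_append, decide_not]
  omega

/-- Bounds the cost of scanning the neighbourhood of a centre by the degree of the vertex assigned
to it plus the size of their difference. A single centre may serve many vertices, so its own degree
would be a poor measure. -/
theorem ClosedLists.length_le_add_diffList (h : ClosedLists n cl) {u r : ℕ} (hu : u < n)
    (hr : r < n) : (cl r).length ≤ (cl u).length + (diffList cl u r).length := by
  have := h.diffList_length hu hr
  have := List.length_filter_le (fun x => decide (x ∈ cl r)) (cl u)
  omega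

/-- Two vertices are near each other when their neighbourhoods differ in at most `n / q` places. -/
def Near (n : ℕ) (cl : ℕ → List ℕ) (q u r : ℕ) : Prop := q * (diffList cl u r).length ≤ n

/-- The table entry of array `2` for the vertices in registers `v` and `x`. -/
abbrev tableE (v x : ℕ) : Exp := .get 2 (addE (mulE (.reg v) (.reg 0)) (.reg x))

/-- Tests whether the vertices in registers `6` and `9` are near each other. -/
def nearTest : Prog :=
  .seq (.assign 10 (.lit 0)) (.seq
    (forNbr 7 8 6 (.assign 10 (addE (.reg 10) (tableE 9 8))))
    (.assign 12 (ltE (mulE (.reg 1)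
      (subE (addE (addE (degE 6) (.lit 1)) (addE (degE 9) (.lit 1))) (mulE (.lit 2) (.reg 10))))
      (addE (.reg 0) (.lit 1)))))

theorem degE_spec {w v V : ℕ} {s : State} (hw : Wide n w) (hG : HasGraph n cl s) (hV : V < n)
    (hsV : s.reg v = V) :
    (degE v).ok w s ∧ (degE v).val s + 1 = (cl V).length := by
  have hW : 4 * (n * n) + 16 * n + 16 < 2 ^ w := hw
  have := hG.length_eq hV
  have h₃ := hG.offset_le (V + 1) hV
  refine ⟨⟨⟨trivial, show 1 < 2 ^ w by omega, ?_⟩, trivial, ?_⟩, ?_⟩ <;>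
    simp only [Exp.val, BinOp.ok, BinOp.val, hsV, degE] <;> omega

/-- Only `N[u]` is scanned; membership in `N[r]` is looked up in the table, and
`ClosedLists.diffList_length` yields the size of the difference. Thus the cost is proportional to
the degree of `u` whatever `r` is, and testing all `u` against `S` representatives costs about `S ∑
|N[u]|`. The comparison with `n + 1` expresses `≤ n` by `<`. -/
theorem nearTest_spec {w q u r : ℕ} {s : State} (hw : Wide n w) (hC : ClosedLists n cl)
    (hG : HasGraph n cl s) (hA : IsAdjTable n cl s) (hq : s.reg 1 = q) (hqn : q ≤ n) (hu : u < n)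
    (hr : r < n) (h6 : s.reg 6 = u) (h9 : s.reg 9 = r) :
    Hoare w nearTest s ((cl u).length * 50 + 60) fun s' => s'.reg 12 ≠ 0 ↔ Near n cl q u r := by
  have hW : 4 * (n * n) + 16 * n + 16 < 2 ^ w := hw
  refine (Hoare.seq (T₁ := 2) (T₂ := (cl u).length * 50 + 58) ?_).time (by omega)
  refine (Hoare.block (P := .assign 10 (.lit 0)) (Q := fun s' => s' = s.setReg 10 0)
    le_rfl ⟨show 0 < 2 ^ w by omega, rfl⟩).mono le_rfl ?_
  rintro _ rfl
  have hG' : HasGraph n cl (s.setReg 10 0) := hG.congr rfl rfl rfl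
  refine (Hoare.seq (T₁ := (cl u).length * (9 + 32) + 14) (T₂ := 40) ?_).time (by omega)
  refine (Hoare.forNbr (c := 9) (Q := fun s' => s'.reg 6 = u ∧ s'.reg 9 = r ∧ s'.reg 1 = q ∧
      HasGraph n cl s' ∧ s'.reg 10 = ((cl u).filter (fun x => x ∈ cl r)).length)
    (fun pre s => s.reg 10 = (pre.filter (fun x => x ∈ cl r)).length) hw hG' hu (by simp [h6])
    rfl rfl rfl rfl rfl (by decide) (by simp) ?_ ?_ ?_).mono le_rfl ?_
  · intro pre s y h; exact ⟨h, h⟩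
  · intro pre y post hpre t hAt hy hI
    have hyn : y < n := hC.lt u hu y (by simp [hpre])
    have h9' : t.reg 9 = r := (hAt.1 9 rfl).trans (by simp [h9])
    have h0' : t.reg 0 = n := (hAt.1 0 rfl).trans (by simp [hG.size])
    have h2' : t.arr 2 = s.arr 2 := hAt.2 2 rfl
    have hidx := idx_lt hr hyn
    have hpl : (pre.filter (fun x => x ∈ cl r)).length ≤ n := by
      refine (List.length_filter_le _ _).trans ((?_ : _ ≤ (cl u).length).trans (hC.length_le hu))
      simp [hpre]
    have hval : t.arr 2 (r * n + y) ≤ 1 := by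
      rw [h2', hA r hr y hyn]; split_ifs <;> omega
    refine Hoare.block (by decide) ⟨⟨trivial, ⟨⟨trivial, trivial, ?_⟩, trivial, ?_⟩, ?_⟩, ?_⟩
    · simp only [BinOp.ok, Exp.val, h9', h0']; omega
    · simp only [BinOp.ok, BinOp.val, Exp.val, h9', h0', hy]; omega
    · simp only [BinOp.ok, BinOp.val, Exp.val, h9', h0', hy, hI]; omega
    · simp only [BinOp.val, Exp.val, h9', h0', hy, hI, State.setReg_reg, if_true, h2',
        hA r hr y hyn, List.filter_append, List.length_append]
      by_cases h : y ∈ cl r <;> simp [h]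
  · intro t hAt h
    exact ⟨(hAt.1 6 rfl).trans (by simp [h6]), (hAt.1 9 rfl).trans (by simp [h9]),
      (hAt.1 1 rfl).trans (by simp [hq]), hG'.congr (hAt.1 0 rfl) (hAt.2 0 rfl) (hAt.2 1 rfl), h⟩
  · rintro t ⟨h6', h9', h1', hGt, h10⟩
    obtain ⟨hk, hv⟩ := degE_spec hw hGt hu h6'
    obtain ⟨hk', hv'⟩ := degE_spec hw hGt hr h9'
    have hlu := hC.length_le hu
    have hlr := hC.length_le hr
    have hd := hC.diffList_length hu hr
    have hm : q * (diffList cl u r).length ≤ n * n :=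
      Nat.mul_le_mul hqn (hC.diffList_length_le hu hr)
    have hsub : (degE 6).val t + 1 + ((degE 9).val t + 1) - 2 * t.reg 10 =
        (diffList cl u r).length := by omega
    refine Hoare.block (by decide) ⟨⟨⟨trivial, ⟨⟨⟨hk, show 1 < 2 ^ w by omega, ?_⟩,
      ⟨hk', show 1 < 2 ^ w by omega, ?_⟩, ?_⟩, ⟨show 2 < 2 ^ w by omega, trivial, ?_⟩, ?_⟩, ?_⟩,
      ⟨trivial, show 1 < 2 ^ w by omega, ?_⟩, hw.pos⟩, ?_⟩
    · simp only [BinOp.ok, Exp.val]; omega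
    · simp only [BinOp.ok, Exp.val]; omega
    · simp only [BinOp.ok, BinOp.val, Exp.val]; omega
    · simp only [BinOp.ok, Exp.val]; omega
    · simp only [BinOp.ok, BinOp.val, Exp.val]; omega
    · simp only [BinOp.ok, BinOp.val, Exp.val, hsub, h1']; omega
    · simp only [BinOp.ok, Exp.val, hGt.size]; omega
    · simp only [BinOp.val, Exp.val, hsub, h1', hGt.size, State.setReg_reg, if_true, Near]
      split_ifs with h <;> simp <;> omega

/-- Appends the vertex in register `8` to row `reg 6` of array `5`, unless it is adjacent to the
vertex in register `v`. -/
def pushNonadjacent (v : ℕ) : Prog :=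
  .ite (tableE v 8) .skip
    (.seq (.put 5 (addE (mulE (.reg 6) (.reg 0)) (.reg 10)) (.reg 8))
      (.assign 10 (addE (.reg 10) (.lit 1))))

/-- Computes, for every vertex, the symmetric difference between its neighbourhood and that of its
representative in array `4`: the rows of array `5` hold these sets, array `6` their sizes. -/
def diffProg : Prog :=
  forP 6 (.reg 0) (.seq (.assign 9 (.get 4 (.reg 6))) (.seq (.assign 10 (.lit 0)) (.seq
    (forNbr 7 8 6 (pushNonadjacent 9)) (.seq (forNbr 7 8 9 (pushNonadjacent 6))
      (.put 6 (.reg 6) (.reg 10))))))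

/-- Row `u` of array `a` starts with the list `l`. -/
def RowHolds (n a u : ℕ) (l : List ℕ) (s : State) : Prop :=
  ∀ i, ∀ h : i < l.length, s.arr a (u * n + i) = l[i]

/-- The rows of array `5` below `k` hold the symmetric differences to the representatives `cen`. -/
def DiffRows (n : ℕ) (cl : ℕ → List ℕ) (cen : ℕ → ℕ) (k : ℕ) (s : State) : Prop :=
  ∀ u < k, s.arr 6 u = (diffList cl u (cen u)).length ∧ RowHolds n 5 u (diffList cl u (cen u)) s

/-- The hypothesis `hl` guarantees that an appended entry stays inside row `u` of the table, so the
rows finished earlier are preserved. -/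
theorem pushNonadjacent_spec {w u v V y : ℕ} {cen : ℕ → ℕ} {s : State} {l : List ℕ}
    (hw : Wide n w) (hC : ClosedLists n cl) (hcen : ∀ u < n, cen u < n)
    (hA : IsAdjTable n cl s)
    (hu : u < n) (hV : V < n) (hy : y < n) (h0 : s.reg 0 = n) (h6 : s.reg 6 = u)
    (hsv : s.reg v = V) (h8 : s.reg 8 = y) (hl : y ∉ cl V → l.length < n)
    (h10 : s.reg 10 = l.length) (hrow : RowHolds n 5 u l s) (hD : DiffRows n cl cen u s) :
    Hoare w (pushNonadjacent v) s 20 fun s' =>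
      s'.reg 10 = (l ++ [y].filter fun x => x ∉ cl V).length ∧
      RowHolds n 5 u (l ++ [y].filter fun x => x ∉ cl V) s' ∧ DiffRows n cl cen u s' := by
  have hW : 4 * (n * n) + 16 * n + 16 < 2 ^ w := hw
  have hidx := idx_lt hV hy
  refine (Hoare.of_vc ?_).time (T' := 20) (by simp [pushNonadjacent, Prog.maxTime, Exp.cost])
  refine ⟨⟨⟨trivial, trivial, ?_⟩, trivial, ?_⟩, fun h => ?_, fun h => ?_⟩
  · simp only [BinOp.ok, Exp.val, hsv, h0]; omega
  · simp only [BinOp.ok, BinOp.val, Exp.val, hsv, h0, h8]; omega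
  · have hy' : y ∈ cl V := by
      by_contra hy'
      simp [BinOp.val, Exp.val, hsv, h0, h8, hA V hV y hy, hy'] at h
    have : ([y].filter fun x => x ∉ cl V) = [] := by simp [hy']
    show _ ∧ _
    simp only [this, List.append_nil]
    exact ⟨h10, hrow, hD⟩
  · have hy' : y ∉ cl V := by
      intro hy'
      simp [BinOp.val, Exp.val, hsv, h0, h8, hA V hV y hy, hy'] at h
    have hll := hl hy'
    have hidx' := idx_lt hu hll
    have : ([y].filter fun x => x ∉ cl V) = [y] := by simp [hy']
    refine ⟨⟨⟨trivial, trivial, ?_⟩, trivial, ?_⟩, trivial,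
      ⟨trivial, show 1 < 2 ^ w by omega, ?_⟩, ?_⟩
    · simp only [BinOp.ok, Exp.val, h6, h0]; omega
    · simp only [BinOp.ok, BinOp.val, Exp.val, h6, h0, h10]; omega
    · simp only [BinOp.ok, Exp.val, State.setArr_reg, h10]; omega
    · simp only [this]
      refine ⟨by simp [BinOp.val, Exp.val, h10], ?_, ?_⟩
      · intro i hi
        simp only [List.length_append, List.length_singleton] at hi
        simp only [BinOp.val, Exp.val, h6, h0, h8, h10, State.setReg_arr, State.setArr_arr, if_true,
          Function.update_apply]
        rcases Nat.lt_succ_iff_lt_or_eq.1 hi with hi' | rfl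
        · rw [if_neg (by omega), hrow i hi', List.getElem_append_left hi']
        · simp
      · intro x hx
        obtain ⟨h₁, h₂⟩ := hD x hx
        refine ⟨by simpa using h₁, fun i hi => ?_⟩
        have hin : i < n := lt_of_lt_of_le hi
          (hC.diffList_length_le (hx.trans hu) (hcen x (hx.trans hu)))
        simp only [BinOp.val, Exp.val, h6, h0, h8, h10, State.setReg_arr, State.setArr_arr, if_true,
          Function.update_apply, idx_inj hin hll, if_neg (fun h : x = u ∧ _ => hx.ne h.1)]
        exact h₂ i hi

theorem diffProg_spec {w K : ℕ} {cen : ℕ → ℕ} {s : State} (hw : Wide n w) (hC : ClosedLists n cl)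
    (hG : HasGraph n cl s) (hA : IsAdjTable n cl s) (hcen : ∀ u < n, cen u < n)
    (h4 : ∀ u < n, s.arr 4 u = cen u) (hK : ∀ u < n, (diffList cl u (cen u)).length ≤ K) :
    Hoare w diffProg s (∑ u ∈ Finset.range n, (((cl u).length * 2 + K) * 60 + 60) + 50)
      (DiffRows n cl cen n) := by
  have hW : 4 * (n * n) + 16 * n + 16 < 2 ^ w := hw
  refine (Hoare.forP (N := n) (c := fun u => ((cl u).length * 2 + K) * 60 + 40)
    (fun k s => DiffRows n cl cen k s) (by omega) hw.pos rfl ?_ ?_ ?_ ?_).time ?_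
  · intro k _ t hA _
    exact ⟨trivial, (hA.1 0 rfl).trans hG.size⟩
  · intro u hu; omega
  · intro u hu t hAt h6 hD
    have hcu := hcen u hu
    have hGt : HasGraph n cl t := hG.congr (hAt.1 0 rfl) (hAt.2 0 rfl) (hAt.2 1 rfl)
    have hAdj : t.arr 2 = s.arr 2 := hAt.2 2 rfl
    have h4t : t.arr 4 = s.arr 4 := hAt.2 4 rfl
    -- The second scan runs over the list of the centre; its length is charged to `u` and to the
    -- bound `K` on the difference.
    have hlen : (cl (cen u)).length ≤ (cl u).length + K :=
      (hC.length_le_add_diffList hu hcu).trans (Nat.add_le_add_left (hK u hu) _)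
    have hT : (cl u).length * (20 + 32) + 14 + ((cl (cen u)).length * (20 + 32) + 14) + 8 ≤
        ((cl u).length * 2 + K) * 60 + 40 := by omega
    have hdl := hC.diffList_length_le hu hcu
    refine (Hoare.seq (T₁ := 3) (T₂ := (cl u).length * (20 + 32) + 14 +
      ((cl (cen u)).length * (20 + 32) + 14) + 5) ?_).time (by omega)
    refine (Hoare.block (P := .assign 9 (.get 4 (.reg 6))) (Q := fun s' => s' = t.setReg 9 (cen u))
      le_rfl ⟨trivial, by simp [Exp.val, h6, h4t, h4 u hu]⟩).mono le_rfl ?_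
    rintro _ rfl
    refine (Hoare.seq (T₁ := 2) (T₂ := (cl u).length * (20 + 32) + 14 +
      ((cl (cen u)).length * (20 + 32) + 14) + 3) ?_).time (by omega)
    refine (Hoare.block (P := .assign 10 (.lit 0))
      (Q := fun s' => s' = (t.setReg 9 (cen u)).setReg 10 0)
      le_rfl ⟨show 0 < 2 ^ w by omega, rfl⟩).mono le_rfl ?_
    rintro _ rfl
    set t₁ := (t.setReg 9 (cen u)).setReg 10 0 with ht₁
    have hG₁ : HasGraph n cl t₁ := hGt.congr rfl rfl rfl
    have hA₁ : IsAdjTable n cl t₁ := by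
      intro a ha x hx; rw [← hA a ha x hx, ← hAdj]; rfl
    refine (Hoare.seq (T₁ := (cl u).length * (20 + 32) + 14) (T₂ :=
      ((cl (cen u)).length * (20 + 32) + 14) + 3) ?_).time (by omega)
    refine (Hoare.forNbr (c := 20) (Q := fun s' => Agree (forNbr 7 8 6 (pushNonadjacent 9)) t₁ s' ∧
        s'.reg 10 = ((cl u).filter fun x => x ∉ cl (cen u)).length ∧
        RowHolds n 5 u ((cl u).filter fun x => x ∉ cl (cen u)) s' ∧ DiffRows n cl cen u s')
      (fun pre s' => s'.reg 10 = (pre.filter fun x => x ∉ cl (cen u)).length ∧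
        RowHolds n 5 u (pre.filter fun x => x ∉ cl (cen u)) s' ∧ DiffRows n cl cen u s')
      hw hG₁ hu (by simp [ht₁, h6]) rfl rfl rfl rfl rfl (by decide) ?_ ?_ ?_ ?_).mono le_rfl ?_
    · exact ⟨by simp [ht₁], by intro i hi; simp at hi, hD⟩
    · intro pre s' y h; exact ⟨h, h⟩
    · rintro pre y post hpre s' hA' hy ⟨h10, hrow, hD'⟩
      have hyn : y < n := hC.lt u hu y (by simp [hpre])
      have hAd : IsAdjTable n cl s' := by
        intro a ha x hx; rw [← hA₁ a ha x hx, hA'.2 2 rfl]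
      -- The entry `y` about to be written belongs to the difference list as well, so the part
      -- written before it is strictly shorter than that list, whose length is at most `n`.
      have hlt : y ∉ cl (cen u) → (pre.filter fun x => x ∉ cl (cen u)).length < n := by
        intro hyc
        refine lt_of_lt_of_le ?_ hdl
        simp only [diffList, hpre, List.filter_append, List.length_append]
        rw [List.filter_cons_of_pos (by simpa using hyc)]
        simp only [List.length_cons]; omega
      simp only [List.filter_append]
      exact pushNonadjacent_spec hw hC hcen hAd hu hcu hyn
        ((hA'.1 0 rfl).trans hG₁.size) ((hA'.1 6 rfl).trans (by simp [ht₁, h6]))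
        ((hA'.1 9 rfl).trans (by simp [ht₁])) hy hlt h10 hrow hD'
    · intro s' hA' h; exact ⟨hA', h⟩
    · rintro t₂ ⟨hA₂, h10, hrow, hD₂⟩
      have hG₂ : HasGraph n cl t₂ := hG₁.congr (hA₂.1 0 rfl) (hA₂.2 0 rfl) (hA₂.2 1 rfl)
      have hAd₂ : IsAdjTable n cl t₂ := by
        intro a ha x hx; rw [← hA₁ a ha x hx, hA₂.2 2 rfl]
      refine Hoare.seq (T₁ := (cl (cen u)).length * (20 + 32) + 14) (T₂ := 3) ?_
      refine (Hoare.forNbr (V := cen u) (c := 20) (Q := fun s' => s'.reg 6 = u ∧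
          s'.reg 10 = (diffList cl u (cen u)).length ∧
          RowHolds n 5 u (diffList cl u (cen u)) s' ∧ DiffRows n cl cen u s')
        (fun pre s' => s'.reg 10 = (((cl u).filter fun x => x ∉ cl (cen u)) ++
            pre.filter fun x => x ∉ cl u).length ∧
          RowHolds n 5 u (((cl u).filter fun x => x ∉ cl (cen u)) ++
            pre.filter fun x => x ∉ cl u) s' ∧ DiffRows n cl cen u s')
        hw hG₂ hcu ((hA₂.1 9 rfl).trans (by simp [ht₁])) rfl rfl rfl rfl rfl (by decide)
          ?_ ?_ ?_ ?_).mono le_rfl ?_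
      · simp only [List.filter_nil, List.append_nil]; exact ⟨h10, hrow, hD₂⟩
      · intro pre s' y h; exact ⟨h, h⟩
      · rintro pre y post hpre s' hA' hy ⟨h10, hrow, hD'⟩
        have hyn : y < n := hC.lt (cen u) hcu y (by simp [hpre])
        have hAd : IsAdjTable n cl s' := by
          intro a ha x hx; rw [← hAd₂ a ha x hx, hA'.2 2 rfl]
        have h6' : s'.reg 6 = u :=
          (hA'.1 6 rfl).trans ((hA₂.1 6 rfl).trans (by simp [ht₁, h6]))
        have hlt : y ∉ cl u → (((cl u).filter fun x => x ∉ cl (cen u)) ++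
            pre.filter fun x => x ∉ cl u).length < n := by
          intro hyc
          refine lt_of_lt_of_le ?_ hdl
          simp only [diffList, hpre, List.filter_append, List.length_append]
          rw [List.filter_cons_of_pos (p := fun x => decide (x ∉ cl u)) (by simpa using hyc)]
          simp only [List.length_cons]; omega
        simp only [List.filter_append, ← List.append_assoc]
        exact pushNonadjacent_spec hw hC hcen hAd hu hu hyn
          ((hA'.1 0 rfl).trans hG₂.size) h6' h6' hy hlt h10 hrow hD'
      · intro s' hA' h
        exact ⟨(hA'.1 6 rfl).trans ((hA₂.1 6 rfl).trans (by simp [ht₁, h6])), h⟩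
      · rintro t₃ ⟨h6', h10', hrow', hD'⟩
        refine Hoare.block le_rfl ⟨trivial, trivial, ?_⟩
        intro x hx
        simp only [Exp.val, h6', h10', RowHolds, State.setReg_arr, State.setArr_arr, if_true,
          Function.update_apply]
        simp only [Nat.reduceEqDiff, if_false]
        rcases Nat.lt_succ_iff_lt_or_eq.1 hx with hx' | rfl
        · simpa [hx'.ne, RowHolds] using hD' x hx'
        · simpa [RowHolds] using hrow'
  · intro t hA h; exact h
  · refine Nat.add_le_add (Finset.sum_le_sum fun u _ => ?_) ?_
    · simp only [Exp.cost]; omega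
    · simp only [Exp.cost]; omega

/-! ## Classes of vertices with the same trace on a list of vertices -/

/-- The vertices `u` and `r` are adjacent to the same members of `cs`. -/
def SameTrace (cl : ℕ → List ℕ) (cs : List ℕ) (u r : ℕ) : Prop := ∀ x ∈ cs, (r ∈ cl x ↔ u ∈ cl x)

/-- Entry of the adjacency table for the vertex in cell `reg 7` of array `3` and that in
register `v`. -/
abbrev listedE (v : ℕ) : Exp := .get 2 (addE (mulE (.get 3 (.reg 7)) (.reg 0)) (.reg v))

/-- Tests whether the vertices in registers `6` and `9` have the same trace on the list in
array `3`. -/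
def traceTest : Prog :=
  .seq (.assign 12 (.lit 1)) (forP 7 (.reg 2) (.ite (eqE (listedE 9) (listedE 6)) .skip
    (.assign 12 (.lit 0))))

theorem traceTest_spec {w S u r : ℕ} {cs : List ℕ} {s : State} (hw : Wide n w)
    (h0 : s.reg 0 = n) (hA : IsAdjTable n cl s) (h2 : s.reg 2 = cs.length)
    (h3 : ∀ i, ∀ h : i < cs.length, s.arr 3 i = cs[i]) (hc : ∀ x ∈ cs, x < n) (hcn : cs.length ≤ n)
    (hS : cs.length ≤ S) (hu : u < n) (hr : r < n) (h6 : s.reg 6 = u) (h9 : s.reg 9 = r) :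
    Hoare w traceTest s (S * 40 + 20) fun s' => s'.reg 12 ≠ 0 ↔ SameTrace cl cs u r := by
  have hW : 4 * (n * n) + 16 * n + 16 < 2 ^ w := hw
  refine (Hoare.seq (T₁ := 2) (T₂ := S * 40 + 10) ?_).time (by omega)
  refine (Hoare.block (P := .assign 12 (.lit 1)) (Q := fun s' => s' = s.setReg 12 1)
    le_rfl ⟨show 1 < 2 ^ w by omega, rfl⟩).mono le_rfl ?_
  rintro _ rfl
  refine (Hoare.forP (N := cs.length) (c := fun _ => 18)
    (fun k s => s.reg 12 ≠ 0 ↔ ∀ x ∈ cs.take k, (r ∈ cl x ↔ u ∈ cl x)) (by omega) hw.pos rfl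
    ?_ ?_ ?_ ?_).time ?_
  · intro k _ t hA _
    exact ⟨trivial, (hA.1 2 rfl).trans h2⟩
  · simp
  · intro i hi t hAt h7 hI
    have h0' : t.reg 0 = n := (hAt.1 0 rfl).trans h0
    have h6' : t.reg 6 = u := (hAt.1 6 rfl).trans h6
    have h9' : t.reg 9 = r := (hAt.1 9 rfl).trans h9
    have ha2 : t.arr 2 = s.arr 2 := hAt.2 2 rfl
    have ha3 : t.arr 3 i = cs[i] := by rw [hAt.2 3 rfl]; exact h3 i hi
    have hcx := hc _ (List.getElem_mem hi)
    have hx1 := idx_lt hcx hu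
    have hx2 := idx_lt hcx hr
    have htake : cs.take (i + 1) = cs.take i ++ [cs[i]] := by
      rw [List.take_succ_eq_append_getElem hi]
    have hval : (eqE (listedE 9) (listedE 6)).val t = if r ∈ cl cs[i] ↔ u ∈ cl cs[i] then 1 else 0 := by
      simp only [Exp.val, BinOp.val, h7, h0', h6', h9', ha2, ha3, hA _ hcx _ hu, hA _ hcx _ hr]
      by_cases h1 : r ∈ cl cs[i] <;> by_cases h2 : u ∈ cl cs[i] <;> simp [h1, h2]
    refine Hoare.block (by decide) ⟨⟨⟨⟨trivial, trivial, ?_⟩, trivial, ?_⟩,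
      ⟨⟨trivial, trivial, ?_⟩, trivial, ?_⟩, hw.pos⟩, fun h => ?_, fun h => ?_⟩
    · simp only [BinOp.ok, Exp.val, h7, ha3, h0']; omega
    · simp only [BinOp.ok, BinOp.val, Exp.val, h7, ha3, h0', h9']; omega
    · simp only [BinOp.ok, Exp.val, h7, ha3, h0']; omega
    · simp only [BinOp.ok, BinOp.val, Exp.val, h7, ha3, h0', h6']; omega
    · rw [hval] at h
      have h' : r ∈ cl cs[i] ↔ u ∈ cl cs[i] := by by_contra h'; simp [h'] at h
      show _ ↔ _
      rw [htake]
      simp only [List.mem_append, List.mem_singleton]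
      simp only [State.setReg_reg, Nat.reduceEqDiff, if_false, hI]
      refine ⟨fun h x hx => ?_, fun h x hx => h x (Or.inl hx)⟩
      rcases hx with hx | rfl
      · exact h x hx
      · exact h'
    · rw [hval] at h
      have h' : ¬ (r ∈ cl cs[i] ↔ u ∈ cl cs[i]) := by intro h'; simp [h'] at h
      refine ⟨show 0 < 2 ^ w by omega, ?_⟩
      simp only [Exp.val, htake, State.setReg_reg, List.mem_append, List.mem_singleton]
      simp only [Nat.reduceEqDiff, if_true, if_false]
      exact ⟨fun h => absurd rfl h, fun h => absurd (h _ (Or.inr rfl)) h'⟩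
  · intro t hA hI; simpa [SameTrace] using hI
  · simp only [Finset.sum_const, Finset.card_range, smul_eq_mul, Exp.cost]
    have := Nat.mul_le_mul_right 40 hS
    omega

/-- Counts the members of the classes in array `8`; the sizes are left in array `9`. -/
def sizeProg : Prog :=
  forP 6 (.reg 0) (.put 9 (.get 8 (.reg 6)) (addE (.get 9 (.get 8 (.reg 6))) (.lit 1)))

theorem sizeProg_spec {w : ℕ} {s : State} (hw : Wide n w) (h0 : s.reg 0 = n)
    (hz : s.arr 9 = fun _ => 0) :
    Hoare w sizeProg s (n * 50 + 50) fun s' =>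
      ∀ r, s'.arr 9 r = ((Finset.range n).filter fun v => s.arr 8 v = r).card := by
  have hW : 4 * (n * n) + 16 * n + 16 < 2 ^ w := hw
  refine (Hoare.forP (N := n) (c := fun _ => 18)
    (fun k s' => ∀ r, s'.arr 9 r = ((Finset.range k).filter fun v => s.arr 8 v = r).card)
    (by omega) hw.pos rfl ?_ ?_ ?_ ?_).time ?_
  · intro k _ t hA _
    exact ⟨trivial, (hA.1 0 rfl).trans h0⟩
  · simp [hz]
  · intro k hk t hAt h6 hI
    have h8 : t.arr 8 = s.arr 8 := hAt.2 8 rfl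
    have hle : ((Finset.range k).filter fun v => s.arr 8 v = s.arr 8 k).card ≤ n :=
      (Finset.card_filter_le _ _).trans (by simp; omega)
    refine Hoare.block (by decide) ⟨trivial, ⟨trivial, show 1 < 2 ^ w by omega, ?_⟩, ?_⟩
    · simp only [BinOp.ok, Exp.val, h6, h8, hI]; omega
    · intro r
      simp only [BinOp.val, Exp.val, h6, h8, hI, State.setReg_arr, State.setArr_arr, if_true,
        Function.update_apply, Finset.range_add_one, Finset.filter_insert]
      split_ifs with h1 h2 h2
      · rw [Finset.card_insert_of_notMem (by simp), h1]
      · exact absurd h1.symm h2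
      · exact absurd h2.symm h1
      · rfl
  · intro t hA hI; exact hI
  · simp only [Finset.sum_const, Finset.card_range, smul_eq_mul, Exp.cost]
    omega

/-! ## Coverage of the second neighbourhoods -/

/-- The data from which second neighbourhoods are computed: the graph, a list `cs` of centres and an
assignment `cen` of vertices to centres, the differences of the neighbourhoods of the vertices and
of their centres, a list `ts` of representatives `typ x` of the classes of equal trace on `cs`, and
the sizes of these classes. -/
structure Prepared (n : ℕ) (cl : ℕ → List ℕ) (cs ts : List ℕ) (cen typ : ℕ → ℕ) (s : State) :
    Prop where
  graph : HasGraph n cl s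
  table : IsAdjTable n cl s
  reg2 : s.reg 2 = cs.length
  arr3 : ∀ i, ∀ h : i < cs.length, s.arr 3 i = cs[i]
  arr4 : ∀ u < n, s.arr 4 u = cen u
  diff : DiffRows n cl cen n s
  reg3 : s.reg 3 = ts.length
  arr7 : ∀ i, ∀ h : i < ts.length, s.arr 7 i = ts[i]
  arr8 : ∀ u < n, s.arr 8 u = typ u
  arr9 : ∀ r, s.arr 9 r = ((Finset.range n).filter fun v => typ v = r).card

theorem Prepared.congr {cs ts : List ℕ} {cen typ : ℕ → ℕ} {s s' : State}
    (h : Prepared n cl cs ts cen typ s) (h₁ : ∀ x ∈ [0, 2, 3], s'.reg x = s.reg x)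
    (h₂ : ∀ a ∈ [0, 1, 2, 3, 4, 5, 6, 7, 8, 9], s'.arr a = s.arr a) :
    Prepared n cl cs ts cen typ s' := by
  constructor
  · exact h.graph.congr (h₁ 0 (by simp)) (h₂ 0 (by simp)) (h₂ 1 (by simp))
  · unfold IsAdjTable; rw [h₂ 2 (by simp)]; exact h.table
  · rw [h₁ 2 (by simp)]; exact h.reg2
  · rw [h₂ 3 (by simp)]; exact h.arr3
  · rw [h₂ 4 (by simp)]; exact h.arr4
  · unfold DiffRows RowHolds; rw [h₂ 5 (by simp), h₂ 6 (by simp)]; exact h.diff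
  · rw [h₁ 3 (by simp)]; exact h.reg3
  · rw [h₂ 7 (by simp)]; exact h.arr7
  · rw [h₂ 8 (by simp)]; exact h.arr8
  · rw [h₂ 9 (by simp)]; exact h.arr9

/-- The combinatorial properties of the data in `Prepared`. -/
structure GoodData (n : ℕ) (cl : ℕ → List ℕ) (cs ts : List ℕ) (cen typ : ℕ → ℕ) : Prop where
  lists : ClosedLists n cl
  cs_lt : ∀ x ∈ cs, x < n
  cs_nodup : cs.Nodup
  ts_lt : ∀ x ∈ ts, x < n
  ts_nodup : ts.Nodup
  cen_mem : ∀ u < n, cen u ∈ cs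
  typ_mem : ∀ u < n, typ u ∈ ts
  trace : ∀ u < n, ∀ x ∈ cs, (typ u ∈ cl x ↔ u ∈ cl x)

theorem length_le_of_nodup {l : List ℕ} (h : l.Nodup) (h' : ∀ x ∈ l, x < n) : l.length ≤ n := by
  rw [← List.toFinset_card_of_nodup h]
  have : l.toFinset ⊆ Finset.range n := fun x hx => Finset.mem_range.2 (h' x (by simpa using hx))
  simpa using Finset.card_le_card this

theorem GoodData.typ_lt {cs ts : List ℕ} {cen typ : ℕ → ℕ} (h : GoodData n cl cs ts cen typ) {u : ℕ}
    (hu : u < n) : typ u < n := h.ts_lt _ (h.typ_mem u hu)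

theorem GoodData.cen_lt {cs ts : List ℕ} {cen typ : ℕ → ℕ} (h : GoodData n cl cs ts cen typ) {u : ℕ}
    (hu : u < n) : cen u < n := h.cs_lt _ (h.cen_mem u hu)

/-- Number of neighbours `w` of `u` such that `x` is adjacent to the centre of `w`. -/
def base (cl : ℕ → List ℕ) (cen : ℕ → ℕ) (u x : ℕ) : ℕ :=
  (cl u).countP fun w => x ∈ cl (cen w)

/-- All centres lie in `cs`, so `base` sees `x` only through its trace on `cs`, which its
representative shares. -/
theorem GoodData.base_typ {cs ts : List ℕ} {cen typ : ℕ → ℕ} (h : GoodData n cl cs ts cen typ)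
    {u x : ℕ} (hu : u < n) (hx : x < n) : base cl cen u (typ x) = base cl cen u x := by
  refine List.countP_congr fun w hw => ?_
  have hwn := h.lists.lt u hu w hw
  simpa using h.trace x hx _ (h.cen_mem w hwn)

theorem GoodData.base_le {cs ts : List ℕ} {cen typ : ℕ → ℕ} (h : GoodData n cl cs ts cen typ)
    {u x : ℕ} (hu : u < n) : base cl cen u x ≤ n :=
  List.countP_le_length.trans (h.lists.length_le hu)

theorem countP_or {l : List ℕ} {p q : ℕ → Prop} [DecidablePred p] [DecidablePred q]
    (h : ∀ x, p x → ¬ q x) :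
    l.countP (fun x => p x ∨ q x) = l.countP (fun x => p x) + l.countP fun x => q x := by
  induction l with
  | nil => simp
  | cons a l ih =>
    simp only [List.countP_cons, ih]
    by_cases h1 : p a
    · simp [h1, h a h1]; omega
    · by_cases h2 : q a <;> simp [h1, h2]; omega

/-- Array `a` vanishes from row `k` on. -/
def ZeroRows (n a k : ℕ) (s : State) : Prop := ∀ v < n, k ≤ v → ∀ x < n, s.arr a (v * n + x) = 0

theorem ZeroRows.congr {a k : ℕ} {s s' : State} (h : ZeroRows n a k s) (h' : s'.arr a = s.arr a) :
    ZeroRows n a k s' := by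
  unfold ZeroRows; rw [h']; exact h

/-- The cell of array `a` in row `reg 6` whose column is given by `e`. -/
abbrev rowE (e : Exp) : Exp := addE (mulE (.reg 6) (.reg 0)) e

/-- Counts, in row `reg 6` of array `10`, how often each centre occurs in the neighbourhood. -/
def tallyProg : Prog :=
  forNbr 7 8 6 (.put 10 (rowE (.get 4 (.reg 8))) (addE (.get 10 (rowE (.get 4 (.reg 8)))) (.lit 1)))

/-- Each `u` uses its own row, still zero when `u` is reached, so no time is spent on clearing
counters. -/
theorem tallyProg_spec {w u : ℕ} {cs ts : List ℕ} {cen typ : ℕ → ℕ} {s : State} (hw : Wide n w)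
    (hD : GoodData n cl cs ts cen typ) (hs : Prepared n cl cs ts cen typ s) (hu : u < n)
    (h6 : s.reg 6 = u) (hz : ZeroRows n 10 u s) :
    Hoare w tallyProg s ((cl u).length * 60 + 14) fun s' =>
      (∀ x < n, s'.arr 10 (u * n + x) = (cl u).countP fun w => cen w = x) ∧
      ZeroRows n 10 (u + 1) s' := by
  have hW : 4 * (n * n) + 16 * n + 16 < 2 ^ w := hw
  refine (Hoare.forNbr (c := 20) (fun pre s' =>
      (∀ x < n, s'.arr 10 (u * n + x) = pre.countP fun w => cen w = x) ∧
      ZeroRows n 10 (u + 1) s') hw hs.graph hu h6 rfl rfl rfl rfl rfl (by decide) ?_ ?_ ?_ ?_).time ?_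
  · exact ⟨fun x hx => by simpa using hz u hu le_rfl x hx, fun v hv hv' => hz v hv (by omega)⟩
  · intro pre s y h; exact ⟨h, h⟩
  · rintro pre y post hpre t hA hy ⟨hI₁, hI₂⟩
    have hyn : y < n := hD.lists.lt u hu y (by simp [hpre])
    have h6' : t.reg 6 = u := (hA.1 6 rfl).trans h6
    have h0' : t.reg 0 = n := (hA.1 0 rfl).trans hs.graph.size
    have h4' : t.arr 4 y = cen y := by rw [hA.2 4 rfl]; exact hs.arr4 y hyn
    have hc := hD.cen_lt hyn
    have hidx := idx_lt hu hc
    have hle : (pre.countP fun w => cen w = cen y) ≤ n := by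
      refine List.countP_le_length.trans ((?_ : _ ≤ (cl u).length).trans (hD.lists.length_le hu))
      simp [hpre]
    refine Hoare.block (by decide) ⟨⟨⟨trivial, trivial, ?_⟩, trivial, ?_⟩,
      ⟨⟨⟨trivial, trivial, ?_⟩, trivial, ?_⟩, show 1 < 2 ^ w by omega, ?_⟩, ?_⟩
    · simp only [BinOp.ok, Exp.val, h6', h0']; omega
    · simp only [BinOp.ok, BinOp.val, Exp.val, h6', h0', hy, h4']; omega
    · simp only [BinOp.ok, Exp.val, h6', h0']; omega
    · simp only [BinOp.ok, BinOp.val, Exp.val, h6', h0', hy, h4']; omega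
    · simp only [BinOp.ok, BinOp.val, Exp.val, h6', h0', hy, h4', hI₁ _ hc]; omega
    · simp only [BinOp.val, Exp.val, h6', h0', hy, h4', hI₁ _ hc, ZeroRows, State.setArr_arr,
        if_true, Function.update_apply]
      refine ⟨fun x hx => ?_, fun v hv huv x hx => ?_⟩
      · rw [List.countP_append, hI₁ x hx]
        simp only [idx_inj hx hc, true_and, List.countP_singleton, decide_eq_true_eq]
        by_cases hxc : x = cen y
        · simp [hxc]
        · simp [hxc, Ne.symm hxc]
      · rw [if_neg (by rw [idx_inj hx hc]; omega)]
        exact hI₂ v hv huv x hx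
  · intro t _ h; exact h
  · have := Nat.mul_le_mul_left (cl u).length (show 20 + 32 ≤ 60 by omega)
    omega

/-- Computes `base` for the representatives in array `7` and the number of vertices at which it
does not vanish. -/
def baseProg : Prog :=
  .seq (.assign 10 (.lit 0)) (forP 14 (.reg 3)
    (.seq (.assign 9 (.get 7 (.reg 14))) (.seq (.assign 11 (.lit 0)) (.seq
      (forP 7 (.reg 2) (.assign 11 (addE (.reg 11)
        (mulE (.get 10 (rowE (.get 3 (.reg 7)))) (listedE 9)))))
      (.seq (.put 11 (rowE (.reg 9)) (.reg 11))
        (.ite (.reg 11) (.assign 10 (addE (.reg 10) (.get 9 (.reg 9)))) .skip))))))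

/-- Grouping the members of `N[u]` by their centres turns `base u r` into a sum over centres `c` of
the tally of `c` times the indicator of `r ∈ N[c]`. One such sum of length at most `S` is formed per
class. Since `base u` is constant on classes, the number of vertices where it is positive is a sum
of class sizes, so no scan of all `x` is needed. -/
theorem baseProg_spec {w u S T : ℕ} {cs ts : List ℕ} {cen typ : ℕ → ℕ} {s : State} (hw : Wide n w)
    (hD : GoodData n cl cs ts cen typ) (hs : Prepared n cl cs ts cen typ s)
    (hS : cs.length ≤ S) (hT : ts.length ≤ T) (hu : u < n)
    (h6 : s.reg 6 = u) (hr : ∀ x < n, s.arr 10 (u * n + x) = (cl u).countP fun w => cen w = x) :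
    Hoare w baseProg s (T * (S * 40 + 50) + 50) fun s' =>
      s'.reg 10 = ((Finset.range n).filter fun x => 0 < base cl cen u x).card ∧
      ∀ x < n, s'.arr 11 (u * n + typ x) = base cl cen u x := by
  have hW : 4 * (n * n) + 16 * n + 16 < 2 ^ w := hw
  have hcn := length_le_of_nodup hD.cs_nodup hD.cs_lt
  have htn := length_le_of_nodup hD.ts_nodup hD.ts_lt
  refine (Hoare.seq (T₁ := 2) (T₂ := T * (S * 40 + 50) + 40) ?_).time (by omega)
  refine (Hoare.block (P := .assign 10 (.lit 0)) (Q := fun s' => s' = s.setReg 10 0)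
    le_rfl ⟨show 0 < 2 ^ w by omega, rfl⟩).mono le_rfl ?_
  rintro _ rfl
  refine (Hoare.forP (N := ts.length) (c := fun _ => S * 40 + 35)
    (fun k s' => s'.reg 10 = ((Finset.range n).filter fun x =>
        typ x ∈ ts.take k ∧ 0 < base cl cen u x).card ∧
      ∀ r ∈ ts.take k, s'.arr 11 (u * n + r) = base cl cen u r)
    (by omega) hw.pos rfl ?_ ?_ ?_ ?_).time ?_
  · intro k _ t hA _
    exact ⟨trivial, (hA.1 3 rfl).trans hs.reg3⟩
  · simp
  · rintro i hi t hA h14 ⟨hI₁, hI₂⟩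
    have hmem : ts[i] ∈ ts := List.getElem_mem hi
    have hrn : ts[i] < n := hD.ts_lt _ hmem
    have h0t : t.reg 0 = n := (hA.1 0 rfl).trans hs.graph.size
    have h2t : t.reg 2 = cs.length := (hA.1 2 rfl).trans hs.reg2
    have h6t : t.reg 6 = u := (hA.1 6 rfl).trans h6
    have a2t : t.arr 2 = s.arr 2 := hA.2 2 rfl
    have a3t : t.arr 3 = s.arr 3 := hA.2 3 rfl
    have a7t : t.arr 7 = s.arr 7 := hA.2 7 rfl
    have a9t : t.arr 9 = s.arr 9 := hA.2 9 rfl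
    have a10t : t.arr 10 = s.arr 10 := hA.2 10 rfl
    have htake : ts.take (i + 1) = ts.take i ++ [ts[i]] := by
      rw [List.take_succ_eq_append_getElem hi]
    refine (Hoare.seq (T₁ := 3) (T₂ := S * 40 + 32) ?_).time (by omega)
    refine (Hoare.block (P := .assign 9 (.get 7 (.reg 14))) (Q := fun s' => s' = t.setReg 9 ts[i])
      le_rfl ⟨trivial, by simp [Exp.val, h14, a7t, hs.arr7 i hi]⟩).mono le_rfl ?_
    rintro _ rfl
    refine (Hoare.seq (T₁ := 2) (T₂ := S * 40 + 30) ?_).time (by omega)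
    refine (Hoare.block (P := .assign 11 (.lit 0))
      (Q := fun s' => s' = (t.setReg 9 ts[i]).setReg 11 0)
      le_rfl ⟨show 0 < 2 ^ w by omega, rfl⟩).mono le_rfl ?_
    rintro _ rfl
    refine (Hoare.seq (T₁ := S * 40 + 10) (T₂ := 20) ?_).time (by omega)
    refine ((Hoare.forP (N := cs.length) (c := fun _ => 25)
      (fun k s' => s'.reg 11 = (cl u).countP fun w => cen w ∈ cs.take k ∧ ts[i] ∈ cl (cen w))
      (Q := fun s' => s'.reg 11 = base cl cen u ts[i])
      (by omega) hw.pos rfl ?_ ?_ ?_ ?_).time ?_).frame.mono le_rfl ?_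
    · intro k _ t' hA' _
      exact ⟨trivial, (hA'.1 2 rfl).trans h2t⟩
    · simp
    · intro j hj t' hA' h7 hI
      have hcm : cs[j] ∈ cs := List.getElem_mem hj
      have hcx := hD.cs_lt _ hcm
      have h0' : t'.reg 0 = n := (hA'.1 0 rfl).trans h0t
      have h6' : t'.reg 6 = u := (hA'.1 6 rfl).trans h6t
      have h9' : t'.reg 9 = ts[i] := (hA'.1 9 rfl).trans (by simp)
      have a2' : t'.arr 2 = s.arr 2 := (hA'.2 2 rfl).trans a2t
      have a3' : t'.arr 3 j = cs[j] := by
        rw [show t'.arr 3 = s.arr 3 from (hA'.2 3 rfl).trans a3t]; exact hs.arr3 j hj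
      have a10' : t'.arr 10 = s.arr 10 := (hA'.2 10 rfl).trans a10t
      have hx1 := idx_lt hu hcx
      have hx2 := idx_lt hcx hrn
      have htake' : cs.take (j + 1) = cs.take j ++ [cs[j]] := by
        rw [List.take_succ_eq_append_getElem hj]
      have hnot : cs[j] ∉ cs.take j := by
        have hnd := hD.cs_nodup.sublist (List.take_sublist (j + 1) cs)
        rw [htake', List.nodup_append] at hnd
        intro hm
        exact hnd.2.2 _ hm _ (List.mem_singleton_self _) rfl
      -- Passing from `j` to `j + 1` centres adds exactly the members of `N[u]` assigned to the new
      -- centre; `cs` has no repetitions, so none of them was counted before.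
      have hcnt : ((cl u).countP fun w => cen w ∈ cs.take (j + 1) ∧ ts[i] ∈ cl (cen w)) =
          ((cl u).countP fun w => cen w ∈ cs.take j ∧ ts[i] ∈ cl (cen w)) +
          ((cl u).countP fun w => cen w = cs[j]) * (if ts[i] ∈ cl cs[j] then 1 else 0) := by
        have e1 : ((cl u).countP fun w => cen w ∈ cs.take (j + 1) ∧ ts[i] ∈ cl (cen w)) =
            (cl u).countP fun w => (cen w ∈ cs.take j ∧ ts[i] ∈ cl (cen w)) ∨
              (cen w = cs[j] ∧ ts[i] ∈ cl (cen w)) := by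
          refine List.countP_congr fun w _ => ?_
          rw [htake']
          simp only [List.mem_append, List.mem_singleton, decide_eq_true_eq]
          tauto
        rw [e1, countP_or (by rintro x ⟨h, -⟩ ⟨h', -⟩; rw [h'] at h; exact hnot h)]
        congr 1
        split_ifs with h
        · rw [mul_one]
          refine List.countP_congr fun w _ => ?_
          simp only [decide_eq_true_eq]
          exact ⟨fun h' => h'.1, fun h' => ⟨h', by rwa [h']⟩⟩
        · rw [mul_zero, List.countP_eq_zero]
          intro w _
          simp only [decide_eq_true_eq]
          rintro ⟨h₁, h₂⟩
          rw [h₁] at h₂; exact h h₂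
      have hle1 : ((cl u).countP fun w => cen w ∈ cs.take (j + 1) ∧ ts[i] ∈ cl (cen w)) ≤ n :=
        List.countP_le_length.trans (hD.lists.length_le hu)
      have hprod : ∀ b : ℕ, b ≤ 1 → (cl u).countP (fun w => cen w = cs[j]) * b ≤ n := fun b hb =>
        (Nat.mul_le_mul (List.countP_le_length.trans (hD.lists.length_le hu)) hb).trans
          (by simp)
      have hp1 : (cl u).countP (fun w => cen w = cs[j]) * (if ts[i] ∈ cl cs[j] then 1 else 0) ≤ n :=
        hprod _ (by split_ifs <;> omega)
      refine Hoare.block (by decide) ⟨⟨trivial, ⟨⟨⟨trivial, trivial, ?_⟩, trivial, ?_⟩,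
        ⟨⟨trivial, trivial, ?_⟩, trivial, ?_⟩, ?_⟩, ?_⟩, ?_⟩
      · simp only [BinOp.ok, Exp.val, h6', h0']; omega
      · simp only [BinOp.ok, BinOp.val, Exp.val, h6', h0', h7, a3']; omega
      · simp only [BinOp.ok, Exp.val, h0', h7, a3']; omega
      · simp only [BinOp.ok, BinOp.val, Exp.val, h0', h7, h9', a3']; omega
      · simp only [BinOp.ok, BinOp.val, Exp.val, h6', h0', h7, h9', a3', a10', a2', hr _ hcx,
          hs.table _ hcx _ hrn]
        omega
      · simp only [BinOp.ok, BinOp.val, Exp.val, h6', h0', h7, h9', a3', a10', a2', hr _ hcx,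
          hs.table _ hcx _ hrn, hI, ← hcnt]
        omega
      · simp only [BinOp.val, Exp.val, h6', h0', h7, h9', a3', a10', a2', hr _ hcx,
          hs.table _ hcx _ hrn, hI, State.setReg_reg]
        simp only [hcnt, if_true, Nat.reduceEqDiff, if_false]
    · intro t' _ hI
      rw [hI, base]
      refine List.countP_congr fun w hw' => ?_
      simp [hD.cen_mem w (hD.lists.lt u hu w hw')]
    · simp only [Finset.sum_const, Finset.card_range, smul_eq_mul, Exp.cost]
      have := Nat.mul_le_mul_right 40 hS
      omega
    · rintro t' ⟨hA', h11⟩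
      have h0' : t'.reg 0 = n := (hA'.1 0 rfl).trans h0t
      have h6' : t'.reg 6 = u := (hA'.1 6 rfl).trans h6t
      have h9' : t'.reg 9 = ts[i] := (hA'.1 9 rfl).trans (by simp)
      have h10' : t'.reg 10 = t.reg 10 := (hA'.1 10 rfl).trans (by simp)
      have a9' : t'.arr 9 = s.arr 9 := (hA'.2 9 rfl).trans a9t
      have a11' : t'.arr 11 = t.arr 11 := hA'.2 11 rfl
      have hx := idx_lt hu hrn
      -- A further representative contributes its whole class if `base` is positive at the
      -- representative and nothing otherwise; the classes are disjoint.
      have hsum : ((Finset.range n).filter fun x =>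
          typ x ∈ ts.take (i + 1) ∧ 0 < base cl cen u x).card =
          ((Finset.range n).filter fun x => typ x ∈ ts.take i ∧ 0 < base cl cen u x).card +
          if 0 < base cl cen u ts[i] then ((Finset.range n).filter fun x => typ x = ts[i]).card
          else 0 := by
        have hnot : ts[i] ∉ ts.take i := by
          have hnd := hD.ts_nodup.sublist (List.take_sublist (i + 1) ts)
          rw [htake, List.nodup_append] at hnd
          intro hm
          exact hnd.2.2 _ hm _ (List.mem_singleton_self _) rfl
        have e1 : ((Finset.range n).filter fun x =>
            typ x ∈ ts.take (i + 1) ∧ 0 < base cl cen u x) =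
            ((Finset.range n).filter fun x => typ x ∈ ts.take i ∧ 0 < base cl cen u x) ∪
            ((Finset.range n).filter fun x => typ x = ts[i] ∧ 0 < base cl cen u ts[i]) := by
          ext x
          rw [htake]
          simp only [Finset.mem_filter, Finset.mem_union, Finset.mem_range, List.mem_append,
            List.mem_singleton]
          constructor
          · rintro ⟨hx, h | h, hb⟩
            · exact Or.inl ⟨hx, h, hb⟩
            · exact Or.inr ⟨hx, h, by rwa [← h, hD.base_typ hu hx]⟩
          · rintro (⟨hx, h, hb⟩ | ⟨hx, h, hb⟩)
            · exact ⟨hx, Or.inl h, hb⟩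
            · exact ⟨hx, Or.inr h, by rwa [← h, hD.base_typ hu hx] at hb⟩
        rw [e1, Finset.card_union_of_disjoint]
        · congr 1
          split_ifs with h <;> simp [h]
        · rw [Finset.disjoint_left]
          simp only [Finset.mem_filter]
          rintro x ⟨-, h, -⟩ ⟨-, h', -⟩
          rw [h'] at h; exact hnot h
      have hle : ((Finset.range n).filter fun x =>
          typ x ∈ ts.take (i + 1) ∧ 0 < base cl cen u x).card ≤ n :=
        (Finset.card_filter_le _ _).trans (by simp)
      have harr : ∀ r ∈ ts.take (i + 1), Function.update (t'.arr 11) (u * n + ts[i])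
          (base cl cen u ts[i]) (u * n + r) = base cl cen u r := by
        intro r hr'
        rw [htake] at hr'
        simp only [Function.update_apply, a11']
        by_cases hri : r = ts[i]
        · simp [hri]
        · rw [if_neg (by omega)]
          exact hI₂ r ((List.mem_append.1 hr').resolve_right (by simpa using hri))
      refine Hoare.block (by decide) ⟨⟨⟨trivial, trivial, ?_⟩, trivial, ?_⟩, trivial, trivial,
        fun h => ⟨⟨trivial, trivial, ?_⟩, ?_⟩, fun h => ?_⟩
      · simp only [BinOp.ok, Exp.val, h6', h0']; omega
      · simp only [BinOp.ok, BinOp.val, Exp.val, h6', h0', h9']; omega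
      · have hpos : 0 < base cl cen u ts[i] := by
          simp only [Exp.val, State.setArr_reg, h11] at h; omega
        rw [if_pos hpos] at hsum
        simp only [BinOp.ok, BinOp.val, Exp.val, State.setArr_reg, State.setArr_arr, h9', h10',
          Nat.reduceEqDiff, if_false, a9', hs.arr9, hI₁]
        omega
      · have hpos : 0 < base cl cen u ts[i] := by
          simp only [Exp.val, State.setArr_reg, h11] at h; omega
        rw [if_pos hpos] at hsum
        simp only [BinOp.val, Exp.val, State.setArr_reg, State.setArr_arr, State.setReg_reg,
          State.setReg_arr, h9', h10', h6', h0', h11, Nat.reduceEqDiff, if_false, if_true, a9',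
          hs.arr9, hI₁]
        exact ⟨hsum.symm, harr⟩
      · have hpos : ¬ 0 < base cl cen u ts[i] := by
          simp only [Exp.val, State.setArr_reg, h11] at h; omega
        rw [if_neg hpos] at hsum
        show _ ∧ _
        simp only [BinOp.val, Exp.val, State.setArr_reg, State.setArr_arr, State.setReg_reg,
          State.setReg_arr, h9', h10', h6', h0', h11, Nat.reduceEqDiff, if_false, if_true, hI₁]
        exact ⟨hsum.symm, harr⟩
  · rintro t hA ⟨hI₁, hI₂⟩
    rw [List.take_length] at hI₁ hI₂
    refine ⟨?_, fun x hx => ?_⟩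
    · rw [hI₁]
      congr 1
      refine Finset.filter_congr fun x hx => ?_
      simp [hD.typ_mem x (Finset.mem_range.1 hx)]
    · rw [hI₂ _ (hD.typ_mem x hx), hD.base_typ hu hx]
  · simp only [Finset.sum_const, Finset.card_range, smul_eq_mul, Exp.cost]
    have := Nat.mul_le_mul hT (show S * 40 + 35 + (1 + 7) ≤ S * 40 + 50 by omega)
    omega

variable {cs ts : List ℕ} {cen typ : ℕ → ℕ}

/-- The value of `base` for the vertex in register `11`. -/
abbrev baseE : Exp := .get 11 (rowE (.get 8 (.reg 11)))

/-- Records that the vertex in register `11` has to be counted once more (in array `12`) or once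
less (in array `13`), according to its adjacency to the vertex in register `9`, and updates the
number of covered vertices in register `10`. -/
def updateProg : Prog :=
  .ite (tableE 9 11)
    (.seq (.put 13 (rowE (.reg 11)) (addE (.get 13 (rowE (.reg 11))) (.lit 1)))
      (.ite (eqE (addE baseE (.get 12 (rowE (.reg 11)))) (.get 13 (rowE (.reg 11))))
        (.assign 10 (subE (.reg 10) (.lit 1))) .skip))
    (.seq (.ite (eqE (addE baseE (.get 12 (rowE (.reg 11)))) (.get 13 (rowE (.reg 11))))
        (.assign 10 (addE (.reg 10) (.lit 1))) .skip)
      (.put 12 (rowE (.reg 11)) (addE (.get 12 (rowE (.reg 11))) (.lit 1))))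

/-- Row `u` of the arrays `12` and `13` holds `p` and `m`, and register `10` the number of `x` with
`m x < b x + p x`. -/
structure Counts (n u : ℕ) (b p m : ℕ → ℕ) (s : State) : Prop where
  count : s.reg 10 = ((Finset.range n).filter fun x => m x < b x + p x).card
  plus : ∀ x < n, s.arr 12 (u * n + x) = p x
  minus : ∀ x < n, s.arr 13 (u * n + x) = m x
  zero_plus : ZeroRows n 12 (u + 1) s
  zero_minus : ZeroRows n 13 (u + 1) s

/-- A change at one point `y` that makes the inequality true there raises the number of solutions by
one. Read backwards, it also covers the case in which a solution is lost. -/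
theorem card_filter_update {f g f' g' : ℕ → ℕ} {y : ℕ} (hy : y < n)
    (hf : ∀ x, x ≠ y → f' x = f x) (hg : ∀ x, x ≠ y → g' x = g x)
    (h₁ : ¬ f y < g y) (h₂ : f' y < g' y) :
    ((Finset.range n).filter fun x => f' x < g' x).card =
      ((Finset.range n).filter fun x => f x < g x).card + 1 := by
  rw [← Finset.card_insert_of_notMem (a := y) (by simp [h₁])]
  congr 1
  ext x
  simp only [Finset.mem_filter, Finset.mem_range, Finset.mem_insert]
  by_cases hx : x = y
  · subst hx; simp [hy, h₂]
  · simp [hx, hf x hx, hg x hx]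

/-- A step of size one changes the truth of `m y < b y + p y` only at the boundary. A gain makes it
true exactly when `b y + p y = m y` before the step, and a loss makes it false exactly when equality
holds after the step. One equality test thus keeps the number of covered vertices correct, in
whichever order corrections arrive. -/
theorem updateProg_spec {w u y z : ℕ} {b p m : ℕ → ℕ} {s : State} (hw : Wide n w)
    (hT : IsAdjTable n cl s) (h0 : s.reg 0 = n) (h6 : s.reg 6 = u) (h9 : s.reg 9 = z)
    (h11 : s.reg 11 = y) (hu : u < n) (hz : z < n) (hy : y < n) (h8 : s.arr 8 y = typ y)
    (hty : typ y < n) (hb : s.arr 11 (u * n + typ y) = b y) (hby : b y ≤ n) (hpy : p y ≤ n)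
    (hmy : m y ≤ n) (hC : Counts n u b p m s) :
    Hoare w updateProg s 60 fun s' => if y ∈ cl z
      then Counts n u b p (Function.update m y (m y + 1)) s'
      else Counts n u b (Function.update p y (p y + 1)) m s' := by
  have hW : 4 * (n * n) + 16 * n + 16 < 2 ^ w := hw
  have hi1 := idx_lt hu hy
  have hi2 := idx_lt hz hy
  have hi3 := idx_lt hu hty
  have hple := hC.plus y hy
  have hmin := hC.minus y hy
  have hcle : s.reg 10 ≤ n := by
    rw [hC.count]; exact (Finset.card_filter_le _ _).trans (by simp)
  have hrow : ∀ a, ∀ v, ZeroRows n a (u + 1) s → ∀ x₁ < n, u + 1 ≤ x₁ → ∀ x < n,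
      Function.update (s.arr a) (u * n + y) v (x₁ * n + x) = 0 := by
    intro a v h x₁ h₁ h₂ x hx
    rw [Function.update_apply, if_neg (by rw [idx_inj hx hy]; omega)]
    exact h x₁ h₁ h₂ x hx
  have hupd : ∀ (a v : ℕ) (f : ℕ → ℕ), (∀ x < n, s.arr a (u * n + x) = f x) → ∀ x < n,
      Function.update (s.arr a) (u * n + y) v (u * n + x) = Function.update f y v x := by
    intro a v f h x hx
    simp only [Function.update_apply, idx_inj hx hy, true_and, h x hx]
  have hrowE : ∀ t : State, t.reg 0 = n → t.reg 6 = u → t.reg 11 = y →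
      (rowE (.reg 11)).ok w t ∧ (rowE (.reg 11)).val t = u * n + y := by
    intro t h0 h6 h11
    refine ⟨⟨⟨trivial, trivial, ?_⟩, trivial, ?_⟩, ?_⟩
    · simp only [BinOp.ok, Exp.val, h6, h0]; omega
    · simp only [BinOp.ok, BinOp.val, Exp.val, h6, h0, h11]; omega
    · simp only [BinOp.val, Exp.val, h6, h0, h11]
  have hbaseE : ∀ t : State, t.reg = s.reg → t.arr 8 = s.arr 8 → t.arr 11 = s.arr 11 →
      baseE.ok w t ∧ baseE.val t = b y := by
    intro t hr h8' h11'
    refine ⟨⟨⟨trivial, trivial, ?_⟩, trivial, ?_⟩, ?_⟩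
    · simp only [BinOp.ok, Exp.val, hr, h6, h0]; omega
    · simp only [BinOp.ok, BinOp.val, Exp.val, hr, h6, h0, h11, h8', h8]; omega
    · simp only [BinOp.val, Exp.val, hr, h6, h0, h11, h8', h8, h11', hb]
  obtain ⟨hr1, hr2⟩ := hrowE s h0 h6 h11
  obtain ⟨hb1, hb2⟩ := hbaseE s rfl rfl rfl
  have hget : ∀ a, (Exp.get a (rowE (.reg 11))).val s = s.arr a (u * n + y) := fun a => by
    rw [← hr2]; rfl
  have hsum : (addE baseE (.get 12 (rowE (.reg 11)))).val s = b y + p y := by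
    show baseE.val s + (Exp.get 12 (rowE (.reg 11))).val s = _
    rw [hb2, hget, hple]
  have hinc : ∀ a c, s.arr a (u * n + y) = c →
      (addE (.get a (rowE (.reg 11))) (.lit 1)).val s = c + 1 := by
    intro a c h
    show (Exp.get a (rowE (.reg 11))).val s + 1 = _
    rw [hget, h]
  have hincok : ∀ a c, s.arr a (u * n + y) = c → c ≤ n →
      (addE (.get a (rowE (.reg 11))) (.lit 1)).ok w s := by
    intro a c h hc
    refine ⟨hr1, show 1 < 2 ^ w by omega, ?_⟩
    show (Exp.get a (rowE (.reg 11))).val s + 1 < 2 ^ w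
    rw [hget, h]; omega
  refine Hoare.block (by decide) ⟨⟨⟨trivial, trivial, ?_⟩, trivial, ?_⟩, fun h => ?_, fun h => ?_⟩
  · simp only [BinOp.ok, Exp.val, h9, h0]; omega
  · simp only [BinOp.ok, BinOp.val, Exp.val, h9, h0, h11]; omega
  · have hyz : y ∈ cl z := by
      by_contra hyz
      simp [BinOp.val, Exp.val, h9, h0, h11, hT z hz y hy, hyz] at h
    refine ⟨hr1, hincok 13 _ hmin hmy, ?_⟩
    rw [hr2, hinc 13 _ hmin]
    set t := s.setArr 13 (u * n + y) (m y + 1) with ht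
    obtain ⟨hr1', hr2'⟩ := hrowE t h0 h6 h11
    obtain ⟨hb1', hb2'⟩ := hbaseE t rfl (by simp [ht]) (by simp [ht])
    have h12 : (Exp.get 12 (rowE (.reg 11))).val t = p y := by
      show t.arr 12 ((rowE (.reg 11)).val t) = _
      rw [hr2', ← hple]; simp [ht]
    have h13 : (Exp.get 13 (rowE (.reg 11))).val t = m y + 1 := by
      show t.arr 13 ((rowE (.reg 11)).val t) = _
      rw [hr2']; simp [ht]
    have hsum' : (addE baseE (.get 12 (rowE (.reg 11)))).val t = b y + p y := by
      show baseE.val t + (Exp.get 12 (rowE (.reg 11))).val t = _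
      rw [hb2', h12]
    have hcond : (eqE (addE baseE (.get 12 (rowE (.reg 11)))) (.get 13 (rowE (.reg 11)))).val t =
        if b y + p y = m y + 1 then 1 else 0 := by
      rw [← hsum', ← h13]; rfl
    have hCt : ∀ t', t'.arr = t.arr → (t'.reg 10 =
        ((Finset.range n).filter fun x => Function.update m y (m y + 1) x < b x + p x).card) →
        Counts n u b p (Function.update m y (m y + 1)) t' := by
      intro t' ha hc
      refine ⟨hc, ?_, ?_, ?_, ?_⟩
      · rw [ha]; simpa [ht] using hC.plus
      · rw [ha]; simpa [ht] using hupd 13 (m y + 1) m hC.minus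
      · exact hC.zero_plus.congr (by rw [ha]; simp [ht])
      · unfold ZeroRows; rw [ha]; simpa [ht] using hrow 13 (m y + 1) hC.zero_minus
    refine ⟨⟨⟨hb1', hr1', ?_⟩, hr1', hw.pos⟩, fun h' => ?_, fun h' => ?_⟩
    · simp only [BinOp.ok, hb2', h12]; omega
    · have heq : b y + p y = m y + 1 := by
        by_contra hne; rw [hcond, if_neg hne] at h'; exact h' rfl
      refine ⟨⟨trivial, show 1 < 2 ^ w by omega, ?_⟩, ?_⟩
      · simp only [BinOp.ok, Exp.val, ht, State.setArr_reg]; omega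
      -- Old and new values exchange roles here: the count before the loss is one more than the
      -- count after it.
      · have hcard := card_filter_update (n := n) (y := y)
          (f := Function.update m y (m y + 1)) (g := fun x => b x + p x)
          (f' := m) (g' := fun x => b x + p x) hy (fun x hx => by simp [hx])
          (fun x hx => rfl) (by simp; omega) (by omega)
        simp only [if_pos hyz]
        refine hCt _ rfl ?_
        simp only [BinOp.val, Exp.val, ht, State.setArr_reg, State.setReg_reg, if_true, hC.count,
          hcard]
        omega
    · have hne : b y + p y ≠ m y + 1 := by
        intro heq; rw [hcond, if_pos heq] at h'; exact one_ne_zero h'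
      simp only [Prog.vc, if_pos hyz]
      refine hCt _ rfl ?_
      simp only [ht, State.setArr_reg, hC.count]
      congr 1
      refine Finset.filter_congr fun x _ => ?_
      by_cases hx : x = y
      · subst hx; simp; omega
      · simp [hx]
  · have hyz : y ∉ cl z := by
      intro hyz
      simp [BinOp.val, Exp.val, h9, h0, h11, hT z hz y hy, hyz] at h
    have hcond : (eqE (addE baseE (.get 12 (rowE (.reg 11)))) (.get 13 (rowE (.reg 11)))).val s =
        if b y + p y = m y then 1 else 0 := by
      rw [← hsum, ← hmin, ← hget]; rfl
    have hCt : ∀ t', t'.arr = (s.setArr 12 (u * n + y) (p y + 1)).arr → (t'.reg 10 =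
        ((Finset.range n).filter fun x => m x < b x + Function.update p y (p y + 1) x).card) →
        Counts n u b (Function.update p y (p y + 1)) m t' := by
      intro t' ha hc
      refine ⟨hc, ?_, ?_, ?_, ?_⟩
      · rw [ha]; simpa using hupd 12 (p y + 1) p hC.plus
      · rw [ha]; simpa using hC.minus
      · unfold ZeroRows; rw [ha]; simpa using hrow 12 (p y + 1) hC.zero_plus
      · exact hC.zero_minus.congr (by rw [ha]; simp)
    refine ⟨⟨⟨hb1, hr1, ?_⟩, hr1, hw.pos⟩, fun h' => ?_, fun h' => ?_⟩
    · simp only [BinOp.ok, hb2, hget, hple]; omega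
    · have heq : b y + p y = m y := by
        by_contra hne; rw [hcond, if_neg hne] at h'; exact h' rfl
      refine ⟨⟨trivial, show 1 < 2 ^ w by omega, ?_⟩, ?_⟩
      · simp only [BinOp.ok, Exp.val]; omega
      · set t := s.setReg 10 ((addE (.reg 10) (.lit 1)).val s) with ht
        obtain ⟨hr1', hr2'⟩ := hrowE t (by simpa [ht] using h0) (by simpa [ht] using h6)
          (by simpa [ht] using h11)
        have h12 : (Exp.get 12 (rowE (.reg 11))).val t = p y := by
          show t.arr 12 ((rowE (.reg 11)).val t) = _
          rw [hr2', ← hple]; simp [ht]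
        have hval : (addE (.get 12 (rowE (.reg 11))) (.lit 1)).val t = p y + 1 := by
          rw [← h12]; rfl
        refine ⟨hr1', ⟨hr1', show 1 < 2 ^ w by omega, ?_⟩, ?_⟩
        · show (Exp.get 12 (rowE (.reg 11))).val t + 1 < 2 ^ w
          rw [h12]; omega
        · rw [hr2', hval]
          simp only [if_neg hyz]
          have hcard := card_filter_update (n := n) (y := y)
            (f := m) (g := fun x => b x + p x)
            (f' := m) (g' := fun x => b x + Function.update p y (p y + 1) x) hy
            (fun x hx => rfl) (fun x hx => by simp [hx]) (by omega) (by simp; omega)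
          refine hCt _ rfl ?_
          simp only [BinOp.val, Exp.val, ht, State.setArr_reg, State.setReg_reg, if_true, hC.count,
            hcard]
    · have hne : b y + p y ≠ m y := by
        intro heq; rw [hcond, if_pos heq] at h'; exact one_ne_zero h'
      refine ⟨hr1, hincok 12 _ hple hpy, ?_⟩
      rw [hr2, hinc 12 _ hple]
      simp only [if_neg hyz]
      refine hCt _ rfl ?_
      simp only [State.setArr_reg, hC.count]
      congr 1
      refine Finset.filter_congr fun x _ => ?_
      by_cases hx : x = y
      · subst hx; simp; omega
      · simp [hx]

/-- Processes the differences between the neighbourhoods of the neighbours of the vertex in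
register `6` and those of their centres. -/
def correctProg : Prog :=
  forNbr 7 8 6 (.seq (.assign 9 (.get 4 (.reg 8)))
    (forP 14 (.get 6 (.reg 8)) (.seq
      (.assign 11 (.get 5 (addE (mulE (.reg 8) (.reg 0)) (.reg 14)))) updateProg)))

/-- Number of members `w` of `l` that are adjacent to `x` while their centres are not. -/
def gain (cl : ℕ → List ℕ) (cen : ℕ → ℕ) (l : List ℕ) (x : ℕ) : ℕ :=
  l.countP fun w => x ∈ cl w ∧ x ∉ cl (cen w)

/-- Number of members `w` of `l` that are not adjacent to `x` while their centres are. -/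
def loss (cl : ℕ → List ℕ) (cen : ℕ → ℕ) (l : List ℕ) (x : ℕ) : ℕ :=
  l.countP fun w => x ∈ cl (cen w) ∧ x ∉ cl w

/-- The true count equals `base + gain - loss`, written without subtraction. It holds member by
member: each `w` shifts the sums according to whether `x` lies in `N[w]` and in `N[cen w]`. -/
theorem base_add_gain (u x : ℕ) :
    base cl cen u x + gain cl cen (cl u) x =
      loss cl cen (cl u) x + (cl u).countP fun w => x ∈ cl w := by
  unfold base gain loss
  induction cl u with
  | nil => simp
  | cons a l ih =>
    simp only [List.countP_cons]
    by_cases h1 : x ∈ cl (cen a) <;> by_cases h2 : x ∈ cl a <;> simp [h1, h2] at ih ⊢ <;> omega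

/-- Each neighbour `v` of `u` contributes one update per element of its stored difference list,
hence at most `K` updates. An element adjacent to the centre of `v` is a loss, any other element a
gain. -/
theorem correctProg_spec {w u K : ℕ} {s : State} (hw : Wide n w)
    (hD : GoodData n cl cs ts cen typ) (hs : Prepared n cl cs ts cen typ s) (hu : u < n)
    (hK : ∀ v < n, (diffList cl v (cen v)).length ≤ K) (h6 : s.reg 6 = u)
    (hb : ∀ x < n, s.arr 11 (u * n + typ x) = base cl cen u x)
    (hc : s.reg 10 = ((Finset.range n).filter fun x => 0 < base cl cen u x).card)
    (hz₁ : ZeroRows n 12 u s) (hz₂ : ZeroRows n 13 u s) :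
    Hoare w correctProg s ((cl u).length * (K * 80 + 60) + 14)
      (Counts n u (base cl cen u) (gain cl cen (cl u)) (loss cl cen (cl u))) := by
  have hW : 4 * (n * n) + 16 * n + 16 < 2 ^ w := hw
  refine (Hoare.forNbr (c := K * 80 + 20) (fun pre s' =>
      Counts n u (base cl cen u) (gain cl cen pre) (loss cl cen pre) s')
      hw hs.graph hu h6 rfl rfl rfl rfl rfl (by decide) ?_ ?_ ?_ ?_).time ?_
  · refine ⟨by simpa [gain, loss] using hc, fun x hx => ?_, fun x hx => ?_, fun v hv hv' => ?_,
      fun v hv hv' => ?_⟩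
    · simpa [gain] using hz₁ u hu le_rfl x hx
    · simpa [loss] using hz₂ u hu le_rfl x hx
    · exact hz₁ v hv (by omega)
    · exact hz₂ v hv (by omega)
  · intro pre s y h
    exact ⟨⟨by simpa using h.count, h.plus, h.minus, h.zero_plus, h.zero_minus⟩,
      ⟨by simpa using h.count, h.plus, h.minus, h.zero_plus, h.zero_minus⟩⟩
  · intro pre v post hpre t hA hv hI
    have hvn : v < n := hD.lists.lt u hu v (by simp [hpre])
    have hcv := hD.cen_lt hvn
    have hst : Prepared n cl cs ts cen typ t := by
      refine hs.congr ?_ ?_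
      · intro x hx; refine hA.1 x ?_; fin_cases hx <;> rfl
      · intro x hx; refine hA.2 x ?_; fin_cases hx <;> rfl
    have h6t : t.reg 6 = u := (hA.1 6 rfl).trans h6
    have h11t : t.arr 11 = s.arr 11 := hA.2 11 rfl
    set D := diffList cl v (cen v) with hDdef
    have hDn : D.Nodup := hD.lists.diffList_nodup hvn hcv
    have hDK : D.length ≤ K := hK v hvn
    obtain ⟨hd1, hd2⟩ := hst.diff v hvn
    have hprelen : pre.length < n := by
      have := hD.lists.length_le hu
      rw [hpre] at this
      simp at this; omega
    refine (Hoare.seq (T₁ := 3) (T₂ := K * 80 + 10) ?_).time (by omega)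
    refine (Hoare.block (P := .assign 9 (.get 4 (.reg 8))) (Q := fun s' => s' = t.setReg 9 (cen v))
      le_rfl ⟨trivial, by simp [Exp.val, hv, hst.arr4 v hvn]⟩).mono le_rfl ?_
    rintro _ rfl
    -- Midway through the list `D` of `v`, the counts are those of the neighbours finished before,
    -- corrected by an indicator on the part of `D` already processed.
    refine (Hoare.forP (N := D.length) (c := fun _ => 68) (fun k s' =>
      Counts n u (base cl cen u)
        (fun x => gain cl cen pre x + if x ∈ D.take k ∧ x ∉ cl (cen v) then 1 else 0)
        (fun x => loss cl cen pre x + if x ∈ D.take k ∧ x ∈ cl (cen v) then 1 else 0) s')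
      ?_ hw.pos rfl ?_ ?_ ?_ ?_).time ?_
    · have : D.length ≤ n := hD.lists.diffList_length_le hvn hcv
      omega
    · intro k _ t' hA' _
      refine ⟨trivial, ?_⟩
      have h8 : t'.reg 8 = v := (hA'.1 8 rfl).trans (by simp [hv])
      have h6' : t'.arr 6 = t.arr 6 := hA'.2 6 rfl
      simp only [Exp.val, h8, h6', hd1, hDdef]
    · exact ⟨by simpa using hI.count, by simpa using hI.plus, by simpa using hI.minus,
        hI.zero_plus, hI.zero_minus⟩
    · intro k hk t' hA' h14 hI'
      have h8 : t'.reg 8 = v := (hA'.1 8 rfl).trans (by simp [hv])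
      have h9 : t'.reg 9 = cen v := (hA'.1 9 rfl).trans (by simp)
      have h0 : t'.reg 0 = n := (hA'.1 0 rfl).trans (by simp [hst.graph.size])
      have h6' : t'.reg 6 = u := (hA'.1 6 rfl).trans (by simp [h6t])
      have a5 : t'.arr 5 = t.arr 5 := hA'.2 5 rfl
      have a2 : t'.arr 2 = t.arr 2 := hA'.2 2 rfl
      have a8 : t'.arr 8 = t.arr 8 := hA'.2 8 rfl
      have a11 : t'.arr 11 = s.arr 11 := (hA'.2 11 rfl).trans h11t
      have hkn : k < n := lt_of_lt_of_le hk (hD.lists.diffList_length_le hvn hcv)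
      have hmem : D[k] ∈ D := List.getElem_mem hk
      have hyn : D[k] < n := hD.lists.diffList_lt hvn hcv hmem
      have hidx := idx_lt hvn hkn
      have htake : D.take (k + 1) = D.take k ++ [D[k]] := by
        rw [List.take_succ_eq_append_getElem hk]
      -- `D` has no repetitions, so adding one at `D[k]` is the same as enlarging the indicator.
      have hnot : D[k] ∉ D.take k := by
        have hnd := hDn.sublist (List.take_sublist (k + 1) D)
        rw [htake, List.nodup_append] at hnd
        intro hm
        exact hnd.2.2 _ hm _ (List.mem_singleton_self _) rfl
      have hgp : gain cl cen pre D[k] ≤ n := List.countP_le_length.trans hprelen.le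
      have hlp : loss cl cen pre D[k] ≤ n := List.countP_le_length.trans hprelen.le
      refine (Hoare.seq (T₁ := 7) (T₂ := 60) ?_).time (by omega)
      refine (Hoare.block (P := .assign 11 (.get 5 (addE (mulE (.reg 8) (.reg 0)) (.reg 14))))
        (Q := fun s' => s' = t'.setReg 11 D[k]) le_rfl
        ⟨⟨⟨trivial, trivial, ?_⟩, trivial, ?_⟩, ?_⟩).mono le_rfl ?_
      · simp only [BinOp.ok, Exp.val, h8, h0]; omega
      · simp only [BinOp.ok, BinOp.val, Exp.val, h8, h0, h14]; omega
      · simp only [BinOp.val, Exp.val, h8, h0, h14, a5, hd2 k hk, hDdef]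
      rintro _ rfl
      refine (updateProg_spec (s := t'.setReg 11 D[k]) (cl := cl) (typ := typ) (u := u) (y := D[k]) (z := cen v) hw ?_
        (by simp [h0]) (by simp [h6']) (by simp [h9]) (by rw [State.setReg_reg, if_pos rfl]) hu hcv hyn ?_ (hD.typ_lt hyn) ?_
        (hD.base_le hu) ?_ ?_
        ⟨hI'.count, hI'.plus, hI'.minus, hI'.zero_plus, hI'.zero_minus⟩).mono
        le_rfl ?_
      · intro a ha x hx; rw [← hst.table a ha x hx, ← a2]; rfl
      · rw [State.setReg_arr, a8]; exact hst.arr8 _ hyn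
      · rw [State.setReg_arr, a11]; exact hb _ hyn
      · simpa [hnot] using hgp
      · simpa [hnot] using hlp
      · intro t₂ h
        suffices h' : Counts n u (base cl cen u)
            (fun x => gain cl cen pre x + if x ∈ D.take (k + 1) ∧ x ∉ cl (cen v) then 1 else 0)
            (fun x => loss cl cen pre x + if x ∈ D.take (k + 1) ∧ x ∈ cl (cen v) then 1 else 0)
            t₂ from
          ⟨by simpa using h'.count, h'.plus, h'.minus, h'.zero_plus, h'.zero_minus⟩
        have hmk : ∀ x, x ∈ D.take (k + 1) ↔ x ∈ D.take k ∨ x = D[k] := fun x => by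
          rw [htake, List.mem_append, List.mem_singleton]
        by_cases hyc : D[k] ∈ cl (cen v)
        · rw [if_pos hyc] at h
          convert h using 1
          · funext x
            by_cases hx : x = D[k]
            · subst hx; simp only [hyc, not_true, and_false]
            · simp only [hmk, hx, or_false]
          · funext x
            by_cases hx : x = D[k]
            · subst hx; simp [hyc, hnot, hmk]
            · simp only [hmk, hx, or_false,
                Function.update_of_ne hx]
        · rw [if_neg hyc] at h
          convert h using 1
          · funext x
            by_cases hx : x = D[k]
            · subst hx; simp [hyc, hnot, hmk]
            · simp only [hmk, hx, or_false,
                Function.update_of_ne hx]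
          · funext x
            by_cases hx : x = D[k]
            · subst hx; simp only [hyc, and_false]
            · simp only [hmk, hx, or_false]
    · intro t' hA' h
      rw [List.take_length] at h
      -- Once `D` is exhausted, the two indicators describe `N[v] \ N[cen v]` and `N[cen v] \ N[v]`,
      -- which are the contributions of `v` to `gain` and `loss`.
      convert h using 1
      · funext x
        simp only [gain, List.countP_append, List.countP_singleton, hDdef, mem_diffList]
        by_cases h1 : x ∈ cl (cen v) <;> by_cases h2 : x ∈ cl v <;> simp [h1, h2]
      · funext x
        simp only [loss, List.countP_append, List.countP_singleton, hDdef, mem_diffList]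
        by_cases h1 : x ∈ cl (cen v) <;> by_cases h2 : x ∈ cl v <;> simp [h1, h2]
    · simp only [Finset.sum_const, Finset.card_range, smul_eq_mul, Exp.cost]
      have := Nat.mul_le_mul hDK (show 68 + (1 + 1 + 7) ≤ 80 by omega)
      omega
  · intro t _ h; exact h
  · have := Nat.mul_le_mul_left (cl u).length (show K * 80 + 20 + 32 ≤ K * 80 + 60 by omega)
    omega

/-- Decides whether all second neighbourhoods are full; the answer is left in register `4`. -/
def coverProg : Prog :=
  .seq (.assign 4 (.lit 1)) (forP 6 (.reg 0) (.seq tallyProg (.seq baseProg (.seq correctProg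
    (.ite (eqE (.reg 10) (.reg 0)) .skip (.assign 4 (.lit 0)))))))

/-- Only the counter arrays that are incremented in place, `10`, `12` and `13`, must start from
zero; array `11` is overwritten before it is read. -/
theorem coverProg_spec {w S T K : ℕ} {s : State} (hw : Wide n w)
    (hD : GoodData n cl cs ts cen typ) (hs : Prepared n cl cs ts cen typ s)
    (hS : cs.length ≤ S) (hT : ts.length ≤ T)
    (hK : ∀ v < n, (diffList cl v (cen v)).length ≤ K)
    (hz : ∀ a ∈ [10, 12, 13], s.arr a = fun _ => 0) :
    Hoare w coverProg s (∑ u ∈ Finset.range n,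
        ((cl u).length * (K * 80 + 120) + T * (S * 40 + 50) + 150) + 50) fun s' =>
      (s'.reg 4 = 1 ∧ ∀ u < n, ∀ x < n, ∃ v ∈ cl u, x ∈ cl v) ∨
      (s'.reg 4 = 0 ∧ ¬ ∀ u < n, ∀ x < n, ∃ v ∈ cl u, x ∈ cl v) := by
  have hW : 4 * (n * n) + 16 * n + 16 < 2 ^ w := hw
  refine (Hoare.seq (T₁ := 2) (T₂ := ∑ u ∈ Finset.range n,
        ((cl u).length * (K * 80 + 120) + T * (S * 40 + 50) + 150) + 40) ?_).time (by omega)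
  refine (Hoare.block (P := .assign 4 (.lit 1)) (Q := fun s' => s' = s.setReg 4 1)
    le_rfl ⟨show 1 < 2 ^ w by omega, rfl⟩).mono le_rfl ?_
  rintro _ rfl
  refine (Hoare.forP (N := n)
    (c := fun u => (cl u).length * (K * 80 + 120) + T * (S * 40 + 50) + 120)
    (fun k s' => (∀ a ∈ [10, 12, 13], ZeroRows n a k s') ∧
      ((s'.reg 4 = 1 ∧ ∀ u < k, ∀ x < n, ∃ v ∈ cl u, x ∈ cl v) ∨
      (s'.reg 4 = 0 ∧ ¬ ∀ u < k, ∀ x < n, ∃ v ∈ cl u, x ∈ cl v)))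
    (by omega) hw.pos rfl ?_ ?_ ?_ ?_).time ?_
  · intro k _ t hA _
    exact ⟨trivial, (hA.1 0 rfl).trans hs.graph.size⟩
  · refine ⟨fun a ha v _ _ x _ => ?_, Or.inl ⟨by simp, by simp⟩⟩
    rw [State.setReg_arr, State.setReg_arr, hz a ha]
  · rintro u hu t hA h6 ⟨hZ, hor⟩
    have hst : Prepared n cl cs ts cen typ t := by
      refine hs.congr ?_ ?_
      · intro x hx
        refine (hA.1 x (by fin_cases hx <;> rfl)).trans ?_
        fin_cases hx <;> rfl
      · intro x hx
        exact hA.2 x (by fin_cases hx <;> rfl)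
    refine (Hoare.seq (T₁ := (cl u).length * 60 + 14)
      (T₂ := (cl u).length * (K * 80 + 60) + T * (S * 40 + 50) + 80) ?_).time ?_
    swap
    · rw [show K * 80 + 120 = (K * 80 + 60) + 60 by omega, Nat.mul_add _ (K * 80 + 60) 60]; omega
    refine (tallyProg_spec hw hD hst hu h6 (hZ 10 (by simp))).frame.mono le_rfl ?_
    rintro t₁ ⟨hA₁, hr, hz10⟩
    have hst₁ : Prepared n cl cs ts cen typ t₁ := by
      refine hst.congr ?_ ?_
      · intro x hx; refine hA₁.1 x ?_; fin_cases hx <;> rfl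
      · intro x hx; refine hA₁.2 x ?_; fin_cases hx <;> rfl
    have h6₁ : t₁.reg 6 = u := (hA₁.1 6 rfl).trans h6
    refine (Hoare.seq (T₁ := T * (S * 40 + 50) + 50)
      (T₂ := (cl u).length * (K * 80 + 60) + 14 + 10) ?_).time (by omega)
    refine (baseProg_spec hw hD hst₁ hS hT hu h6₁ hr).frame.mono le_rfl ?_
    rintro t₂ ⟨hA₂, h10, h11⟩
    have hst₂ : Prepared n cl cs ts cen typ t₂ := by
      refine hst₁.congr ?_ ?_
      · intro x hx; refine hA₂.1 x ?_; fin_cases hx <;> rfl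
      · intro x hx; refine hA₂.2 x ?_; fin_cases hx <;> rfl
    have h6₂ : t₂.reg 6 = u := (hA₂.1 6 rfl).trans h6₁
    refine Hoare.seq (T₁ := (cl u).length * (K * 80 + 60) + 14) (T₂ := 10) ?_
    refine (correctProg_spec hw hD hst₂ hu hK h6₂ h11 h10
      ((hZ 12 (by simp)).congr ((hA₂.2 12 rfl).trans (hA₁.2 12 rfl)))
      ((hZ 13 (by simp)).congr ((hA₂.2 13 rfl).trans (hA₁.2 13 rfl)))).frame.mono le_rfl ?_
    rintro t₃ ⟨hA₃, hC⟩
    have h4 : t₃.reg 4 = t.reg 4 := (hA₃.1 4 rfl).trans ((hA₂.1 4 rfl).trans (hA₁.1 4 rfl))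
    have h0 : t₃.reg 0 = n := (hA₃.1 0 rfl).trans hst₂.graph.size
    have hZ' : ∀ a ∈ [10, 12, 13], ZeroRows n a (u + 1) t₃ := by
      intro a ha
      fin_cases ha
      · exact hz10.congr ((hA₃.2 10 rfl).trans (hA₂.2 10 rfl))
      · exact hC.zero_plus
      · exact hC.zero_minus
    -- By `base_add_gain`, `loss < base + gain` says that `x` is reached through at least one
    -- neighbour of `u`. The counter equals `n` precisely when this holds for all `x`.
    have hcov : t₃.reg 10 = n ↔ ∀ x < n, ∃ v ∈ cl u, x ∈ cl v := by
      have hiff : ∀ x, (loss cl cen (cl u) x < base cl cen u x + gain cl cen (cl u) x) ↔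
          ∃ v ∈ cl u, x ∈ cl v := by
        intro x
        rw [base_add_gain, Nat.lt_add_right_iff_pos, List.countP_pos_iff]
        simp
      rw [hC.count]
      have := Finset.card_filter_eq_iff (s := Finset.range n)
        (p := fun x => loss cl cen (cl u) x < base cl cen u x + gain cl cen (cl u) x)
      rw [Finset.card_range] at this
      rw [this]
      simp only [Finset.mem_range, hiff]
    have hall : (∀ v < u + 1, ∀ x < n, ∃ a ∈ cl v, x ∈ cl a) ↔
        (∀ v < u, ∀ x < n, ∃ a ∈ cl v, x ∈ cl a) ∧ t₃.reg 10 = n := by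
      rw [hcov]
      refine ⟨fun h => ⟨fun v hv => h v (by omega), h u (by omega)⟩, fun h v hv => ?_⟩
      rcases Nat.lt_succ_iff_lt_or_eq.1 hv with hv' | rfl
      · exact h.1 v hv'
      · exact h.2
    refine Hoare.block (by decide) ⟨⟨trivial, trivial, hw.pos⟩, fun h => ?_,
      fun h => ⟨show 0 < 2 ^ w by omega, ?_⟩⟩
    · have h10' : t₃.reg 10 = n := by
        by_contra hne
        simp [Exp.val, BinOp.val, h0, hne] at h
      refine ⟨fun a ha => (hZ' a ha).congr rfl, ?_⟩
      rw [hall]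
      simp only [State.setReg_reg, Nat.reduceEqDiff, if_false, h4, h10', and_true]
      exact hor
    · have h10' : t₃.reg 10 ≠ n := by
        intro heq
        simp [Exp.val, BinOp.val, h0, heq] at h
      refine ⟨fun a ha => (hZ' a ha).congr rfl, Or.inr ⟨by simp [Exp.val], ?_⟩⟩
      rw [hall]
      exact fun h => h10' h.2
  · rintro t hA ⟨-, h⟩; exact h
  · refine Nat.add_le_add (Finset.sum_le_sum fun u _ => ?_) ?_
    · simp only [Exp.cost]; omega
    · simp only [Exp.cost]; omega

/-! ### Assembling the phases -/

/-- The whole computation except for the scale `q`. -/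
def pipelineProg : Prog :=
  .seq adjTable (.seq (greedy 2 3 4 nearTest) (.seq diffProg (.seq (greedy 3 7 8 traceTest)
    (.seq sizeProg coverProg))))

/-- Every two vertices have a common closed neighbour. -/
def AllMeet (n : ℕ) (cl : ℕ → List ℕ) : Prop := ∀ u < n, ∀ x < n, ∃ v ∈ cl u, x ∈ cl v

/-- `S` bounds the number of centres and `T` the number of trace classes. The list of centres is
known only at run time, so `hT` speaks of every possible list. Difference lists have length at most
`n / q`, and every phase costs a multiple of `M (n / q)` plus a multiple of `M T S`, where `M` is
the sum of the closed degrees. -/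
theorem pipelineProg_spec {w q S T : ℕ} {s : State} (hw : Wide n w) (hn : 0 < n)
    (hC : ClosedLists n cl) (hG : HasGraph n cl s) (hz : ∀ a, 2 ≤ a → s.arr a = fun _ => 0)
    (hq0 : 0 < q) (hqn : q ≤ n) (hq : s.reg 1 = q)
    (hS : ∀ l : List ℕ, (∀ x ∈ l, x < n) → (l.Pairwise fun a b => a < b ∧ ¬ Near n cl q b a) →
      l.length ≤ S)
    (hT : ∀ cs : List ℕ, cs.Nodup → (∀ x ∈ cs, x < n) → cs.length ≤ S → ∀ l : List ℕ,
      (∀ x ∈ l, x < n) → (l.Pairwise fun a b => a < b ∧ ¬ SameTrace cl cs b a) → l.length ≤ T)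
    (hS1 : 1 ≤ S) (hT1 : 1 ≤ T) :
    Hoare w pipelineProg s (2000 * ((∑ u ∈ Finset.range n, (cl u).length) * (n / q + T * S)))
      fun s' => (s'.reg 4 = 1 ∧ AllMeet n cl) ∨ (s'.reg 4 = 0 ∧ ¬ AllMeet n cl) := by
  have hsum : ∀ a b : ℕ, ∑ u ∈ Finset.range n, ((cl u).length * a + b) =
      (∑ u ∈ Finset.range n, (cl u).length) * a + n * b := by
    intro a b
    rw [Finset.sum_add_distrib, ← Finset.sum_mul]; simp
  have hnM : n ≤ ∑ u ∈ Finset.range n, (cl u).length := by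
    have := Finset.sum_le_sum (s := Finset.range n) (f := fun _ => 1) (g := fun u => (cl u).length)
      fun u hu => List.length_pos_of_mem (hC.self u (Finset.mem_range.1 hu))
    simpa using this
  set M := ∑ u ∈ Finset.range n, (cl u).length with hM
  set K := n / q with hK
  have hK1 : 1 ≤ K := (Nat.one_le_div_iff hq0).2 hqn
  have hM1 : 1 ≤ M := hn.trans_le hnM
  have hTS1 : 1 ≤ T * S := Nat.mul_pos hT1 hS1
  -- These comparisons of products make the time bounds of the phases linear in `M * K` and `M * (T
  -- * S)`, within the reach of `omega`.
  have f1 : M ≤ M * (T * S) := Nat.le_mul_of_pos_right _ hTS1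
  have f2 : M * S ≤ M * (T * S) := Nat.mul_le_mul_left _ (Nat.le_mul_of_pos_left _ hT1)
  have f3 : n * S ≤ M * S := Nat.mul_le_mul_right _ hnM
  have f4 : n * (T * S) ≤ M * (T * S) := Nat.mul_le_mul_right _ hnM
  have f5 : n * K ≤ M * K := Nat.mul_le_mul_right _ hnM
  have f6 : n * T ≤ n * (T * S) := Nat.mul_le_mul_left _ (Nat.le_mul_of_pos_right _ hS1)
  have hadj : ∑ u ∈ Finset.range n, ((cl u).length * 50 + 50) + 50 ≤ 150 * (M * (T * S)) := by
    rw [hsum]; omega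
  have hgr1 : ∑ u ∈ Finset.range n, (S * ((cl u).length * 50 + 60 + 50) + 50) + 50 ≤
      260 * (M * (T * S)) := by
    have : ∀ u, S * ((cl u).length * 50 + 60 + 50) + 50 = (cl u).length * (S * 50) + (S * 110 + 50) :=
      fun u => by ring
    simp only [this]
    rw [hsum, ← mul_assoc, mul_add, ← mul_assoc]; omega
  have hdf : ∑ u ∈ Finset.range n, (((cl u).length * 2 + K) * 60 + 60) + 50 ≤
      60 * (M * K) + 230 * (M * (T * S)) := by
    have : ∀ u, ((cl u).length * 2 + K) * 60 + 60 = (cl u).length * 120 + (K * 60 + 60) :=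
      fun u => by ring
    simp only [this]
    rw [hsum, mul_add, ← mul_assoc]; omega
  have hgr2 : ∑ u ∈ Finset.range n, (T * (S * 40 + 20 + 50) + 50) + 50 ≤ 210 * (M * (T * S)) := by
    have : n * (T * (S * 40 + 20 + 50) + 50) = 40 * (n * (T * S)) + 70 * (n * T) + 50 * n := by ring
    simp only [Finset.sum_const, Finset.card_range, smul_eq_mul, this]; omega
  have hsz : n * 50 + 50 ≤ 100 * (M * (T * S)) := by omega
  have hcv : ∑ u ∈ Finset.range n, ((cl u).length * (K * 80 + 120) + T * (S * 40 + 50) + 150) + 50 ≤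
      80 * (M * K) + 410 * (M * (T * S)) := by
    simp only [add_assoc _ (T * _)]
    rw [hsum]
    have e1 : M * (K * 80 + 120) = 80 * (M * K) + 120 * M := by ring
    have e2 : n * (T * (S * 40 + 50) + 150) = 40 * (n * (T * S)) + 50 * (n * T) + 150 * n := by ring
    rw [e1, e2]; omega
  have htot : 2000 * (M * (K + T * S)) = 2000 * (M * K) + 2000 * (M * (T * S)) := by ring
  rw [htot]
  clear_value M K
  refine (Hoare.seq (T₁ := 150 * (M * (T * S)))
    (T₂ := 140 * (M * K) + 1210 * (M * (T * S))) ?_).time (by omega)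
  refine (adjTable_spec hw hC hG (hz 2 le_rfl)).frame.mono hadj ?_
  rintro s₁ ⟨hA₁, hTab⟩
  have hG₁ : HasGraph n cl s₁ := hG.congr (hA₁.1 0 rfl) (hA₁.2 0 rfl) (hA₁.2 1 rfl)
  have hq₁ : s₁.reg 1 = q := (hA₁.1 1 rfl).trans hq
  refine (Hoare.seq (T₁ := 260 * (M * (T * S)))
    (T₂ := 140 * (M * K) + 950 * (M * (T * S))) ?_).time (by omega)
  refine (greedy_spec (R := Near n cl q) (S := S) (ct := fun u => (cl u).length * 50 + 60) hw
    hG₁.size (by decide) (by decide) (by decide) (by decide) ?_ hS).frame.mono hgr1 ?_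
  · intro u hu r hr t hA h6 h9
    refine nearTest_spec hw hC (hG₁.congr (hA.1 0 rfl) (hA.2 0 rfl) (hA.2 1 rfl)) ?_
      ((hA.1 1 rfl).trans hq₁) hqn hu hr h6 h9
    intro a ha x hx; rw [← hTab a ha x hx, hA.2 2 rfl]
  rintro s₂ ⟨hA₂, cs, hcs⟩
  have hG₂ : HasGraph n cl s₂ := hG₁.congr (hA₂.1 0 rfl) (hA₂.2 0 rfl) (hA₂.2 1 rfl)
  have hTab₂ : IsAdjTable n cl s₂ := by
    intro a ha x hx; rw [← hTab a ha x hx, hA₂.2 2 rfl]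
  have hcen : ∀ u < n, s₂.arr 4 u < n := fun u hu => hcs.lt _ (hcs.mem u hu)
  -- A vertex is either its own centre, with empty difference, or near its centre, which is the
  -- bound `n / q`.
  have hdK : ∀ u < n, (diffList cl u (s₂.arr 4 u)).length ≤ K := by
    intro u hu
    rw [hK, Nat.le_div_iff_mul_le hq0, mul_comm]
    rcases hcs.rel u hu with h | h
    · rw [h, diffList_self]; simp
    · exact h
  have hcsS : cs.length ≤ S := hS cs hcs.lt hcs.separated
  refine (Hoare.seq (T₁ := 60 * (M * K) + 230 * (M * (T * S)))
    (T₂ := 80 * (M * K) + 720 * (M * (T * S))) ?_).time (by omega)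
  refine (diffProg_spec (cen := s₂.arr 4) hw hC hG₂ hTab₂ hcen (fun _ _ => rfl) hdK).frame.mono
    hdf ?_
  rintro s₃ ⟨hA₃, hDR⟩
  have hG₃ : HasGraph n cl s₃ := hG₂.congr (hA₃.1 0 rfl) (hA₃.2 0 rfl) (hA₃.2 1 rfl)
  have hTab₃ : IsAdjTable n cl s₃ := by
    intro a ha x hx; rw [← hTab₂ a ha x hx, hA₃.2 2 rfl]
  have hcs₃ : Representatives (Near n cl q) 2 3 4 n cs s₃ :=
    hcs.congr (hA₃.1 2 rfl) (hA₃.2 3 rfl) (hA₃.2 4 rfl)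
  refine (Hoare.seq (T₁ := 210 * (M * (T * S)))
    (T₂ := 80 * (M * K) + 510 * (M * (T * S))) ?_).time (by omega)
  refine (greedy_spec (R := SameTrace cl cs) (S := T) (ct := fun u => S * 40 + 20) hw
    hG₃.size (by decide) (by decide) (by decide) (by decide) ?_
    (hT cs hcs.nodup hcs.lt hcsS)).frame.mono hgr2 ?_
  · intro u hu r hr t hA h6 h9
    refine traceTest_spec hw ((hA.1 0 rfl).trans hG₃.size) ?_ ((hA.1 2 rfl).trans hcs₃.length_eq)
      ?_ hcs.lt hcs.length_le hcsS hu hr h6 h9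
    · intro a ha x hx; rw [← hTab₃ a ha x hx, hA.2 2 rfl]
    · rw [hA.2 3 rfl]; exact hcs₃.entry
  rintro s₄ ⟨hA₄, ts, hts⟩
  have hG₄ : HasGraph n cl s₄ := hG₃.congr (hA₄.1 0 rfl) (hA₄.2 0 rfl) (hA₄.2 1 rfl)
  refine (Hoare.seq (T₁ := 100 * (M * (T * S)))
    (T₂ := 80 * (M * K) + 410 * (M * (T * S))) ?_).time (by omega)
  refine (sizeProg_spec hw hG₄.size ?_).frame.mono hsz ?_
  · rw [hA₄.2 9 rfl, hA₃.2 9 rfl, hA₂.2 9 rfl, hA₁.2 9 rfl, hz 9 (by norm_num)]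
  rintro s₅ ⟨hA₅, h9⟩
  have a8 : s₅.arr 8 = s₄.arr 8 := hA₅.2 8 rfl
  have hD : GoodData n cl cs ts (s₂.arr 4) (s₄.arr 8) := by
    refine ⟨hC, hcs.lt, hcs.nodup, hts.lt, hts.nodup, hcs.mem, hts.mem, fun u hu x hx => ?_⟩
    rcases hts.rel u hu with h | h
    · rw [h]
    · exact h x hx
  have hP : Prepared n cl cs ts (s₂.arr 4) (s₄.arr 8) s₅ := by
    constructor
    · exact hG₄.congr (hA₅.1 0 rfl) (hA₅.2 0 rfl) (hA₅.2 1 rfl)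
    · intro a ha x hx; rw [← hTab₃ a ha x hx, hA₅.2 2 rfl, hA₄.2 2 rfl]
    · rw [hA₅.1 2 rfl, hA₄.1 2 rfl]; exact hcs₃.length_eq
    · rw [hA₅.2 3 rfl, hA₄.2 3 rfl]; exact hcs₃.entry
    · rw [hA₅.2 4 rfl, hA₄.2 4 rfl, hA₃.2 4 rfl]; exact fun _ _ => rfl
    · unfold DiffRows RowHolds
      rw [hA₅.2 5 rfl, hA₄.2 5 rfl, hA₅.2 6 rfl, hA₄.2 6 rfl]; exact hDR
    · rw [hA₅.1 3 rfl]; exact hts.length_eq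
    · rw [hA₅.2 7 rfl]; exact hts.entry
    · rw [a8]; exact fun _ _ => rfl
    · exact h9
  refine (coverProg_spec hw hD hP hcsS (hT cs hcs.nodup hcs.lt hcsS ts hts.lt hts.separated) hdK
    ?_).mono hcv fun _ h => h
  intro a ha
  fin_cases ha
  · rw [hA₅.2 10 rfl, hA₄.2 10 rfl, hA₃.2 10 rfl, hA₂.2 10 rfl, hA₁.2 10 rfl, hz 10 (by norm_num)]
  · rw [hA₅.2 12 rfl, hA₄.2 12 rfl, hA₃.2 12 rfl, hA₂.2 12 rfl, hA₁.2 12 rfl, hz 12 (by norm_num)]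
  · rw [hA₅.2 13 rfl, hA₄.2 13 rfl, hA₃.2 13 rfl, hA₂.2 13 rfl, hA₁.2 13 rfl, hz 13 (by norm_num)]

end WordRAM

/-! ## Traces and packings of set families of bounded VC-dimension -/

section SetFamily

open Finset

variable {α : Type*} [DecidableEq α]

/-- Number of subsets of bounded size. -/
theorem card_filter_card_le (Y : Finset α) (d : ℕ) :
    (Y.powerset.filter fun Z => Z.card ≤ d).card ≤ (Y.card + 1) ^ d := by
  induction d with
  | zero =>
    rw [pow_zero, card_le_one]
    intro a ha b hb
    simp only [mem_filter, Nat.le_zero, card_eq_zero] at ha hb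
    rw [ha.2, hb.2]
  | succ d ih =>
    -- A nonempty set is encoded by one of its elements together with the rest, the empty set by
    -- `none`. This gives the factor `#Y + 1`.
    have hsub : (Y.powerset.filter fun Z => Z.card ≤ d + 1) ⊆
        (insertNone Y ×ˢ Y.powerset.filter fun Z => Z.card ≤ d).image
          fun p => p.1.elim p.2 fun a => insert a p.2 := by
      intro Z hZ
      rw [mem_filter, mem_powerset] at hZ
      rw [mem_image]
      rcases Z.eq_empty_or_nonempty with rfl | ⟨a, ha⟩
      · exact ⟨(none, ∅), by simp, rfl⟩
      · refine ⟨(some a, Z.erase a), ?_, ?_⟩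
        · simp only [mem_product, some_mem_insertNone, mem_filter, mem_powerset]
          refine ⟨hZ.1 ha, (erase_subset _ _).trans hZ.1, ?_⟩
          rw [card_erase_of_mem ha]; omega
        · simp [insert_erase ha]
    refine (card_le_card hsub).trans (card_image_le.trans ?_)
    rw [card_product, card_insertNone, pow_succ, mul_comm]
    exact Nat.mul_le_mul_right _ ih

/-- A family of VC-dimension at most `d` has at most `(#Y + 1) ^ d` traces on `Y`. -/
theorem card_trace_le {𝒜 : Finset (Finset α)} {d : ℕ} (h : 𝒜.vcDim ≤ d) (Y : Finset α) :
    (𝒜.image fun A => A ∩ Y).card ≤ (Y.card + 1) ^ d := by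
  -- A family has at most as many members as it shatters sets. What the traces on `Y` shatter is
  -- contained in `Y` and already shattered by `𝒜`, so it has at most `d` elements.
  refine (card_le_card_shatterer _).trans ((card_le_card ?_).trans (card_filter_card_le Y d))
  intro Z hZ
  rw [mem_shatterer] at hZ
  have hZY : Z ⊆ Y := by
    obtain ⟨t, ht, hZt⟩ := hZ.exists_superset
    obtain ⟨A, -, rfl⟩ := mem_image.1 ht
    exact hZt.trans inter_subset_right
  rw [mem_filter, mem_powerset]
  refine ⟨hZY, le_trans (Shatters.card_le_vcDim ?_) h⟩
  intro t ht
  obtain ⟨u, hu, hut⟩ := hZ ht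
  obtain ⟨A, hA, rfl⟩ := mem_image.1 hu
  refine ⟨A, hA, ?_⟩
  rw [← hut, inter_comm A Y, ← inter_assoc, inter_eq_left.2 hZY]

/-- Sets of density more than `1 / q` have a small hitting set. -/
theorem exists_hitting_set [Fintype α] {q : ℕ} (r : ℕ) (𝒟 : Finset (Finset α))
    (h𝒟 : ∀ D ∈ 𝒟, Fintype.card α < q * D.card) (hr : 𝒟.card * (q - 1) ^ r < q ^ r) :
    ∃ Y : Finset α, Y.card ≤ r ∧ ∀ D ∈ 𝒟, (D ∩ Y).Nonempty := by
  induction r generalizing 𝒟 with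
  | zero =>
    have : 𝒟 = ∅ := by simpa using hr
    subst this
    exact ⟨∅, by simp, by simp⟩
  | succ r ih =>
    rcases 𝒟.eq_empty_or_nonempty with rfl | ⟨D₀, hD₀⟩
    · exact ⟨∅, by simp, by simp⟩
    have hq : 0 < q := Nat.pos_of_ne_zero (by rintro rfl; simpa using h𝒟 D₀ hD₀)
    -- Averaging: each set contains more than a fraction `1 / q` of the points, so by double
    -- counting some point lies in at least a fraction `1 / q` of the sets.
    obtain ⟨y, hy⟩ : ∃ y, 𝒟.card ≤ q * (𝒟.filter fun D => y ∈ D).card := by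
      by_contra! hcon
      have h1 : ∑ y : α, (𝒟.filter fun D => y ∈ D).card = ∑ D ∈ 𝒟, D.card := by
        simp only [card_filter]
        rw [sum_comm]
        refine sum_congr rfl fun D _ => ?_
        rw [← card_filter]; simp
      have h2 : ∑ y : α, q * (𝒟.filter fun D => y ∈ D).card ≤ ∑ _y : α, 𝒟.card :=
        sum_le_sum fun y _ => (hcon y).le
      rw [← mul_sum, h1, mul_sum, sum_const, card_univ, smul_eq_mul] at h2
      have h3 : ∑ _D ∈ 𝒟, Fintype.card α < ∑ D ∈ 𝒟, q * D.card :=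
        sum_lt_sum_of_nonempty ⟨D₀, hD₀⟩ h𝒟
      rw [sum_const, smul_eq_mul, mul_comm] at h3
      omega
    obtain ⟨Y, hY, hYD⟩ := ih (𝒟.filter fun D => y ∉ D) (fun D hD => h𝒟 D (mem_filter.1 hD).1) (by
      have h1 := card_filter_add_card_filter_not (s := 𝒟) (fun D => y ∈ D)
      -- Choosing `y` multiplies the number of sets not yet hit by at most `1 - 1 / q`, so after `r`
      -- choices fewer than one set remains.
      have h2 : q * (𝒟.filter fun D => y ∉ D).card ≤ 𝒟.card * (q - 1) := by
        obtain ⟨p, rfl⟩ : ∃ p, q = p + 1 := ⟨q - 1, by omega⟩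
        rw [Nat.add_sub_cancel]
        nlinarith
      have h3 : q * ((𝒟.filter fun D => y ∉ D).card * (q - 1) ^ r) < q * q ^ r := by
        calc q * ((𝒟.filter fun D => y ∉ D).card * (q - 1) ^ r)
            = q * (𝒟.filter fun D => y ∉ D).card * (q - 1) ^ r := by ring
          _ ≤ 𝒟.card * (q - 1) * (q - 1) ^ r := Nat.mul_le_mul_right _ h2
          _ = 𝒟.card * (q - 1) ^ (r + 1) := by ring
          _ < q ^ (r + 1) := hr
          _ = q * q ^ r := by ring
      exact lt_of_mul_lt_mul_left h3 (Nat.zero_le _))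
    refine ⟨insert y Y, (card_insert_le _ _).trans (by omega), fun D hD => ?_⟩
    by_cases hyD : y ∈ D
    · exact ⟨y, by simp [hyD]⟩
    · obtain ⟨x, hx⟩ := hYD D (mem_filter.2 ⟨hD, hyD⟩)
      rw [mem_inter] at hx
      exact ⟨x, by simp [hx.1, hx.2]⟩

/-- This is `(1 - 1 / q) ^ q ≤ 1 / 2`; with `p = q - 1` it follows from Bernoulli's inequality `(1 +
1 / p) ^ (p + 1) ≥ 2`. -/
theorem two_mul_pred_pow_le {q : ℕ} (hq : 0 < q) : 2 * (q - 1) ^ q ≤ q ^ q := by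
  obtain ⟨p, rfl⟩ : ∃ p, q = p + 1 := ⟨q - 1, by omega⟩
  rw [Nat.add_sub_cancel]
  rcases Nat.eq_zero_or_pos p with rfl | hp
  · simp
  have h : (p : ℝ) ^ (p + 1) * 2 ≤ ((p : ℝ) + 1) ^ (p + 1) := by
    have hp' : (0 : ℝ) < p := by exact_mod_cast hp
    have hb := one_add_mul_le_pow (a := (1 : ℝ) / p) (by
      have : 0 ≤ (1 : ℝ) / p := by positivity
      linarith) (p + 1)
    have h2 : (2 : ℝ) ≤ 1 + ((p + 1 : ℕ) : ℝ) * (1 / p) := by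
      push_cast
      rw [mul_one_div, add_div, div_self hp'.ne']
      have : 0 ≤ (1 : ℝ) / p := by positivity
      linarith
    calc (p : ℝ) ^ (p + 1) * 2 ≤ (p : ℝ) ^ (p + 1) * (1 + 1 / p) ^ (p + 1) := by
          gcongr; exact h2.trans hb
      _ = ((p : ℝ) + 1) ^ (p + 1) := by
          rw [← mul_pow]; congr 1; field_simp
  rw [mul_comm]
  exact_mod_cast h

/-- A family of VC-dimension at most `d` whose members differ pairwise in more than a fraction
`1 / q` of all points has at most `(2 q L + 1) ^ d` members, if it has fewer than `2 ^ L`. -/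
theorem card_le_of_separated [Fintype α] {𝒜 ℱ : Finset (Finset α)} {d q L : ℕ} (h : 𝒜.vcDim ≤ d)
    (hℱ : ℱ ⊆ 𝒜) (hq : 0 < q) (hL : ℱ.card < 2 ^ L)
    (hsep : ∀ A ∈ ℱ, ∀ B ∈ ℱ, A ≠ B → Fintype.card α < q * (symmDiff A B).card) :
    ℱ.card ≤ (2 * q * L + 1) ^ d := by
  -- Fewer than `2 ^ (2 L)` symmetric differences must be hit, and `q` choices of points halve the
  -- number left, so `q * (2 L)` points suffice.
  obtain ⟨Y, hY, hYD⟩ := exists_hitting_set (q := q) (q * (2 * L))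
    ((ℱ ×ˢ ℱ).filter (fun p => p.1 ≠ p.2) |>.image fun p => symmDiff p.1 p.2) (by
      intro D hD
      obtain ⟨⟨A, B⟩, hp, rfl⟩ := mem_image.1 hD
      rw [mem_filter, mem_product] at hp
      exact hsep A hp.1.1 B hp.1.2 hp.2) (by
      have h1 : (((ℱ ×ˢ ℱ).filter (fun p => p.1 ≠ p.2)).image fun p => symmDiff p.1 p.2).card ≤
          ℱ.card * ℱ.card :=
        card_image_le.trans ((card_filter_le _ _).trans (card_product _ _).le)
      have h2 : ℱ.card * ℱ.card < 2 ^ (2 * L) := by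
        rw [two_mul, pow_add]; exact Nat.mul_lt_mul'' hL hL
      have h3 := Nat.pow_le_pow_left (two_mul_pred_pow_le hq) (2 * L)
      rw [mul_pow, ← pow_mul, ← pow_mul] at h3
      -- Strictness is lost when multiplying by zero, so the case of a vanishing power is separate;
      -- it is trivial.
      rcases Nat.eq_zero_or_pos ((q - 1) ^ (q * (2 * L))) with h0 | h0
      · rw [h0, mul_zero]; positivity
      · exact ((Nat.mul_le_mul_right _ h1).trans_lt (Nat.mul_lt_mul_of_pos_right h2 h0)).trans_le h3)
  -- A point of `Y` in the symmetric difference of two members tells their traces apart, so counting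
  -- traces on `Y` counts the members.
  have hinj : Set.InjOn (fun A => A ∩ Y) (ℱ : Set (Finset α)) := by
    intro A hA B hB hAB
    by_contra hne
    obtain ⟨x, hx⟩ := hYD (symmDiff A B)
      (mem_image.2 ⟨(A, B), mem_filter.2 ⟨mem_product.2 ⟨hA, hB⟩, hne⟩, rfl⟩)
    rw [mem_inter, mem_symmDiff] at hx
    have := congrArg (x ∈ ·) hAB
    simp only [mem_inter, hx.2, and_true, eq_iff_iff] at this
    tauto
  rw [← card_image_of_injOn hinj]
  refine (card_le_card (image_subset_image hℱ)).trans ((card_trace_le h Y).trans ?_)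
  refine Nat.pow_le_pow_left ?_ d
  have : q * (2 * L) = 2 * q * L := by ring
  omega

end SetFamily

open WordRAM

/-! ## The input -/

section Input

variable {n : ℕ}

/-- The closed adjacency lists, on natural numbers. -/
def closedList (L : Fin n → List (Fin n)) (v : ℕ) : List ℕ :=
  if h : v < n then (L ⟨v, h⟩).map Fin.val ++ [v] else []

theorem mem_closedList {G : SimpleGraph (Fin n)} {L : Fin n → List (Fin n)} (hL : IsAdjLists G L)
    (u v : Fin n) : (v : ℕ) ∈ closedList L u ↔ v = u ∨ G.Adj u v := by
  simp only [closedList, u.isLt, dif_pos, Fin.eta, List.mem_append, List.mem_map,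
    List.mem_singleton, Fin.val_inj, exists_eq_right, (hL u).2]
  exact or_comm

theorem closedList_lt {L : Fin n → List (Fin n)} {u x : ℕ} (h : x ∈ closedList L u) : x < n := by
  unfold closedList at h
  split_ifs at h with hu
  · rcases List.mem_append.1 h with h | h
    · obtain ⟨y, -, rfl⟩ := List.mem_map.1 h; exact y.isLt
    · rw [List.mem_singleton.1 h]; exact hu
  · simp at h

theorem closedLists_closedList {G : SimpleGraph (Fin n)} {L : Fin n → List (Fin n)}
    (hL : IsAdjLists G L) : ClosedLists n (closedList L) := by
  constructor
  · intro v hv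
    rw [closedList, dif_pos hv, List.nodup_append]
    refine ⟨(hL ⟨v, hv⟩).1.map Fin.val_injective, by simp, ?_⟩
    intro a ha b hb hab
    obtain ⟨y, hy, rfl⟩ := List.mem_map.1 ha
    rw [List.mem_singleton.1 hb] at hab
    have := ((hL ⟨v, hv⟩).2 y).1 hy
    rw [show y = ⟨v, hv⟩ from Fin.ext hab] at this
    exact G.irrefl this
  · intro v _ x hx; exact closedList_lt hx
  · intro v hv x hx h
    have h1 := (mem_closedList hL ⟨v, hv⟩ ⟨x, hx⟩).1 h
    refine (mem_closedList hL ⟨x, hx⟩ ⟨v, hv⟩).2 ?_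
    exact h1.imp Eq.symm fun h => h.symm
  · intro v hv
    exact (mem_closedList hL ⟨v, hv⟩ ⟨v, hv⟩).2 (Or.inl rfl)

theorem adjOffset_succ (L : Fin n → List (Fin n)) (v : Fin n) :
    adjOffset L (v + 1) = adjOffset L v + (L v).length := by
  have h : ∀ x : Fin n, (if x.val < v.val + 1 then (L x).length else 0) =
      (if x.val < v.val then (L x).length else 0) + if x = v then (L v).length else 0 := by
    intro x
    by_cases hx : x = v
    · subst hx; simp
    · have : x.val ≠ v.val := fun h => hx (Fin.ext h)
      simp only [hx, if_false, add_zero]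
      congr 1
      rw [eq_iff_iff]; omega
  unfold adjOffset
  rw [Finset.sum_congr rfl fun x _ => h x, Finset.sum_add_distrib]
  simp

theorem length_flatten_take (L : Fin n → List (Fin n)) (v : ℕ) (hv : v ≤ n) :
    ((List.ofFn fun v => (L v).map Fin.val).take v).flatten.length = adjOffset L v := by
  induction v with
  | zero => simp [adjOffset]
  | succ v ih =>
    have hv' : v < n := hv
    rw [List.take_succ_eq_append_getElem (by simpa using hv'), List.flatten_append,
      List.length_append, ih hv'.le, adjOffset_succ L ⟨v, hv'⟩]
    simp

theorem adjConcat_getD (L : Fin n → List (Fin n)) {v k : ℕ} (hv : v < n)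
    (hk : k < ((L ⟨v, hv⟩).map Fin.val).length) :
    (adjConcat L).getD (adjOffset L v + k) 0 = ((L ⟨v, hv⟩).map Fin.val)[k] := by
  set ls := List.ofFn fun v => (L v).map Fin.val with hls
  have hlen : ls.length = n := by simp [hls]
  have hsplit : ls = ls.take v ++ ls[v] :: ls.drop (v + 1) := by simp
  have hget : ls[v] = (L ⟨v, hv⟩).map Fin.val := by simp [hls]
  have hoff : (ls.take v).flatten.length = adjOffset L v := length_flatten_take L v hv.le
  have hcat : adjConcat L = (ls.take v).flatten ++ (ls[v] ++ (ls.drop (v + 1)).flatten) := by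
    rw [adjConcat, ← hls]
    conv_lhs => rw [hsplit]
    rw [List.flatten_append, List.flatten_cons]
  rw [hcat, ← hoff, List.getD_append_right _ _ _ _ (by omega), Nat.add_sub_cancel_left, hget,
    List.getD_append _ _ _ _ hk, List.getD_eq_getElem _ _ hk]

theorem adjList_length_le {G : SimpleGraph (Fin n)} {L : Fin n → List (Fin n)} (hL : IsAdjLists G L)
    (v : Fin n) : (L v).length ≤ n := by
  simpa using (hL v).1.length_le_card

theorem hasGraph_inputState {G : SimpleGraph (Fin n)} {L : Fin n → List (Fin n)}
    (hL : IsAdjLists G L) : HasGraph n (closedList L) (inputState L) := by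
  constructor
  · simp [inputState]
  · intro v hv
    refine ⟨(L ⟨v, hv⟩).map Fin.val, by rw [closedList, dif_pos hv], ?_, fun k hk => ?_⟩
    · have := adjOffset_succ L ⟨v, hv⟩
      simpa [inputState, hv.le, Nat.succ_le_of_lt hv] using this
    · simpa [inputState, hv.le] using adjConcat_getD L hv hk
  · intro v hv
    simp only [inputState, if_true, hv]
    calc adjOffset L v ≤ ∑ _v : Fin n, n := by
          refine Finset.sum_le_sum fun x _ => ?_
          split_ifs
          · exact adjList_length_le hL x
          · exact Nat.zero_le _
      _ = n * n := by simp

theorem sum_length_eq {G : SimpleGraph (Fin n)} {L : Fin n → List (Fin n)} (hL : IsAdjLists G L) :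
    ∑ v, (L v).length = 2 * G.edgeSet.ncard := by
  classical
  have h1 : ∀ v, (L v).length = G.degree v := by
    intro v
    rw [← List.toFinset_card_of_nodup (hL v).1, ← SimpleGraph.card_neighborFinset_eq_degree]
    congr 1
    ext u
    simp [(hL v).2]
  rw [Finset.sum_congr rfl fun v _ => h1 v, G.sum_degrees_eq_twice_card_edges,
    ← SimpleGraph.coe_edgeFinset, Set.ncard_coe_finset]

/-- The last offset hands the machine the number of edges for free; the test for completeness uses
it. -/
theorem adjOffset_self {G : SimpleGraph (Fin n)} {L : Fin n → List (Fin n)} (hL : IsAdjLists G L) :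
    adjOffset L n = 2 * G.edgeSet.ncard := by
  rw [← sum_length_eq hL]
  simp [adjOffset]

theorem sum_closedList_length {G : SimpleGraph (Fin n)} {L : Fin n → List (Fin n)}
    (hL : IsAdjLists G L) :
    ∑ v ∈ Finset.range n, (closedList L v).length = n + 2 * G.edgeSet.ncard := by
  rw [← sum_length_eq hL, Finset.sum_range]
  simp [closedList, Finset.sum_add_distrib, add_comm]

/-! ## Bounds for the numbers of centres and of classes -/

/-- The members of a closed adjacency list, as a set of vertices. -/
def closedSet (L : Fin n → List (Fin n)) (v : ℕ) : Finset (Fin n) :=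
  Finset.univ.filter fun u => (u : ℕ) ∈ closedList L v

theorem closedSet_mem {G : SimpleGraph (Fin n)} {L : Fin n → List (Fin n)} (hL : IsAdjLists G L)
    {v : ℕ} (hv : v < n) : closedSet L v ∈ closedNeighbourhoods G := by
  classical
  unfold closedNeighbourhoods
  rw [Finset.mem_image]
  refine ⟨⟨v, hv⟩, Finset.mem_univ _, ?_⟩
  ext u
  simp only [closedSet, Finset.mem_filter, Finset.mem_univ, true_and]
  exact (mem_closedList hL ⟨v, hv⟩ u).symm

theorem card_symmDiff_closedSet {G : SimpleGraph (Fin n)} {L : Fin n → List (Fin n)}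
    (hL : IsAdjLists G L) {u r : ℕ} (hu : u < n) (hr : r < n) :
    (symmDiff (closedSet L u) (closedSet L r)).card = (diffList (closedList L) u r).length := by
  have hC := closedLists_closedList hL
  rw [← List.toFinset_card_of_nodup (hC.diffList_nodup hu hr),
    ← Finset.card_map Fin.valEmbedding]
  congr 1
  ext x
  simp only [Finset.mem_map, Finset.mem_symmDiff, closedSet, Finset.mem_filter, Finset.mem_univ,
    true_and, Fin.valEmbedding_apply, List.mem_toFinset, mem_diffList]
  constructor
  · rintro ⟨y, hy, rfl⟩; exact hy
  · intro h
    have hx : x < n := by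
      rcases h with h | h
      · exact closedList_lt h.1
      · exact closedList_lt h.1
    exact ⟨⟨x, hx⟩, h, rfl⟩

/-- Distinct centres have closed neighbourhoods that differ in more than `n / q` places. These are
therefore distinct sets, to which the packing bound `card_le_of_separated` applies. -/
theorem centres_length_le {G : SimpleGraph (Fin n)} {L : Fin n → List (Fin n)}
    (hL : IsAdjLists G L) {d q : ℕ} (hd : graphVCDim G ≤ d) (hq : 0 < q) {l : List ℕ}
    (hl : ∀ x ∈ l, x < n)
    (hp : l.Pairwise fun a b => a < b ∧ ¬ Near n (closedList L) q b a) :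
    l.length ≤ (2 * q * (Nat.log 2 n + 1) + 1) ^ d := by
  have hnd : l.Nodup := hp.imp fun h => h.1.ne
  have hfar : ∀ a ∈ l, ∀ b ∈ l, a ≠ b →
      n < q * (symmDiff (closedSet L a) (closedSet L b)).card := by
    have hp' : l.Pairwise fun a b => n < q * (symmDiff (closedSet L a) (closedSet L b)).card := by
      refine hp.imp_of_mem fun {a b} ha hb h => ?_
      have := h.2
      rw [Near, ← card_symmDiff_closedSet hL (hl b hb) (hl a ha), symmDiff_comm] at this
      omega
    intro a ha b hb hab
    have : Std.Symm fun a b => n < q * (symmDiff (closedSet L a) (closedSet L b)).card :=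
      ⟨fun x y h => by rwa [symmDiff_comm]⟩
    exact hp'.forall ha hb hab
  have hinj : Set.InjOn (closedSet L) (l.toFinset : Set ℕ) := by
    intro a ha b hb hab
    by_contra hne
    have := hfar a (by simpa using ha) b (by simpa using hb) hne
    rw [hab, symmDiff_self] at this
    simp at this
  have hcard : (l.toFinset.image (closedSet L)).card = l.length := by
    rw [Finset.card_image_of_injOn hinj, List.toFinset_card_of_nodup hnd]
  rw [← hcard]
  refine card_le_of_separated (𝒜 := closedNeighbourhoods G) hd ?_ hq ?_ ?_
  · intro A hA
    obtain ⟨a, ha, rfl⟩ := Finset.mem_image.1 hA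
    exact closedSet_mem hL (hl a (by simpa using ha))
  · rw [hcard]
    -- The a priori bound needed by the packing lemma: there are at most `n < 2 ^ (log₂ n + 1)`
    -- centres. This is the source of the logarithm.
    exact (length_le_of_nodup hnd hl).trans_lt (Nat.lt_pow_succ_log_self (by norm_num) n)
  · intro A hA B hB hAB
    obtain ⟨a, ha, rfl⟩ := Finset.mem_image.1 hA
    obtain ⟨b, hb, rfl⟩ := Finset.mem_image.1 hB
    rw [Fintype.card_fin]
    exact hfar a (by simpa using ha) b (by simpa using hb) fun h => hAB (by rw [h])

/-- Closed adjacency is symmetric, so the centres whose neighbourhoods contain `x` are the centres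
in `N[x]`. Classes therefore correspond to traces of closed neighbourhoods on the set of centres,
and `card_trace_le` applies without passing to the dual family. -/
theorem classes_length_le {G : SimpleGraph (Fin n)} {L : Fin n → List (Fin n)}
    (hL : IsAdjLists G L) {d S : ℕ} (hd : graphVCDim G ≤ d) {cs : List ℕ}
    (hcs : ∀ x ∈ cs, x < n) (hS : cs.length ≤ S) {l : List ℕ} (hl : ∀ x ∈ l, x < n)
    (hp : l.Pairwise fun a b => a < b ∧ ¬ SameTrace (closedList L) cs b a) :
    l.length ≤ (S + 1) ^ d := by
  have hC := closedLists_closedList hL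
  have hnd : l.Nodup := hp.imp fun h => h.1.ne
  set Y : Finset (Fin n) := Finset.univ.filter fun y => (y : ℕ) ∈ cs with hY
  have hYS : Y.card ≤ S := by
    rw [← Finset.card_map Fin.valEmbedding]
    refine le_trans (Finset.card_le_card (t := cs.toFinset) ?_) (cs.toFinset_card_le.trans hS)
    intro x hx
    obtain ⟨y, hy, rfl⟩ := Finset.mem_map.1 hx
    simpa [hY] using hy
  have hne : ∀ a ∈ l, ∀ b ∈ l, a ≠ b → closedSet L a ∩ Y ≠ closedSet L b ∩ Y := by
    have hp' : l.Pairwise fun a b => closedSet L a ∩ Y ≠ closedSet L b ∩ Y := by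
      refine hp.imp_of_mem fun {a b} ha hb h heq => h.2 fun x hx => ?_
      have hxn := hcs x hx
      have := congrArg ((⟨x, hxn⟩ : Fin n) ∈ ·) heq
      simp only [closedSet, hY, Finset.mem_inter, Finset.mem_filter, Finset.mem_univ, true_and, hx,
        and_true, eq_iff_iff] at this
      have han := hl a ha
      have hbn := hl b hb
      exact ⟨fun h => hC.symm _ hbn _ hxn (this.1 (hC.symm _ hxn _ han h)),
        fun h => hC.symm _ han _ hxn (this.2 (hC.symm _ hxn _ hbn h))⟩
    intro a ha b hb hab
    have : Std.Symm fun a b => closedSet L a ∩ Y ≠ closedSet L b ∩ Y := ⟨fun x y h => h.symm⟩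
    exact hp'.forall ha hb hab
  have hinj : Set.InjOn (fun a => closedSet L a ∩ Y) (l.toFinset : Set ℕ) := by
    intro a ha b hb hab
    by_contra h
    exact hne a (by simpa using ha) b (by simpa using hb) h hab
  rw [← List.toFinset_card_of_nodup hnd, ← Finset.card_image_of_injOn hinj]
  refine (Finset.card_le_card ?_).trans ((card_trace_le (𝒜 := closedNeighbourhoods G) hd Y).trans
    (Nat.pow_le_pow_left (by omega) d))
  intro A hA
  obtain ⟨a, ha, rfl⟩ := Finset.mem_image.1 hA
  exact Finset.mem_image.2 ⟨_, closedSet_mem hL (hl a (by simpa using ha)), rfl⟩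

/-! ## The diameter -/

/-- A common closed neighbour bounds the distance by two, and a geodesic of length at most two
supplies one. Connectedness matters: `diam` takes a default value on graphs of infinite diameter. -/
theorem allMeet_iff {G : SimpleGraph (Fin n)} {L : Fin n → List (Fin n)} (hL : IsAdjLists G L)
    (hG : G.Connected) : AllMeet n (closedList L) ↔ G.diam ≤ 2 := by
  have : Nonempty (Fin n) := hG.nonempty
  have htop : G.ediam ≠ ⊤ := SimpleGraph.connected_iff_ediam_ne_top.1 hG
  constructor
  · intro h
    obtain ⟨u, v, huv⟩ := G.exists_dist_eq_diam
    rw [← huv]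
    obtain ⟨w, hw, hv⟩ := h u u.isLt v v.isLt
    have hwn := closedList_lt hw
    have h1 := (mem_closedList hL u ⟨w, hwn⟩).1 hw
    have h2 := (mem_closedList hL ⟨w, hwn⟩ v).1 hv
    have e1 : G.dist u ⟨w, hwn⟩ ≤ 1 := by
      rcases h1 with h1 | h1
      · rw [h1]; simp
      · exact (SimpleGraph.dist_eq_one_iff_adj.2 h1).le
    have e2 : G.dist ⟨w, hwn⟩ v ≤ 1 := by
      rcases h2 with h2 | h2
      · rw [h2]; simp
      · exact (SimpleGraph.dist_eq_one_iff_adj.2 h2).le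
    exact (hG.dist_triangle (v := ⟨w, hwn⟩)).trans (Nat.add_le_add e1 e2)
  · intro h u hu v hv
    obtain ⟨p, hp⟩ := hG.exists_walk_length_eq_dist ⟨u, hu⟩ ⟨v, hv⟩
    have hle : p.length ≤ 2 := by rw [hp]; exact (G.dist_le_diam htop).trans h
    have hC := closedLists_closedList hL
    cases p with
    | nil => exact ⟨u, hC.self u hu, hC.self u hu⟩
    | @cons _ a _ hadj p =>
      refine ⟨a, (mem_closedList hL ⟨u, hu⟩ a).2 (Or.inr hadj), ?_⟩
      refine (mem_closedList hL a ⟨v, hv⟩).2 ?_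
      cases p with
      | nil => exact Or.inl rfl
      | cons hadj' p =>
        cases p with
        | nil => exact Or.inr hadj'
        | cons _ _ => simp at hle

theorem eq_top_iff_ncard {G : SimpleGraph (Fin n)} :
    G = ⊤ ↔ 2 * G.edgeSet.ncard = n * (n - 1) := by
  classical
  have htop : 2 * (⊤ : SimpleGraph (Fin n)).edgeFinset.card = n * (n - 1) := by
    rw [← SimpleGraph.sum_degrees_eq_twice_card_edges]
    simp
  have hcard : G.edgeSet.ncard = G.edgeFinset.card := by
    rw [← SimpleGraph.coe_edgeFinset, Set.ncard_coe_finset]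
  rw [hcard]
  constructor
  · rintro rfl
    convert htop
  · intro h
    rw [← SimpleGraph.edgeFinset_inj]
    exact Finset.eq_of_subset_of_card_le (SimpleGraph.edgeFinset_mono le_top) (by omega)

/-- Among connected graphs of diameter at most two, those of smaller diameter are the complete ones,
including the graph with a single vertex; the edge count recognises them. -/
theorem diam_eq_two_iff {G : SimpleGraph (Fin n)} (hG : G.Connected) :
    G.diam = 2 ↔ G.diam ≤ 2 ∧ 2 * G.edgeSet.ncard ≠ n * (n - 1) := by
  have : Nonempty (Fin n) := hG.nonempty
  rw [Ne, ← eq_top_iff_ncard]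
  rcases subsingleton_or_nontrivial (Fin n) with hs | hs
  · have h0 : G.diam = 0 := SimpleGraph.diam_eq_zero.2 (Or.inr hs)
    have htop : G = ⊤ := Subsingleton.elim _ _
    exact ⟨fun h => by omega, fun h => absurd htop h.2⟩
  · have h0 : G.diam ≠ 0 := SimpleGraph.connected_iff_diam_ne_zero.1 hG
    rw [← SimpleGraph.diam_eq_one]
    omega

end Input

/-! ## The algorithm -/

/-- Decides whether the diameter is at most two; the answer is left in register `4`. -/
def coreProg (E : ℕ) : Prog := .seq (scaleProg E) pipelineProg

/-- With `a = 2 ^ (log₂ n + 1) > n`, the hypothesis says `a ^ (E + 8) ≤ 2 ^ w`. The factor `a ^ 8 ≥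
64 a²` covers the quadratic quantities, and `a ^ E ≥ 2 ^ E` the trial product in the search for the
scale. -/
theorem wide_of_le {n w E : ℕ} (h : (E + 8) * (Nat.log 2 n + 1) ≤ w) :
    Wide n w ∧ 2 ^ E * n < 2 ^ w := by
  set a := 2 ^ (Nat.log 2 n + 1) with ha
  have hn : n < a := Nat.lt_pow_succ_log_self (by norm_num) n
  have h2 : 2 ≤ a := by rw [ha, pow_succ]; have := Nat.one_le_two_pow (n := Nat.log 2 n); omega
  have hw : a ^ E * a ^ 8 ≤ 2 ^ w := by
    rw [← pow_add, ha, ← pow_mul, mul_comm]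
    exact Nat.pow_le_pow_right (by norm_num) h
  have hE1 : 1 ≤ a ^ E := Nat.one_le_pow _ _ (by omega)
  have hE2 : 2 ^ E ≤ a ^ E := Nat.pow_le_pow_left h2 E
  have h8 : a ≤ a ^ 8 := Nat.le_self_pow (by norm_num) a
  constructor
  · have e1 : 2 ^ 6 * (a * a) ≤ a ^ 8 := by
      calc 2 ^ 6 * (a * a) ≤ a ^ 6 * (a * a) := by gcongr
        _ = a ^ 8 := by ring
    have e2 : a ^ 8 ≤ a ^ E * a ^ 8 := Nat.le_mul_of_pos_left _ hE1
    have e3 : n * n < a * a := Nat.mul_lt_mul'' hn hn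
    have e4 : 2 * a ≤ a * a := Nat.mul_le_mul_right _ h2
    unfold Wide
    omega
  · calc 2 ^ E * n < 2 ^ E * a := by gcongr
      _ ≤ a ^ E * a ^ 8 := Nat.mul_le_mul hE2 h8
      _ ≤ 2 ^ w := hw

/-- Constant in the time bound. -/
def timeConst (d : ℕ) : ℕ := 4000 * (2 ^ (d + 1) * 3 ^ (d * (d + 1))) + 200

/-- With `S = (2 q L + 1) ^ d` centres and `(S + 1) ^ d` classes, the second term is at most `(S +
1) ^ (d + 1)`, which is of order `(q L) ^ (d (d + 1))`. The choice of `q` puts `q ^ (d (d + 1))`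
below `n / q`. The last summand `50` on the left is reserved for the final assignment of the answer.
-/
theorem cost_le {d n q M L : ℕ} (hq0 : 0 < q) (hqn : q ^ (d * (d + 1) + 2) ≤ n) (hn : 0 < n)
    (hM : n ≤ M) (hL : 1 ≤ L) :
    n * 50 + 50 + 2000 * (M * (n / q + ((2 * q * L + 1) ^ d + 1) ^ d * (2 * q * L + 1) ^ d)) + 50 ≤
      timeConst d * (M * (n / q) * L ^ (d * (d + 1))) := by
  set c := 2 ^ (d + 1) * 3 ^ (d * (d + 1)) with hc
  set S := (2 * q * L + 1) ^ d with hS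
  set X := n / q * L ^ (d * (d + 1)) with hX
  have hqL : 1 ≤ q * L := Nat.mul_pos hq0 hL
  have hc1 : 1 ≤ c := Nat.mul_pos (by positivity) (by positivity)
  have hS1 : 1 ≤ S := Nat.one_le_pow _ _ (by omega)
  -- Only `q ^ (d (d + 1) + 1) ≤ n` is needed. The extra one in the exponent keeps the saving `1 /
  -- (d (d + 1) + 2)` below `1` even for `d = 0`.
  have hq1 : q ^ (d * (d + 1)) ≤ n / q := by
    rw [Nat.le_div_iff_mul_le hq0, ← pow_succ]
    exact (Nat.pow_le_pow_right hq0 (by omega)).trans hqn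
  have hqp : 1 ≤ q ^ (d * (d + 1)) := Nat.one_le_pow _ _ hq0
  have hLp : 1 ≤ L ^ (d * (d + 1)) := Nat.one_le_pow _ _ hL
  have hST : (S + 1) ^ d * S ≤ c * X := by
    calc (S + 1) ^ d * S ≤ (S + 1) ^ d * (S + 1) := Nat.mul_le_mul_left _ (by omega)
      _ = (S + 1) ^ (d + 1) := (pow_succ _ _).symm
      _ ≤ (2 * (3 * (q * L)) ^ d) ^ (d + 1) := by
          refine Nat.pow_le_pow_left ?_ _
          have : S ≤ (3 * (q * L)) ^ d := Nat.pow_le_pow_left (by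
            have : 2 * q * L = 2 * (q * L) := by ring
            omega) d
          omega
      _ = c * (q ^ (d * (d + 1)) * L ^ (d * (d + 1))) := by
          rw [mul_pow 2, ← pow_mul, mul_pow 3, mul_pow q, hc, mul_assoc]
      _ ≤ c * X := Nat.mul_le_mul_left _ (Nat.mul_le_mul_right _ hq1)
  have hnX : n / q ≤ c * X :=
    (Nat.le_mul_of_pos_right _ hLp).trans (Nat.le_mul_of_pos_left _ hc1)
  have hX1 : 1 ≤ X := Nat.mul_pos (hqp.trans hq1) hLp
  have hMX : M ≤ M * X := Nat.le_mul_of_pos_right _ hX1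
  have h1 : M * (n / q + (S + 1) ^ d * S) ≤ M * (c * X + c * X) :=
    Nat.mul_le_mul_left _ (Nat.add_le_add hnX hST)
  have h2 : timeConst d * (M * (n / q) * L ^ (d * (d + 1))) =
      2000 * (M * (c * X + c * X)) + 200 * (M * X) := by
    rw [timeConst, ← hc, hX]; ring
  rw [h2]
  omega

/-- Besides the answer for "at most two", the final state still holds `n` and twice the number of
edges, from which "exactly two" is derived. The `50` steps subtracted leave room for the output. -/
theorem coreProg_spec {d n w : ℕ} {G : SimpleGraph (Fin n)} {L : Fin n → List (Fin n)}
    (hL : IsAdjLists G L) (hG : G.Connected) (hd : graphVCDim G ≤ d)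
    (hw : (d * (d + 1) + 2 + 8) * (Nat.log 2 n + 1) ≤ w) :
    ∃ q, 0 < q ∧ n < (2 * q) ^ (d * (d + 1) + 2) ∧
      Hoare w (coreProg (d * (d + 1) + 2)) (inputState L)
        (timeConst d * ((n + 2 * G.edgeSet.ncard) * (n / q) *
          (Nat.log 2 n + 1) ^ (d * (d + 1))) - 50)
        (fun s => s.reg 0 = n ∧ s.arr 0 n = 2 * G.edgeSet.ncard ∧
          ((s.reg 4 = 1 ∧ G.diam ≤ 2) ∨ (s.reg 4 = 0 ∧ ¬ G.diam ≤ 2))) ∧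
      50 ≤ timeConst d * ((n + 2 * G.edgeSet.ncard) * (n / q) *
          (Nat.log 2 n + 1) ^ (d * (d + 1))) := by
  have : Nonempty (Fin n) := hG.nonempty
  have hn : 0 < n := Fin.pos_iff_nonempty.2 this
  obtain ⟨hW, hWE⟩ := wide_of_le hw
  have hgr := hasGraph_inputState hL
  have hC := closedLists_closedList hL
  obtain ⟨s₁, t₁, hx₁, ht₁, hA₁, hq0, hqn, hnq⟩ :=
    (scaleProg_spec (E := d * (d + 1) + 2) hW hn (by omega) hWE hgr.size).frame
  set q := s₁.reg 1 with hq
  have hqle : q ≤ n := (Nat.le_self_pow (by omega) q).trans hqn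
  have hgr₁ : HasGraph n (closedList L) s₁ := hgr.congr (hA₁.1 0 rfl) (hA₁.2 0 rfl) (hA₁.2 1 rfl)
  have hcost := cost_le (M := n + 2 * G.edgeSet.ncard) (L := Nat.log 2 n + 1) hq0 hqn hn (by omega)
    (by omega)
  refine ⟨q, hq0, hnq, ?_, by omega⟩
  have hrest := (pipelineProg_spec (s := s₁) (S := (2 * q * (Nat.log 2 n + 1) + 1) ^ d)
    (T := ((2 * q * (Nat.log 2 n + 1) + 1) ^ d + 1) ^ d) hW hn hC hgr₁ ?_ hq0 hqle rfl
    (fun l hl hp => centres_length_le hL hd hq0 hl hp)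
    (fun cs _ hcs hS l hl hp => classes_length_le hL hd hcs hS hl hp)
    (Nat.one_le_pow _ _ (by omega)) (Nat.one_le_pow _ _ (by omega))).frame
  · rw [sum_closedList_length hL] at hrest
    refine (Hoare.seq ⟨s₁, t₁, hx₁, ht₁, hrest.mono le_rfl ?_⟩).time (by omega)
    rintro s₂ ⟨hA₂, h4⟩
    rw [allMeet_iff hL hG] at h4
    refine ⟨(hA₂.1 0 rfl).trans hgr₁.size, ?_, h4⟩
    rw [hA₂.2 0 rfl, hA₁.2 0 rfl, ← adjOffset_self hL]
    simp [inputState]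
  · intro a ha
    have e : s₁.arr a = (inputState L).arr a := hA₁.2 a rfl
    rw [e]
    funext i
    simp [inputState, show a ≠ 0 by omega, show a ≠ 1 by omega]

/-- Maximality of the scale, `n < (2 q) ^ E` with `E = d (d + 1) + 2`, gives `n / q ≤ 2 n ^ (1 - 1 /
E)`. The constant `8 * 3 ^ D`, where `D = d (d + 1)`, collects `4` from the edges, `2` from the
scale and `3` from each logarithm. -/
theorem time_le {d n m q : ℕ} (hn : 0 < n) (hm : n ≤ m + 1) (hm' : n = 1 → m = 0)
    (hnq : n < (2 * q) ^ (d * (d + 1) + 2)) :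
    ((timeConst d * ((n + 2 * m) * (n / q) * (Nat.log 2 n + 1) ^ (d * (d + 1))) : ℕ) : ℝ) ≤
      (8 * 3 ^ (d * (d + 1)) * timeConst d : ℝ) *
        ((m : ℝ) * (n : ℝ) ^ (1 - (1 : ℝ) / (d * (d + 1) + 2 : ℕ)) * Real.log n ^ (d * (d + 1))
          + 1) := by
  set D := d * (d + 1) with hD
  have h3 : (1 : ℝ) ≤ 3 ^ D := one_le_pow₀ (by norm_num)
  have hq0 : 0 < q := Nat.pos_of_ne_zero (by rintro rfl; simp at hnq)
  rcases (show n = 1 ∨ 2 ≤ n by omega) with rfl | hn2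
  -- For a single vertex there are no edges and the main term vanishes, so the whole cost is
  -- absorbed by the summand `1` in the bound.
  · have hm0 := hm' rfl
    subst hm0
    have h1q : 1 / q ≤ 1 := Nat.div_le_self 1 q
    have h1 : timeConst d * ((1 + 2 * 0) * (1 / q) * (Nat.log 2 1 + 1) ^ D) ≤ timeConst d := by
      simpa using Nat.mul_le_mul_left (timeConst d) h1q
    calc ((timeConst d * ((1 + 2 * 0) * (1 / q) * (Nat.log 2 1 + 1) ^ D) : ℕ) : ℝ)
        ≤ (timeConst d : ℝ) := by exact_mod_cast h1
      _ ≤ 8 * 3 ^ D * timeConst d := le_mul_of_one_le_left (Nat.cast_nonneg _) (by linarith)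
      _ = _ := by simp
  · have hnR : (0 : ℝ) < n := by exact_mod_cast hn
    have hqR : (0 : ℝ) < q := by exact_mod_cast hq0
    have hE : ((D + 2 : ℕ) : ℝ) ≠ 0 := by positivity
    have hroot : (n : ℝ) ^ ((1 : ℝ) / (D + 2 : ℕ)) ≤ 2 * q := by
      have : (n : ℝ) ≤ (2 * q : ℝ) ^ (D + 2) := by exact_mod_cast hnq.le
      calc (n : ℝ) ^ ((1 : ℝ) / (D + 2 : ℕ)) ≤ ((2 * q : ℝ) ^ (D + 2)) ^ ((1 : ℝ) / (D + 2 : ℕ)) :=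
            Real.rpow_le_rpow hnR.le this (by positivity)
        _ = 2 * q := by
            rw [one_div]
            exact Real.pow_rpow_inv_natCast (by positivity) (by omega)
    have hdiv : ((n / q : ℕ) : ℝ) ≤ 2 * (n : ℝ) ^ (1 - (1 : ℝ) / (D + 2 : ℕ)) := by
      rw [Real.rpow_sub hnR, Real.rpow_one]
      have hp : (0 : ℝ) < (n : ℝ) ^ ((1 : ℝ) / (D + 2 : ℕ)) := Real.rpow_pos_of_pos hnR _
      refine Nat.cast_div_le.trans ?_
      rw [← mul_div_assoc, div_le_div_iff₀ hqR hp]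
      nlinarith
    -- For `n ≥ 2` one has `⌊log₂ n⌋ + 1 ≤ 2 ⌊log₂ n⌋`, and `2 < 3 log 2`.
    have hlog : ((Nat.log 2 n + 1 : ℕ) : ℝ) ≤ 3 * Real.log n := by
      have h1 : 1 ≤ Nat.log 2 n := Nat.log_pos (by norm_num) hn2
      have h2 : ((2 ^ Nat.log 2 n : ℕ) : ℝ) ≤ n := by
        exact_mod_cast Nat.pow_log_le_self 2 (by omega)
      have h4 := Real.log_le_log (by positivity) h2
      push_cast at h4
      rw [Real.log_pow] at h4
      have h5 := Real.log_two_gt_d9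
      have h6 : (1 : ℝ) ≤ Nat.log 2 n := by exact_mod_cast h1
      push_cast
      nlinarith
    -- From `n ≤ m + 1` and `n ≥ 2` follows `n ≤ 2 m`; this is where connectedness enters the time
    -- bound.
    have hM : ((n + 2 * m : ℕ) : ℝ) ≤ 4 * m := by
      have : n + 2 * m ≤ 4 * m := by omega
      exact_mod_cast this
    have hlp : ((Nat.log 2 n + 1 : ℕ) : ℝ) ^ D ≤ (3 * Real.log n) ^ D :=
      pow_le_pow_left₀ (Nat.cast_nonneg _) hlog D
    have hprod : ((n + 2 * m : ℕ) : ℝ) * ((n / q : ℕ) : ℝ) * ((Nat.log 2 n + 1 : ℕ) : ℝ) ^ D ≤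
        4 * m * (2 * (n : ℝ) ^ (1 - (1 : ℝ) / (D + 2 : ℕ))) * (3 * Real.log n) ^ D := by
      gcongr
    rw [Nat.cast_mul, Nat.cast_mul, Nat.cast_mul, Nat.cast_pow]
    calc (timeConst d : ℝ) *
          (((n + 2 * m : ℕ) : ℝ) * ((n / q : ℕ) : ℝ) * ((Nat.log 2 n + 1 : ℕ) : ℝ) ^ D)
        ≤ timeConst d *
          (4 * m * (2 * (n : ℝ) ^ (1 - (1 : ℝ) / (D + 2 : ℕ))) * (3 * Real.log n) ^ D) := by
          gcongr
      _ = (8 * 3 ^ D * timeConst d : ℝ) *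
          ((m : ℝ) * (n : ℝ) ^ (1 - (1 : ℝ) / (D + 2 : ℕ)) * Real.log n ^ D) := by
          rw [mul_pow]; ring
      _ ≤ _ := by
          gcongr
          linarith

/-- Both decision problems share the core computation and differ only in the expression `e` that
turns its final state into the answer. -/
theorem decidesWithin_of_answer {d : ℕ} (Q : ∀ {n : ℕ}, SimpleGraph (Fin n) → Prop) (e : Exp)
    (he : (Prog.assign 0 e).maxTime ≤ 50)
    (hok : ∀ {n w : ℕ} {G : SimpleGraph (Fin n)} {s : State}, Wide n w → G.Connected →
      s.reg 0 = n → s.arr 0 n = 2 * G.edgeSet.ncard → 2 * G.edgeSet.ncard ≤ n * n →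
      ((s.reg 4 = 1 ∧ G.diam ≤ 2) ∨ (s.reg 4 = 0 ∧ ¬ G.diam ≤ 2)) →
      e.ok w s ∧ (Q G → e.val s = 1) ∧ (¬ Q G → e.val s = 0)) :
    DecidesWithin (.seq (coreProg (d * (d + 1) + 2)) (.assign 0 e))
      (fun G => G.Connected ∧ graphVCDim G ≤ d) Q
      (fun n m => (8 * 3 ^ (d * (d + 1)) * timeConst d : ℝ) *
        ((m : ℝ) * (n : ℝ) ^ (1 - (1 : ℝ) / (d * (d + 1) + 2 : ℕ)) * Real.log n ^ (d * (d + 1))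
          + 1)) := by
  refine ⟨d * (d + 1) + 2 + 8, fun n G hG L hL w hw => ?_⟩
  obtain ⟨hconn, hd⟩ := hG
  have hne : Nonempty (Fin n) := hconn.nonempty
  have hn : 0 < n := Fin.pos_iff_nonempty.2 hne
  obtain ⟨q, hq0, hnq, hH, h50⟩ := coreProg_spec hL hconn hd hw
  have hW := (wide_of_le hw).1
  have hmn : 2 * G.edgeSet.ncard ≤ n * n := by
    have h1 := (hasGraph_inputState hL).offset_le n le_rfl
    rw [← adjOffset_self hL]
    simpa [inputState] using h1
  have hH' := Hoare.seq (hH.mono le_rfl fun s hs =>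
    Hoare.block (w := w) (P := .assign 0 e) (s := s) (T := 50)
      (Q := fun s => (Q G → s.reg 0 = 1) ∧ (¬ Q G → s.reg 0 = 0)) he (by
        obtain ⟨h1, h2, h3⟩ := hok hW hconn hs.1 hs.2.1 hmn hs.2.2
        exact ⟨h1, fun h => by simpa using h2 h, fun h => by simpa using h3 h⟩))
  obtain ⟨s, t, hx, ht, hs⟩ := hH'
  refine ⟨s, t, hx, ?_, hs⟩
  refine le_trans ?_ (time_le (q := q) hn ?_ ?_ hnq)
  · exact_mod_cast ht.trans (by omega)
  · have := hconn.card_vert_le_card_edgeSet_add_one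
    simpa [Nat.card_coe_set_eq] using this
  · rintro rfl
    have : 2 * G.edgeSet.ncard = 1 * (1 - 1) := eq_top_iff_ncard.1 (Subsingleton.elim _ _)
    omega

theorem theorem1 (d : ℕ) :
    ∃ ε : ℝ, 0 < ε ∧ ε < 1 ∧ ∃ (C : ℝ) (k : ℕ),
      (∃ P : WordRAM.Prog,
        DecidesWithin P (fun G => G.Connected ∧ graphVCDim G ≤ d) (fun G => G.diam = 2)
          (fun n m => C * ((m : ℝ) * (n : ℝ) ^ (1 - ε) * Real.log n ^ k + 1))) ∧
      (∃ P : WordRAM.Prog,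
        DecidesWithin P (fun G => G.Connected ∧ graphVCDim G ≤ d) (fun G => G.diam ≤ 2)
          (fun n m => C * ((m : ℝ) * (n : ℝ) ^ (1 - ε) * Real.log n ^ k + 1))) := by
  -- For diameter exactly two, the answer in register `4` is multiplied by the indicator that `2 m ≠
  -- n (n - 1)`, where `2 m` is read from the last offset cell.
  refine ⟨1 / (d * (d + 1) + 2 : ℕ), by positivity, ?_, _, _, ⟨_, decidesWithin_of_answer (d := d)
    (fun G => G.diam = 2) (mulE (.reg 4) (subE (.lit 1) (eqE (.get 0 (.reg 0))
      (mulE (.reg 0) (subE (.reg 0) (.lit 1)))))) (by decide) ?_⟩,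
    ⟨_, decidesWithin_of_answer (fun G => G.diam ≤ 2) (.reg 4) (by decide) ?_⟩⟩
  · rw [div_lt_one (by positivity)]
    exact_mod_cast (by omega : 1 < d * (d + 1) + 2)
  · intro n w G s hw hG h0 ha hmn h4
    have hW : 4 * (n * n) + 16 * n + 16 < 2 ^ w := hw
    have hnn : n * (n - 1) ≤ n * n := Nat.mul_le_mul_left _ (by omega)
    have h4le : s.reg 4 ≤ 1 := by omega
    set b := (eqE (.get 0 (.reg 0)) (mulE (.reg 0) (subE (.reg 0) (.lit 1)))).val s with hb
    have hbv : b = if 2 * G.edgeSet.ncard = n * (n - 1) then 1 else 0 := by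
      simp [hb, Exp.val, BinOp.val, h0, ha]
    have hprod : s.reg 4 * (1 - b) ≤ 1 := by
      simpa using Nat.mul_le_mul h4le (Nat.sub_le 1 b)
    refine ⟨⟨trivial, ⟨show 1 < 2 ^ w by omega, ⟨trivial, ⟨trivial, ⟨trivial,
      show 1 < 2 ^ w by omega, ?_⟩, ?_⟩, hw.pos⟩, ?_⟩, ?_⟩, ?_⟩
    · simp only [BinOp.ok, Exp.val, h0]; omega
    · simp only [BinOp.ok, BinOp.val, Exp.val, h0]; omega
    · show 1 - b < 2 ^ w
      omega
    · show s.reg 4 * (1 - b) < 2 ^ w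
      omega
    · show (G.diam = 2 → s.reg 4 * (1 - b) = 1) ∧ (G.diam ≠ 2 → s.reg 4 * (1 - b) = 0)
      rw [Ne, diam_eq_two_iff hG, hbv]
      rcases h4 with ⟨h, h'⟩ | ⟨h, h'⟩
      · simp only [h, h', true_and, one_mul]
        split_ifs with h1 <;> simp [h1]
      · simp [h, h']
  · intro n w G s _ _ _ _ _ h4
    refine ⟨trivial, fun h => ?_, fun h => ?_⟩
    · exact (h4.resolve_right fun h' => h'.2 h).1
    · exact (h4.resolve_left fun h' => h h'.2).1
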